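/- Let $n\ge 1$ be odd, let $q\in\mathbb{C}$ be a primitive $n$-th root of unity and put $p=q^2$, which is again a primitive $n$-th root of unity. Let $H_n(p)$ be the Taft algebra over $\mathbb{C}$: it is generated by $g,x$ with $g^n=1$, $x^n=0$, $gx=p\,xg$, $\Delta(g)=g\otimes g$, $\Delta(x)=x\otimes g+1\otimes x$, $\varepsilon(g)=1$, $\varepsilon(x)=0$, $S(g)=g^{-1}$, $S(x)=-xg^{-1}$. Let $D(H_n(p))=H_n(p)^{*\mathrm{cop}}\bowtie H_n(p)$ be its Drinfeld double, with product $(f\bowtie h)(f'\bowtie h')=f\,f'(S^{-1}(h_3)\,?\,h_1)\bowtie h_2h'$. Let $H_n(1,p)$ be the Hopf algebra over $\mathbb{C}$ generated by $a,b,c,d$ with relations $$a^n=d^n=0,\quad b^n=c^n=1,\quad ba=p\,ab,\quad db=p\,bd,\quad ca=p\,ac,\quad dc=p\,cd,\quad bc=cb,\quad da-p\,ad=1-bc,$$ coproduct $\Delta(a)=a\otimes b+1\otimes a$, $\Delta(b)=b\otimes b$, $\Delta(c)=c\otimes c$, $\Delta(d)=d\otimes c+1\otimes d$, counit $\varepsilon(a)=\varepsilon(d)=0$,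 $\varepsilon(b)=\varepsilon(c)=1$, and antipode $S(a)=-ab^{-1}$, $S(b)=b^{-1}$, $S(c)=c^{-1}$, $S(d)=-dc^{-1}$. Write $(i)_p=1+p+\dots+p^{i-1}$, $(i)!_p=(1)_p(2)_p\cdots(i)_p$ and $\alpha_i(l)=(i)_p(1-p^{\,i-l})$. For $1\le l\le n$ and $r\in\mathbb{Z}$ let $V(l,r)$ be the $H_n(1,p)$-module with basis $v_1,\dots,v_l$ and $$a v_i=v_{i+1}\ (i<l),\quad a v_l=0,\quad b v_i=p^{\,r+i-1}v_i,\quad c v_i=p^{\,i-(r+l)}v_i,\quad d v_i=\alpha_{i-1}(l)v_{i-1}\ (i>1),\quad d v_1=0.$$ For a Hopf algebra $H$ over $\mathbb{C}$ with antipode $S$ and a simple finite-dimensional $H$-module $V$ with representation $\varphi:H\to\mathrm{End}(V)$, the trace invariant $\mu(V)$ is $\mathrm{Tr}(S_V)$ if $V\cong V^*$ as $H$-modules, where $S_V:\mathrm{End}(V)\to\mathrm{End}(V)$ is the unique linear map with $S_V(\varphi(h))=\varphi(S(h))$ for all $h\in H$; otherwise $\mu(V)=0$. Here $H$ acts on $V^*$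 by $(hf)(v)=f(S(h)v)$. Then: (1) There is an isomorphism of Hopf algebras $D(H_n(p))\cong H_n(1,p)$ given, for $0\le s,t,i,j<n$, by $$\overline{x^sg^t}\bowtie x^ig^j\longmapsto\sum_{0\le m<n}\frac{1}{n\,(s)!_p}\,p^{-tm}\,c^md^sa^ib^j,$$ where $\{\overline{x^sg^t}\}$ is the basis of $H_n(p)^*$ dual to the basis $\{x^sg^t\}$ of $H_n(p)$. (2) For all $1\le l\le n$ and $r\in\mathbb{Z}$, the $l$-dimensional module $V(l,r)$ is simple and $$\mu(V(l,r))=\begin{cases}\displaystyle\sum_{j=1}^{l}(-q)^{\,l-2j+1}&\text{if } 2r\equiv 1-l \pmod n,\\ 0&\text{otherwise.}\end{cases}$$ -/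

import Mathlib

open scoped TensorProduct
open Module (Dual)

namespace TaftDouble

/-! ### Gaussian binomial coefficients (needed for the coproducts to be well defined) -/

section Gauss

/-- Gaussian binomial coefficients, by the `q`-Pascal recursion. -/
noncomputable def gauss (q : ℂ) : ℕ → ℕ → ℂ
  | _, 0 => 1
  | 0, _ + 1 => 0
  | m + 1, k + 1 => gauss q m k + q ^ (k + 1) * gauss q m (k + 1)

theorem gauss_zero_right (q : ℂ) (m : ℕ) : gauss q m 0 = 1 := by
  cases m <;> simp [gauss]

theorem gauss_of_lt (q : ℂ) (m : ℕ) : ∀ k, m < k → gauss q m k = 0 := by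
  induction m with
  | zero => intro k hk; obtain ⟨j, rfl⟩ := Nat.exists_eq_succ_of_ne_zero hk.ne'; simp [gauss]
  | succ m ih =>
    intro k hk
    obtain ⟨j, rfl⟩ := Nat.exists_eq_succ_of_ne_zero (Nat.ne_of_gt (by omega : 0 < k))
    simp [gauss, ih j (by omega), ih (j + 1) (by omega)]

theorem gauss_self (q : ℂ) (m : ℕ) : gauss q m m = 1 := by
  induction m with
  | zero => simp [gauss]
  | succ m ih => simp [gauss, ih, gauss_of_lt q m (m + 1) (by omega)]

theorem gauss_rec (q : ℂ) (m : ℕ) :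
    ∀ k, q ^ k * (q ^ (k + 1) - 1) * gauss q m (k + 1) = (q ^ m - q ^ k) * gauss q m k := by
  induction m with
  | zero =>
    intro k
    cases k <;> simp [gauss]
  | succ m ih =>
    intro k
    cases k with
    | zero =>
      have h := ih 0
      simp only [gauss, gauss_zero_right] at h ⊢
      linear_combination q * h
    | succ k =>
      have h1 := ih k
      have h2 := ih (k + 1)
      simp only [gauss]
      linear_combination q ^ (k + 2) * h2 + q * h1

theorem gauss_eq_zero {q : ℂ} {n : ℕ} (hq : IsPrimitiveRoot q n) (hn : n ≠ 0) (k : ℕ)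
    (hk : k + 1 < n) : gauss q n (k + 1) = 0 := by
  induction k with
  | zero =>
    have h := gauss_rec q n 0
    have h1 : q ^ (0 + 1) - 1 ≠ 0 := sub_ne_zero.2 (hq.pow_ne_one_of_pos_of_lt (by omega) hk)
    simpa [hq.pow_eq_one, sub_eq_zero, hq.ne_one (by omega : 1 < n)] using h
  | succ k ih =>
    have h := gauss_rec q n (k + 1)
    rw [ih (by omega), mul_zero] at h
    have h1 : q ^ (k + 1 + 1) - 1 ≠ 0 := sub_ne_zero.2 (hq.pow_ne_one_of_pos_of_lt (by omega) hk)
    have h2 : q ^ (k + 1) ≠ 0 := pow_ne_zero _ (hq.ne_zero hn)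
    simpa [h1, hq.ne_zero hn] using h

variable {A : Type*} [Ring A] [Algebra ℂ A]

theorem qcomm_pow {q : ℂ} {X Y : A} (h : Y * X = q • (X * Y)) (k : ℕ) :
    Y * X ^ k = q ^ k • (X ^ k * Y) := by
  induction k with
  | zero => simp
  | succ k ih =>
    rw [pow_succ, ← mul_assoc, ih, smul_mul_assoc, mul_assoc, h, mul_smul_comm, smul_smul,
      ← mul_assoc, ← pow_succ, ← pow_succ]

theorem qcomm_add_pow {q : ℂ} {X Y : A} (h : Y * X = q • (X * Y)) (m : ℕ) :
    (X + Y) ^ m = ∑ k ∈ Finset.range (m + 1), gauss q m k • (X ^ k * Y ^ (m - k)) := by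
  induction m with
  | zero => simp [gauss]
  | succ m ih =>
    have hX : ∀ k ∈ Finset.range (m + 1), X * (gauss q m k • (X ^ k * Y ^ (m - k))) =
        gauss q m k • (X ^ (k + 1) * Y ^ (m + 1 - (k + 1))) := by
      intro k _
      rw [mul_smul_comm, ← mul_assoc, ← pow_succ', Nat.add_sub_add_right]
    have hY : ∀ k ∈ Finset.range (m + 1), Y * (gauss q m k • (X ^ k * Y ^ (m - k))) =
        (q ^ k * gauss q m k) • (X ^ k * Y ^ (m + 1 - k)) := by
      intro k hk
      have hk' : m + 1 - k = (m - k) + 1 := by have := Finset.mem_range.1 hk; omega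
      rw [mul_smul_comm, ← mul_assoc, qcomm_pow h, smul_mul_assoc, smul_smul, mul_assoc,
        ← pow_succ', hk', mul_comm]
    rw [pow_succ', ih, add_mul, Finset.mul_sum, Finset.mul_sum, Finset.sum_congr rfl hX,
      Finset.sum_congr rfl hY, Finset.sum_range_succ' _ (m + 1)]
    simp only [gauss, add_smul, Finset.sum_add_distrib]
    rw [add_assoc]
    congr 1
    rw [Finset.sum_range_succ' _ m, Finset.sum_range_succ _ m,
      gauss_of_lt q m (m + 1) (by omega)]
    simp [gauss_zero_right]

/-- The `q`-binomial theorem at a primitive `n`-th root of unity. -/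
theorem qcomm_add_pow_root {q : ℂ} {n : ℕ} (hq : IsPrimitiveRoot q n) (hn : n ≠ 0) {X Y : A}
    (h : Y * X = q • (X * Y)) : (X + Y) ^ n = X ^ n + Y ^ n := by
  obtain ⟨m, rfl⟩ := Nat.exists_eq_succ_of_ne_zero hn
  rw [qcomm_add_pow h, Finset.sum_range_succ, Finset.sum_range_succ']
  rw [Finset.sum_eq_zero (fun k hk => ?_)]
  · simp [gauss_zero_right, gauss_self, add_comm]
  · rw [gauss_eq_zero hq hn k (by have := Finset.mem_range.1 hk; omega), zero_smul]

/-- `(xy)^k` is a multiple of `x^k y^k` for `q`-commuting elements. -/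
theorem qcomm_mul_pow {q : ℂ} {X Y : A} (h : Y * X = q • (X * Y)) (k : ℕ) :
    ∃ t : ℂ, (X * Y) ^ k = t • (X ^ k * Y ^ k) := by
  induction k with
  | zero => exact ⟨1, by simp⟩
  | succ k ih =>
    obtain ⟨t, ht⟩ := ih
    refine ⟨t * q ^ k, ?_⟩
    rw [pow_succ', ht, mul_smul_comm, mul_assoc, ← mul_assoc Y, qcomm_pow h, smul_mul_assoc,
      mul_smul_comm, smul_smul, mul_assoc, ← pow_succ', ← mul_assoc, ← pow_succ']

/-- If `u` `q`-commutes with `X` and `u ^ n = 1`, then `u⁻¹ = u ^ (n - 1)` `q⁻¹`-commutes. -/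
theorem qcomm_inv {q : ℂ} {n : ℕ} (hq : IsPrimitiveRoot q n) (hn : n ≠ 0) {X u : A}
    (h : u * X = q • (X * u)) : X * u ^ (n - 1) = q • (u ^ (n - 1) * X) := by
  have h2 : ∀ k, u ^ k * X = q ^ k • (X * u ^ k) := by
    intro k
    induction k with
    | zero => simp
    | succ k ih =>
      rw [pow_succ, mul_assoc, h, mul_smul_comm, ← mul_assoc, ih, smul_mul_assoc, smul_smul,
        mul_assoc, mul_comm q, ← pow_succ]
  rw [h2, smul_smul, ← pow_succ', Nat.sub_add_cancel (Nat.one_le_iff_ne_zero.2 hn),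
    hq.pow_eq_one, one_smul]

end Gauss

/-! ### A criterion for the antipode -/

section Antipode

variable {A : Type*} [Ring A] [Bialgebra ℂ A]

/-- The linear map underlying an algebra homomorphism into the opposite algebra. -/
noncomputable def unopLin (S : A →ₐ[ℂ] Aᵐᵒᵖ) : A →ₗ[ℂ] A :=
  (MulOpposite.opLinearEquiv ℂ).symm.toLinearMap ∘ₗ S.toLinearMap

@[simp] theorem unopLin_apply (S : A →ₐ[ℂ] Aᵐᵒᵖ) (x : A) :
    unopLin S x = MulOpposite.unop (S x) := rfl

theorem left_antipode_mul (S : A →ₐ[ℂ] Aᵐᵒᵖ) (t : A ⊗[ℂ] A) (r : ℂ)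
    (ht : LinearMap.mul' ℂ A ((unopLin S).rTensor A t) = algebraMap ℂ A r) (u : A ⊗[ℂ] A) :
    LinearMap.mul' ℂ A ((unopLin S).rTensor A (t * u)) =
      r • LinearMap.mul' ℂ A ((unopLin S).rTensor A u) := by
  induction u with
  | zero => simp
  | add x y hx hy => simp [mul_add, hx, hy]
  | tmul c d =>
    have key : ∀ t : A ⊗[ℂ] A, LinearMap.mul' ℂ A ((unopLin S).rTensor A (t * (c ⊗ₜ d))) =
        unopLin S c * LinearMap.mul' ℂ A ((unopLin S).rTensor A t) * d := by
      intro t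
      induction t with
      | zero => simp
      | add x y hx hy => simp only [add_mul, map_add, hx, hy, mul_add]
      | tmul a b => simp [mul_assoc]
    rw [key, ht, ← Algebra.commutes, mul_assoc, ← Algebra.smul_def]
    simp

theorem right_antipode_mul (S : A →ₐ[ℂ] Aᵐᵒᵖ) (u : A ⊗[ℂ] A) (r : ℂ)
    (hu : LinearMap.mul' ℂ A ((unopLin S).lTensor A u) = algebraMap ℂ A r) (t : A ⊗[ℂ] A) :
    LinearMap.mul' ℂ A ((unopLin S).lTensor A (t * u)) =
      r • LinearMap.mul' ℂ A ((unopLin S).lTensor A t) := by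
  induction t with
  | zero => simp
  | add x y hx hy => simp [add_mul, hx, hy]
  | tmul c d =>
    have key : ∀ u : A ⊗[ℂ] A, LinearMap.mul' ℂ A ((unopLin S).lTensor A ((c ⊗ₜ d) * u)) =
        c * LinearMap.mul' ℂ A ((unopLin S).lTensor A u) * unopLin S d := by
      intro u
      induction u with
      | zero => simp
      | add x y hx hy => simp only [mul_add, map_add, hx, hy, add_mul]
      | tmul a b => simp [mul_assoc]
    rw [key, hu, ← Algebra.commutes, mul_assoc, ← Algebra.smul_def]
    simp

/-- A bialgebra generated by a set on which an anti-multiplicative map satisfies the antipode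
identities is a Hopf algebra. -/
noncomputable abbrev hopfOfAntiHom (S : A →ₐ[ℂ] Aᵐᵒᵖ) (s : Set A)
    (hs : Algebra.adjoin ℂ s = ⊤)
    (hl : ∀ x ∈ s, LinearMap.mul' ℂ A ((unopLin S).rTensor A (Coalgebra.comul x)) =
      algebraMap ℂ A (Coalgebra.counit x))
    (hr : ∀ x ∈ s, LinearMap.mul' ℂ A ((unopLin S).lTensor A (Coalgebra.comul x)) =
      algebraMap ℂ A (Coalgebra.counit x)) : HopfAlgebra ℂ A where
  antipode := unopLin S
  mul_antipode_rTensor_comul := by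
    ext x
    have hx : x ∈ Algebra.adjoin ℂ s := hs ▸ Algebra.mem_top
    simp only [LinearMap.comp_apply, Algebra.linearMap_apply]
    induction hx using Algebra.adjoin_induction with
    | mem x hx => exact hl x hx
    | algebraMap r => simp [Algebra.TensorProduct.algebraMap_apply]
    | add x y _ _ hx hy => simp only [map_add, hx, hy]
    | mul x y _ _ hx hy =>
      rw [Bialgebra.comul_mul, left_antipode_mul S _ _ hx, hy, Bialgebra.counit_mul, map_mul,
        Algebra.smul_def]
  mul_antipode_lTensor_comul := by
    ext x
    have hx : x ∈ Algebra.adjoin ℂ s := hs ▸ Algebra.mem_top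
    simp only [LinearMap.comp_apply, Algebra.linearMap_apply]
    induction hx using Algebra.adjoin_induction with
    | mem x hx => exact hr x hx
    | algebraMap r => simp [Algebra.TensorProduct.algebraMap_apply]
    | add x y _ _ hx hy => simp only [map_add, hx, hy]
    | mul x y _ _ hx hy =>
      rw [Bialgebra.comul_mul, right_antipode_mul S _ _ hy, hx, Bialgebra.counit_mul, map_mul,
        Algebra.smul_def, Algebra.commutes]

end Antipode

/-! ### The Taft algebra `H_n(q)` -/

section Taft

/-- The defining relations of the Taft algebra `H_n(q)`. -/
structure TaftRels (n : ℕ) (q : ℂ) {B : Type*} [Ring B] [Algebra ℂ B] (g x : B) : Prop where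
  g_pow : g ^ n = 1
  x_pow : x ^ n = 0
  gx : g * x = q • (x * g)

inductive TaftGen
  | g
  | x

inductive TaftRel (n : ℕ) (q : ℂ) : FreeAlgebra ℂ TaftGen → FreeAlgebra ℂ TaftGen → Prop
  | g_pow : TaftRel n q (FreeAlgebra.ι ℂ .g ^ n) 1
  | x_pow : TaftRel n q (FreeAlgebra.ι ℂ .x ^ n) 0
  | gx : TaftRel n q (FreeAlgebra.ι ℂ .g * FreeAlgebra.ι ℂ .x)
      (q • (FreeAlgebra.ι ℂ .x * FreeAlgebra.ι ℂ .g))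

/-- The Taft algebra `H_n(q)`, `q` a primitive `n`-th root of unity, generated by `g`, `x` with
`g ^ n = 1`, `x ^ n = 0`, `g x = q x g`. -/
def TaftAlgebra {n : ℕ} {q : ℂ} (_hq : IsPrimitiveRoot q n) : Type := RingQuot (TaftRel n q)

namespace TaftAlgebra

variable {n : ℕ} {q : ℂ} (hq : IsPrimitiveRoot q n)

noncomputable instance : Ring (TaftAlgebra hq) := inferInstanceAs (Ring (RingQuot (TaftRel n q)))

noncomputable instance : Algebra ℂ (TaftAlgebra hq) :=
  inferInstanceAs (Algebra ℂ (RingQuot (TaftRel n q)))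

noncomputable def mk : FreeAlgebra ℂ TaftGen →ₐ[ℂ] TaftAlgebra hq :=
  RingQuot.mkAlgHom ℂ (TaftRel n q)

noncomputable def g : TaftAlgebra hq := mk hq (FreeAlgebra.ι ℂ .g)

noncomputable def x : TaftAlgebra hq := mk hq (FreeAlgebra.ι ℂ .x)

theorem rels : TaftRels n q (g hq) (x hq) where
  g_pow := by
    rw [g, ← map_pow, ← map_one (mk hq)]; exact RingQuot.mkAlgHom_rel ℂ .g_pow
  x_pow := by
    rw [x, ← map_pow, ← map_zero (mk hq)]; exact RingQuot.mkAlgHom_rel ℂ .x_pow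
  gx := by
    rw [g, x, ← map_mul, ← map_mul, ← map_smul]; exact RingQuot.mkAlgHom_rel ℂ .gx

variable {B : Type*} [Ring B] [Algebra ℂ B]

/-- The universal property of the presentation. -/
noncomputable def lift {g' x' : B} (h : TaftRels n q g' x') : TaftAlgebra hq →ₐ[ℂ] B :=
  RingQuot.liftAlgHom ℂ ⟨FreeAlgebra.lift ℂ (fun | .g => g' | .x => x'), by
    intro u v huv
    induction huv with
    | g_pow => simpa using h.g_pow
    | x_pow => simpa using h.x_pow
    | gx => simpa using h.gx⟩

@[simp] theorem lift_g {g' x' : B} (h : TaftRels n q g' x') : lift hq h (g hq) = g' :=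
  (RingQuot.liftAlgHom_mkAlgHom_apply ℂ _ _ _).trans (by simp)

@[simp] theorem lift_x {g' x' : B} (h : TaftRels n q g' x') : lift hq h (x hq) = x' :=
  (RingQuot.liftAlgHom_mkAlgHom_apply ℂ _ _ _).trans (by simp)

variable {hq} in
theorem hom_ext {φ ψ : TaftAlgebra hq →ₐ[ℂ] B} (hg : φ (g hq) = ψ (g hq))
    (hx : φ (x hq) = ψ (x hq)) : φ = ψ := by
  refine RingQuot.ringQuot_ext' ℂ φ ψ (FreeAlgebra.hom_ext (funext fun i => ?_))
  cases i
  · exact hg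
  · exact hx

theorem adjoin_eq_top : Algebra.adjoin ℂ {g hq, x hq} = ⊤ := by
  refine top_unique fun y hy => ?_
  clear hy
  obtain ⟨z, rfl⟩ := RingQuot.mkAlgHom_surjective ℂ (TaftRel n q) y
  change mk hq z ∈ _
  induction z using FreeAlgebra.induction with
  | grade0 r => rw [AlgHom.commutes]; exact Subalgebra.algebraMap_mem _ r
  | grade1 i =>
    refine Algebra.subset_adjoin ?_
    cases i
    · exact Or.inl rfl
    · exact Or.inr rfl
  | mul a b ha hb => rw [map_mul]; exact Subalgebra.mul_mem _ ha hb
  | add a b ha hb => rw [map_add]; exact Subalgebra.add_mem _ ha hb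

variable [NeZero n]

theorem g_mul_inv : g hq * g hq ^ (n - 1) = 1 := by
  rw [← pow_succ', Nat.sub_add_cancel NeZero.one_le, (rels hq).g_pow]

theorem inv_mul_g : g hq ^ (n - 1) * g hq = 1 := by
  rw [← pow_succ, Nat.sub_add_cancel NeZero.one_le, (rels hq).g_pow]

theorem comul_rels : TaftRels n q (g hq ⊗ₜ[ℂ] g hq) (x hq ⊗ₜ[ℂ] g hq + 1 ⊗ₜ[ℂ] x hq) where
  g_pow := by simp [Algebra.TensorProduct.tmul_pow, (rels hq).g_pow, Algebra.TensorProduct.one_def]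
  x_pow := by
    rw [add_comm, qcomm_add_pow_root hq (NeZero.ne n)]
    · simp [Algebra.TensorProduct.tmul_pow, (rels hq).x_pow]
    · simp [(rels hq).gx]
  gx := by
    simp [mul_add, add_mul, (rels hq).gx, TensorProduct.smul_tmul']

theorem counit_rels : TaftRels n q (1 : ℂ) 0 where
  g_pow := one_pow n
  x_pow := zero_pow (NeZero.ne n)
  gx := by simp

/-- The coproduct: `Δ g = g ⊗ g`, `Δ x = x ⊗ g + 1 ⊗ x`; the counit: `ε g = 1`, `ε x = 0`. -/
noncomputable instance : Bialgebra ℂ (TaftAlgebra hq) :=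
  Bialgebra.ofAlgHom (lift hq (comul_rels hq)) (lift hq counit_rels)
    (hom_ext (by simp) (by simp [TensorProduct.tmul_add, TensorProduct.add_tmul,
      Algebra.TensorProduct.one_def, add_assoc]))
    (hom_ext (by simp) (by simp))
    (hom_ext (by simp) (by simp))

@[simp] theorem comul_g : Coalgebra.comul (R := ℂ) (g hq) = g hq ⊗ₜ[ℂ] g hq :=
  lift_g hq (comul_rels hq)

@[simp] theorem comul_x :
    Coalgebra.comul (R := ℂ) (x hq) = x hq ⊗ₜ[ℂ] g hq + 1 ⊗ₜ[ℂ] x hq :=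
  lift_x hq (comul_rels hq)

@[simp] theorem counit_g : Coalgebra.counit (R := ℂ) (g hq) = 1 := lift_g hq counit_rels

@[simp] theorem counit_x : Coalgebra.counit (R := ℂ) (x hq) = 0 := lift_x hq counit_rels

open MulOpposite in
theorem antipode_rels : TaftRels n q (op (g hq ^ (n - 1))) (op (-(x hq * g hq ^ (n - 1)))) where
  g_pow := by
    rw [← op_pow, ← pow_mul, mul_comm, pow_mul, (rels hq).g_pow, one_pow, op_one]
  x_pow := by
    obtain ⟨t, ht⟩ := qcomm_mul_pow (q := q⁻¹) (X := x hq) (Y := g hq ^ (n - 1)) (by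
      rw [qcomm_inv hq (NeZero.ne n) (rels hq).gx, smul_smul, inv_mul_cancel₀
        (hq.ne_zero (NeZero.ne n)), one_smul]) n
    rw [← op_pow, neg_pow, ht, (rels hq).x_pow]
    simp
  gx := by
    rw [← op_mul, ← op_mul, ← op_smul, neg_mul, mul_neg, ← mul_assoc,
      qcomm_inv hq (NeZero.ne n) (rels hq).gx, smul_neg, smul_mul_assoc]

/-- The antipode: `S g = g⁻¹`, `S x = - x g⁻¹`. -/
noncomputable instance : HopfAlgebra ℂ (TaftAlgebra hq) :=
  hopfOfAntiHom (lift hq (antipode_rels hq)) {g hq, x hq} (adjoin_eq_top hq)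
    (by rintro y (rfl | rfl) <;> simp [inv_mul_g, mul_assoc])
    (by rintro y (rfl | rfl) <;> simp [g_mul_inv])

theorem antipode_g : HopfAlgebra.antipode ℂ (g hq) = g hq ^ (n - 1) :=
  congrArg MulOpposite.unop (lift_g hq (antipode_rels hq))

theorem antipode_x : HopfAlgebra.antipode ℂ (x hq) = -(x hq * g hq ^ (n - 1)) :=
  congrArg MulOpposite.unop (lift_x hq (antipode_rels hq))

/-- The antipode of the Taft algebra is bijective. -/
theorem antipode_surjective :
    Function.Surjective (HopfAlgebra.antipode ℂ (A := TaftAlgebra hq)) := by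
  have hpow : ∀ k, HopfAlgebra.antipode ℂ (g hq ^ k) = (g hq ^ (n - 1)) ^ k := by
    intro k
    induction k with
    | zero => simp
    | succ k ih =>
      rw [pow_succ, HopfAlgebra.antipode_mul_antidistrib, ih, antipode_g, pow_succ']
  have hg' : HopfAlgebra.antipode ℂ (g hq ^ (n - 1)) = g hq := by
    rw [hpow]
    calc (g hq ^ (n - 1)) ^ (n - 1)
        = (g hq ^ (n - 1)) ^ (n - 1) * (g hq ^ (n - 1) * g hq) := by rw [inv_mul_g, mul_one]
      _ = (g hq ^ n) ^ (n - 1) * g hq := by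
        rw [← mul_assoc, ← pow_succ, Nat.sub_add_cancel NeZero.one_le, ← pow_mul, ← pow_mul,
          mul_comm n]
      _ = g hq := by rw [(rels hq).g_pow, one_pow, one_mul]
  intro y
  have hy : y ∈ Algebra.adjoin ℂ {g hq, x hq} := adjoin_eq_top hq ▸ Algebra.mem_top
  induction hy using Algebra.adjoin_induction with
  | mem y hy =>
    rcases hy with rfl | rfl
    · exact ⟨_, hg'⟩
    · refine ⟨-(g hq ^ (n - 1) * x hq), ?_⟩
      rw [map_neg, HopfAlgebra.antipode_mul_antidistrib, hg', antipode_x, neg_mul, neg_neg,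
        mul_assoc, inv_mul_g, mul_one]
  | algebraMap r => exact ⟨algebraMap ℂ _ r, by simp [Algebra.algebraMap_eq_smul_one]⟩
  | add a b _ _ ha hb =>
    obtain ⟨a, rfl⟩ := ha
    obtain ⟨b, rfl⟩ := hb
    exact ⟨a + b, map_add _ _ _⟩
  | mul a b _ _ ha hb =>
    obtain ⟨a, rfl⟩ := ha
    obtain ⟨b, rfl⟩ := hb
    exact ⟨b * a, HopfAlgebra.antipode_mul_antidistrib _ _⟩

/-- The Taft algebra is spanned by the monomials `x ^ i g ^ j` with `i, j < n`. -/
theorem span_eq_top : Submodule.span ℂ (Set.range fun p : Fin n × Fin n =>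
    x hq ^ (p.1 : ℕ) * g hq ^ (p.2 : ℕ)) = ⊤ := by
  set M := Submodule.span ℂ (Set.range fun p : Fin n × Fin n =>
    x hq ^ (p.1 : ℕ) * g hq ^ (p.2 : ℕ)) with hM
  have mono : ∀ i j : ℕ, x hq ^ i * g hq ^ j ∈ M := by
    intro i j
    by_cases hi : i < n
    · have hg : g hq ^ j = g hq ^ (j % n) := by
        conv_lhs => rw [← Nat.div_add_mod j n, pow_add, pow_mul, (rels hq).g_pow, one_pow, one_mul]
      rw [hg]
      exact Submodule.subset_span ⟨(⟨i, hi⟩, ⟨j % n, Nat.mod_lt _ (NeZero.pos n)⟩), rfl⟩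
    · obtain ⟨k, rfl⟩ := Nat.exists_eq_add_of_le (not_lt.1 hi)
      rw [pow_add, (rels hq).x_pow, zero_mul, zero_mul]
      exact M.zero_mem
  have key : ∀ y : TaftAlgebra hq, ∀ m ∈ M, y * m ∈ M := by
    intro y
    have hy : y ∈ Algebra.adjoin ℂ {g hq, x hq} := adjoin_eq_top hq ▸ Algebra.mem_top
    induction hy using Algebra.adjoin_induction with
    | mem y hy =>
      intro m hm
      induction hm using Submodule.span_induction with
      | mem m hm =>
        obtain ⟨p, rfl⟩ := hm
        rcases hy with rfl | rfl
        · have h := qcomm_pow (rels hq).gx p.1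
          simp only
          rw [← mul_assoc, h, smul_mul_assoc, mul_assoc, ← pow_succ']
          exact M.smul_mem _ (mono _ _)
        · simp only
          rw [← mul_assoc, ← pow_succ']
          exact mono _ _
      | zero => simp
      | add a b _ _ ha hb => rw [mul_add]; exact M.add_mem ha hb
      | smul c a _ ha => rw [mul_smul_comm]; exact M.smul_mem _ ha
    | algebraMap r => intro m hm; rw [← Algebra.smul_def]; exact M.smul_mem _ hm
    | add a b _ _ ha hb => intro m hm; rw [add_mul]; exact M.add_mem (ha m hm) (hb m hm)
    | mul a b _ _ ha hb => intro m hm; rw [mul_assoc]; exact ha _ (hb m hm)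
  refine top_unique fun y _ => ?_
  simpa using key y 1 (by simpa using mono 0 0)

instance : Module.Finite ℂ (TaftAlgebra hq) :=
  .of_fg_top (span_eq_top hq ▸ Submodule.fg_span (Set.finite_range _))

theorem antipode_bijective :
    Function.Bijective (HopfAlgebra.antipode ℂ (A := TaftAlgebra hq)) :=
  ⟨LinearMap.injective_iff_surjective.2 (antipode_surjective hq), antipode_surjective hq⟩

end TaftAlgebra

end Taft

/-! ### The Hopf algebra `H_n(1,q)` -/

section Chen

/-- The defining relations of `H_n(1,q)`. -/
structure ChenRels (n : ℕ) (q : ℂ) {B : Type*} [Ring B] [Algebra ℂ B] (a b c d : B) : Prop where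
  a_pow : a ^ n = 0
  b_pow : b ^ n = 1
  c_pow : c ^ n = 1
  d_pow : d ^ n = 0
  ba : b * a = q • (a * b)
  db : d * b = q • (b * d)
  ca : c * a = q • (a * c)
  dc : d * c = q • (c * d)
  bc : b * c = c * b
  da : d * a - q • (a * d) = 1 - b * c

inductive ChenGen
  | a
  | b
  | c
  | d

local notation "ι" => FreeAlgebra.ι ℂ

inductive ChenRel (n : ℕ) (q : ℂ) : FreeAlgebra ℂ ChenGen → FreeAlgebra ℂ ChenGen → Prop
  | a_pow : ChenRel n q (ι .a ^ n) 0
  | b_pow : ChenRel n q (ι .b ^ n) 1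
  | c_pow : ChenRel n q (ι .c ^ n) 1
  | d_pow : ChenRel n q (ι .d ^ n) 0
  | ba : ChenRel n q (ι .b * ι .a) (q • (ι .a * ι .b))
  | db : ChenRel n q (ι .d * ι .b) (q • (ι .b * ι .d))
  | ca : ChenRel n q (ι .c * ι .a) (q • (ι .a * ι .c))
  | dc : ChenRel n q (ι .d * ι .c) (q • (ι .c * ι .d))
  | bc : ChenRel n q (ι .b * ι .c) (ι .c * ι .b)
  | da : ChenRel n q (ι .d * ι .a - q • (ι .a * ι .d)) (1 - ι .b * ι .c)

/-- The algebra `H_n(1,q)`, `q` a primitive `n`-th root of unity, given by the generators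
`a, b, c, d` and the relations `ChenRels`. -/
def ChenAlgebra {n : ℕ} {q : ℂ} (_hq : IsPrimitiveRoot q n) : Type := RingQuot (ChenRel n q)

namespace ChenAlgebra

variable {n : ℕ} {q : ℂ} (hq : IsPrimitiveRoot q n)

noncomputable instance : Ring (ChenAlgebra hq) := inferInstanceAs (Ring (RingQuot (ChenRel n q)))

noncomputable instance : Algebra ℂ (ChenAlgebra hq) :=
  inferInstanceAs (Algebra ℂ (RingQuot (ChenRel n q)))

noncomputable def mk : FreeAlgebra ℂ ChenGen →ₐ[ℂ] ChenAlgebra hq :=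
  RingQuot.mkAlgHom ℂ (ChenRel n q)

noncomputable def a : ChenAlgebra hq := mk hq (ι .a)

noncomputable def b : ChenAlgebra hq := mk hq (ι .b)

noncomputable def c : ChenAlgebra hq := mk hq (ι .c)

noncomputable def d : ChenAlgebra hq := mk hq (ι .d)

theorem mk_rel {u v : FreeAlgebra ℂ ChenGen} (h : ChenRel n q u v) : mk hq u = mk hq v :=
  RingQuot.mkAlgHom_rel ℂ h

theorem rels : ChenRels n q (a hq) (b hq) (c hq) (d hq) where
  a_pow := by simpa [a] using mk_rel hq .a_pow
  b_pow := by simpa [b] using mk_rel hq .b_pow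
  c_pow := by simpa [c] using mk_rel hq .c_pow
  d_pow := by simpa [d] using mk_rel hq .d_pow
  ba := by simpa [a, b] using mk_rel hq .ba
  db := by simpa [b, d] using mk_rel hq .db
  ca := by simpa [a, c] using mk_rel hq .ca
  dc := by simpa [c, d] using mk_rel hq .dc
  bc := by simpa [b, c] using mk_rel hq .bc
  da := by simpa [a, b, c, d] using mk_rel hq .da

variable {B : Type*} [Ring B] [Algebra ℂ B]

/-- The universal property of the presentation. -/
noncomputable def lift {a' b' c' d' : B} (h : ChenRels n q a' b' c' d') :
    ChenAlgebra hq →ₐ[ℂ] B :=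
  RingQuot.liftAlgHom ℂ ⟨FreeAlgebra.lift ℂ (fun | .a => a' | .b => b' | .c => c' | .d => d'), by
    intro u v huv
    induction huv with
    | a_pow => simpa using h.a_pow
    | b_pow => simpa using h.b_pow
    | c_pow => simpa using h.c_pow
    | d_pow => simpa using h.d_pow
    | ba => simpa using h.ba
    | db => simpa using h.db
    | ca => simpa using h.ca
    | dc => simpa using h.dc
    | bc => simpa using h.bc
    | da => simpa using h.da⟩

variable {a' b' c' d' : B} (h : ChenRels n q a' b' c' d')

@[simp] theorem lift_a : lift hq h (a hq) = a' :=
  (RingQuot.liftAlgHom_mkAlgHom_apply ℂ _ _ _).trans (by simp)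

@[simp] theorem lift_b : lift hq h (b hq) = b' :=
  (RingQuot.liftAlgHom_mkAlgHom_apply ℂ _ _ _).trans (by simp)

@[simp] theorem lift_c : lift hq h (c hq) = c' :=
  (RingQuot.liftAlgHom_mkAlgHom_apply ℂ _ _ _).trans (by simp)

@[simp] theorem lift_d : lift hq h (d hq) = d' :=
  (RingQuot.liftAlgHom_mkAlgHom_apply ℂ _ _ _).trans (by simp)

variable {hq} in
theorem hom_ext {φ ψ : ChenAlgebra hq →ₐ[ℂ] B} (ha : φ (a hq) = ψ (a hq))
    (hb : φ (b hq) = ψ (b hq)) (hc : φ (c hq) = ψ (c hq)) (hd : φ (d hq) = ψ (d hq)) :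
    φ = ψ := by
  refine RingQuot.ringQuot_ext' ℂ φ ψ (FreeAlgebra.hom_ext (funext fun i => ?_))
  cases i
  · exact ha
  · exact hb
  · exact hc
  · exact hd

theorem adjoin_eq_top : Algebra.adjoin ℂ {a hq, b hq, c hq, d hq} = ⊤ := by
  refine top_unique fun y hy => ?_
  clear hy
  obtain ⟨z, rfl⟩ := RingQuot.mkAlgHom_surjective ℂ (ChenRel n q) y
  change mk hq z ∈ _
  induction z using FreeAlgebra.induction with
  | grade0 r => rw [AlgHom.commutes]; exact Subalgebra.algebraMap_mem _ r
  | grade1 i =>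
    refine Algebra.subset_adjoin ?_
    cases i
    · exact Or.inl rfl
    · exact Or.inr (Or.inl rfl)
    · exact Or.inr (Or.inr (Or.inl rfl))
    · exact Or.inr (Or.inr (Or.inr rfl))
  | mul a b ha hb => rw [map_mul]; exact Subalgebra.mul_mem _ ha hb
  | add a b ha hb => rw [map_add]; exact Subalgebra.add_mem _ ha hb

variable [NeZero n]

theorem b_mul_inv : b hq * b hq ^ (n - 1) = 1 := by
  rw [← pow_succ', Nat.sub_add_cancel NeZero.one_le, (rels hq).b_pow]

theorem inv_mul_b : b hq ^ (n - 1) * b hq = 1 := by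
  rw [← pow_succ, Nat.sub_add_cancel NeZero.one_le, (rels hq).b_pow]

theorem c_mul_inv : c hq * c hq ^ (n - 1) = 1 := by
  rw [← pow_succ', Nat.sub_add_cancel NeZero.one_le, (rels hq).c_pow]

theorem inv_mul_c : c hq ^ (n - 1) * c hq = 1 := by
  rw [← pow_succ, Nat.sub_add_cancel NeZero.one_le, (rels hq).c_pow]

theorem comul_rels : ChenRels n q (a hq ⊗ₜ[ℂ] b hq + 1 ⊗ₜ[ℂ] a hq) (b hq ⊗ₜ[ℂ] b hq)
    (c hq ⊗ₜ[ℂ] c hq) (d hq ⊗ₜ[ℂ] c hq + 1 ⊗ₜ[ℂ] d hq) where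
  a_pow := by
    rw [add_comm, qcomm_add_pow_root hq (NeZero.ne n)]
    · simp [Algebra.TensorProduct.tmul_pow, (rels hq).a_pow]
    · simp [(rels hq).ba]
  b_pow := by simp [Algebra.TensorProduct.tmul_pow, (rels hq).b_pow, Algebra.TensorProduct.one_def]
  c_pow := by simp [Algebra.TensorProduct.tmul_pow, (rels hq).c_pow, Algebra.TensorProduct.one_def]
  d_pow := by
    rw [qcomm_add_pow_root hq (NeZero.ne n)]
    · simp [Algebra.TensorProduct.tmul_pow, (rels hq).d_pow]
    · simp [(rels hq).dc]
  ba := by simp [mul_add, add_mul, (rels hq).ba, TensorProduct.smul_tmul']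
  db := by simp [mul_add, add_mul, (rels hq).db, (rels hq).bc, TensorProduct.smul_tmul']
  ca := by simp [mul_add, add_mul, (rels hq).ca, (rels hq).bc, TensorProduct.smul_tmul']
  dc := by simp [mul_add, add_mul, (rels hq).dc, TensorProduct.smul_tmul']
  bc := by simp [(rels hq).bc]
  da := by
    have hda : d hq * a hq = 1 - b hq * c hq + q • (a hq * d hq) := by
      rw [← (rels hq).da]; abel
    simp [mul_add, add_mul, (rels hq).db, (rels hq).ca, (rels hq).bc, hda, TensorProduct.smul_tmul',
      TensorProduct.add_tmul, TensorProduct.tmul_add, TensorProduct.sub_tmul,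
      TensorProduct.tmul_sub, Algebra.TensorProduct.one_def]
    abel

theorem counit_rels : ChenRels n q (0 : ℂ) 1 1 0 where
  a_pow := zero_pow (NeZero.ne n)
  b_pow := one_pow n
  c_pow := one_pow n
  d_pow := zero_pow (NeZero.ne n)
  ba := by simp
  db := by simp
  ca := by simp
  dc := by simp
  bc := by simp
  da := by simp

/-- The coproduct: `Δ a = a ⊗ b + 1 ⊗ a`, `Δ b = b ⊗ b`, `Δ c = c ⊗ c`, `Δ d = d ⊗ c + 1 ⊗ d`;
the counit: `ε a = ε d = 0`, `ε b = ε c = 1`. -/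
noncomputable instance : Bialgebra ℂ (ChenAlgebra hq) :=
  Bialgebra.ofAlgHom (lift hq (comul_rels hq)) (lift hq counit_rels)
    (hom_ext (by simp [TensorProduct.tmul_add, TensorProduct.add_tmul,
      Algebra.TensorProduct.one_def, add_assoc]) (by simp) (by simp)
      (by simp [TensorProduct.tmul_add, TensorProduct.add_tmul,
      Algebra.TensorProduct.one_def, add_assoc]))
    (hom_ext (by simp) (by simp) (by simp) (by simp))
    (hom_ext (by simp) (by simp) (by simp) (by simp))

@[simp] theorem comul_a :
    Coalgebra.comul (R := ℂ) (a hq) = a hq ⊗ₜ[ℂ] b hq + 1 ⊗ₜ[ℂ] a hq :=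
  lift_a hq (comul_rels hq)

@[simp] theorem comul_b : Coalgebra.comul (R := ℂ) (b hq) = b hq ⊗ₜ[ℂ] b hq :=
  lift_b hq (comul_rels hq)

@[simp] theorem comul_c : Coalgebra.comul (R := ℂ) (c hq) = c hq ⊗ₜ[ℂ] c hq :=
  lift_c hq (comul_rels hq)

@[simp] theorem comul_d :
    Coalgebra.comul (R := ℂ) (d hq) = d hq ⊗ₜ[ℂ] c hq + 1 ⊗ₜ[ℂ] d hq :=
  lift_d hq (comul_rels hq)

@[simp] theorem counit_a : Coalgebra.counit (R := ℂ) (a hq) = 0 := lift_a hq counit_rels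

@[simp] theorem counit_b : Coalgebra.counit (R := ℂ) (b hq) = 1 := lift_b hq counit_rels

@[simp] theorem counit_c : Coalgebra.counit (R := ℂ) (c hq) = 1 := lift_c hq counit_rels

@[simp] theorem counit_d : Coalgebra.counit (R := ℂ) (d hq) = 0 := lift_d hq counit_rels

open MulOpposite in
theorem antipode_rels : ChenRels n q (op (-(a hq * b hq ^ (n - 1)))) (op (b hq ^ (n - 1)))
    (op (c hq ^ (n - 1))) (op (-(d hq * c hq ^ (n - 1)))) := by
  have h0 : n ≠ 0 := NeZero.ne n
  have q0 : q ≠ 0 := hq.ne_zero h0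
  have hab := qcomm_inv hq h0 (rels hq).ba
  have hac := qcomm_inv hq h0 (rels hq).ca
  have hqq : q * q ^ (n - 1) = 1 := by
    rw [← pow_succ', Nat.sub_add_cancel NeZero.one_le, hq.pow_eq_one]
  have hbd : b hq ^ (n - 1) * d hq = q • (d hq * b hq ^ (n - 1)) := by
    rw [qcomm_pow (rels hq).db, smul_smul, hqq, one_smul]
  have hcd : c hq ^ (n - 1) * d hq = q • (d hq * c hq ^ (n - 1)) := by
    rw [qcomm_pow (rels hq).dc, smul_smul, hqq, one_smul]
  have hbc : b hq ^ (n - 1) * c hq ^ (n - 1) = c hq ^ (n - 1) * b hq ^ (n - 1) :=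
    Commute.pow_pow (rels hq).bc _ _
  refine ⟨?_, ?_, ?_, ?_, ?_, ?_, ?_, ?_, ?_, ?_⟩
  · obtain ⟨t, ht⟩ := qcomm_mul_pow (q := q⁻¹) (X := a hq) (Y := b hq ^ (n - 1)) (by
      rw [hab, smul_smul, inv_mul_cancel₀ q0, one_smul]) n
    rw [← op_pow, neg_pow, ht, (rels hq).a_pow]
    simp
  · rw [← op_pow, ← pow_mul, mul_comm, pow_mul, (rels hq).b_pow, one_pow, op_one]
  · rw [← op_pow, ← pow_mul, mul_comm, pow_mul, (rels hq).c_pow, one_pow, op_one]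
  · obtain ⟨t, ht⟩ := qcomm_mul_pow hcd n
    rw [← op_pow, neg_pow, ht, (rels hq).d_pow]
    simp
  · rw [← op_mul, ← op_mul, ← op_smul, neg_mul, mul_neg, ← mul_assoc, hab, smul_neg,
      smul_mul_assoc]
  · rw [← op_mul, ← op_mul, ← op_smul, neg_mul, mul_neg, ← mul_assoc, hbd, smul_neg,
      smul_mul_assoc, mul_assoc, mul_assoc, hbc]
  · rw [← op_mul, ← op_mul, ← op_smul, neg_mul, mul_neg, mul_assoc, hbc, ← mul_assoc, hac,
      smul_neg, smul_mul_assoc, mul_assoc]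
  · rw [← op_mul, ← op_mul, ← op_smul, neg_mul, mul_neg, ← mul_assoc, hcd, smul_neg,
      smul_mul_assoc]
  · rw [← op_mul, ← op_mul, hbc]
  · rw [← op_mul, ← op_mul, ← op_mul, ← op_smul, ← op_one, ← op_sub, ← op_sub]
    congr 1
    have e1 : a hq * b hq ^ (n - 1) * (d hq * c hq ^ (n - 1)) =
        (q • (a hq * d hq)) * (b hq ^ (n - 1) * c hq ^ (n - 1)) := by
      rw [mul_assoc, ← mul_assoc (b hq ^ (n - 1)), hbd, smul_mul_assoc, mul_smul_comm,
        smul_mul_assoc]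
      simp only [mul_assoc]
    have e2 : q • (d hq * c hq ^ (n - 1) * (a hq * b hq ^ (n - 1))) =
        (d hq * a hq) * (b hq ^ (n - 1) * c hq ^ (n - 1)) := by
      rw [hbc, mul_assoc, ← mul_assoc (c hq ^ (n - 1)), ← mul_smul_comm, ← smul_mul_assoc, ← hac]
      simp only [mul_assoc]
    have e3 : b hq * c hq * (b hq ^ (n - 1) * c hq ^ (n - 1)) = 1 := by
      rw [hbc, mul_assoc, ← mul_assoc (c hq), c_mul_inv, one_mul, b_mul_inv]
    rw [neg_mul_neg, neg_mul_neg, e1, e2, ← sub_mul, ← neg_sub, (rels hq).da, neg_mul, sub_mul, e3,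
      one_mul, neg_sub, hbc]

/-- The antipode: `S a = - a b⁻¹`, `S b = b⁻¹`, `S c = c⁻¹`, `S d = - d c⁻¹`. -/
noncomputable instance : HopfAlgebra ℂ (ChenAlgebra hq) :=
  hopfOfAntiHom (lift hq (antipode_rels hq)) {a hq, b hq, c hq, d hq} (adjoin_eq_top hq)
    (by rintro y (rfl | rfl | rfl | rfl) <;> simp [inv_mul_b, inv_mul_c, mul_assoc])
    (by rintro y (rfl | rfl | rfl | rfl) <;> simp [b_mul_inv, c_mul_inv])

theorem antipode_a : HopfAlgebra.antipode ℂ (a hq) = -(a hq * b hq ^ (n - 1)) :=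
  congrArg MulOpposite.unop (lift_a hq (antipode_rels hq))

theorem antipode_b : HopfAlgebra.antipode ℂ (b hq) = b hq ^ (n - 1) :=
  congrArg MulOpposite.unop (lift_b hq (antipode_rels hq))

theorem antipode_c : HopfAlgebra.antipode ℂ (c hq) = c hq ^ (n - 1) :=
  congrArg MulOpposite.unop (lift_c hq (antipode_rels hq))

theorem antipode_d : HopfAlgebra.antipode ℂ (d hq) = -(d hq * c hq ^ (n - 1)) :=
  congrArg MulOpposite.unop (lift_d hq (antipode_rels hq))

end ChenAlgebra

end Chen

/-! ### The Drinfeld double of a finite-dimensional Hopf algebra -/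

section Double

open Coalgebra HopfAlgebra

variable {H : Type*} [Ring H] [HopfAlgebra ℂ H]

variable (H) in
/-- The underlying vector space `H* ⊗ H` of the Drinfeld double `D(H) = H*ᶜᵒᵖ ⋈ H`; the element
`f ⊗ h` is usually written `f ⋈ h`. -/
abbrev Double : Type _ := Dual ℂ H ⊗[ℂ] H

namespace Double

variable (H) in
/-- The convolution product of `H*`: `(f f')(h) = f(h₁) f'(h₂)`. -/
noncomputable def dualMul : Dual ℂ H ⊗[ℂ] Dual ℂ H →ₗ[ℂ] Dual ℂ H :=
  (comul (R := ℂ) (A := H)).dualMap ∘ₗ TensorProduct.dualDistrib ℂ H H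

variable (H) in
/-- The coproduct `f ↦ f₁ ⊗ f₂` of `H*`, characterised by `f(h k) = f₁(h) f₂(k)`. -/
noncomputable def dualComul [Module.Finite ℂ H] : Dual ℂ H →ₗ[ℂ] Dual ℂ H ⊗[ℂ] Dual ℂ H :=
  (TensorProduct.dualDistribEquiv ℂ H H).symm.toLinearMap ∘ₗ (LinearMap.mul' ℂ H).dualMap

variable (hS : Function.Bijective (antipode ℂ (A := H)))

/-- The inverse `S⁻¹` of the antipode. -/
noncomputable def antipodeInv : H →ₗ[ℂ] H :=
  (LinearEquiv.ofBijective (antipode ℂ (A := H)) hS).symm.toLinearMap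

/-- For `h, k` in `H`, the operator `f ↦ f(S⁻¹(k) ? h)` on `H*`. -/
noncomputable def coadj : H →ₗ[ℂ] H →ₗ[ℂ] Dual ℂ H →ₗ[ℂ] Dual ℂ H :=
  LinearMap.mk₂ ℂ
    (fun h k => (LinearMap.mulLeft ℂ (antipodeInv hS k) ∘ₗ LinearMap.mulRight ℂ h).dualMap)
    (fun h h' k => by ext f y; simp [mul_add])
    (fun c h k => by ext f y; simp)
    (fun h k k' => by ext f y; simp [add_mul])
    (fun c h k => by ext f y; simp)

theorem coadj_apply (h k : H) (f : Dual ℂ H) (y : H) :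
    coadj hS h k f y = f (antipodeInv hS k * (y * h)) := rfl

/-- `h₁ ⊗ (h₂ ⊗ h₃) ↦ (f ↦ f(S⁻¹(h₃) ? h₁) ⊗ h₂)`. -/
noncomputable def straighten : H ⊗[ℂ] (H ⊗[ℂ] H) →ₗ[ℂ] Dual ℂ H →ₗ[ℂ] Double H :=
  TensorProduct.lift
    ((LinearMap.llcomp ℂ (Dual ℂ H) (Dual ℂ H) (Double H) ∘ₗ
      (TensorProduct.mk ℂ (Dual ℂ H) H).flip).compl₂ (TensorProduct.lift (coadj hS))).flip ∘ₗ
  (TensorProduct.assoc ℂ H H H).symm.toLinearMap ∘ₗ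
  (TensorProduct.comm ℂ H H).toLinearMap.lTensor H

theorem straighten_tmul (h₁ h₂ h₃ : H) (f : Dual ℂ H) :
    straighten hS (h₁ ⊗ₜ (h₂ ⊗ₜ h₃)) f = coadj hS h₁ h₃ f ⊗ₜ h₂ := by
  simp [straighten]

/-- The product of `1 ⋈ h` and `f ⋈ 1`, that is `f(S⁻¹(h₃) ? h₁) ⋈ h₂`. -/
noncomputable def twist : H →ₗ[ℂ] Dual ℂ H →ₗ[ℂ] Double H :=
  straighten hS ∘ₗ (comul (R := ℂ) (A := H)).lTensor H ∘ₗ comul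

/-- The product of the double: `(f ⋈ h)(f' ⋈ h') = f f'(S⁻¹(h₃) ? h₁) ⋈ h₂ h'`. -/
noncomputable def mul : Double H →ₗ[ℂ] Double H →ₗ[ℂ] Double H :=
  TensorProduct.curry <|
    TensorProduct.map (dualMul H) (LinearMap.mul' ℂ H) ∘ₗ
    (TensorProduct.assoc ℂ (Dual ℂ H) (Dual ℂ H) (H ⊗[ℂ] H)).symm.toLinearMap ∘ₗ
    (TensorProduct.assoc ℂ (Dual ℂ H) H H).toLinearMap.lTensor (Dual ℂ H) ∘ₗ
    ((TensorProduct.lift (twist hS)).rTensor H).lTensor (Dual ℂ H) ∘ₗ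
    (TensorProduct.assoc ℂ H (Dual ℂ H) H).symm.toLinearMap.lTensor (Dual ℂ H) ∘ₗ
    (TensorProduct.assoc ℂ (Dual ℂ H) H (Double H)).toLinearMap

theorem mul_tmul (f f' : Dual ℂ H) (h h' : H) :
    mul hS (f ⊗ₜ h) (f' ⊗ₜ h') =
      TensorProduct.map (dualMul H ∘ₗ TensorProduct.mk ℂ (Dual ℂ H) (Dual ℂ H) f)
        (LinearMap.mulRight ℂ h') (twist hS h f') := by
  simp only [mul, TensorProduct.curry_apply, LinearMap.comp_apply, LinearEquiv.coe_coe,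
    TensorProduct.assoc_tmul, LinearMap.lTensor_tmul, TensorProduct.assoc_symm_tmul,
    LinearMap.rTensor_tmul, TensorProduct.lift.tmul]
  induction twist hS h f' using TensorProduct.induction_on with
  | zero => simp
  | add s t hs ht => simp only [TensorProduct.add_tmul, TensorProduct.tmul_add, map_add, hs, ht]
  | tmul x y => simp

variable (H) in
/-- The unit `ε ⋈ 1` of the double. -/
noncomputable def one : Double H := counit (R := ℂ) (A := H) ⊗ₜ[ℂ] (1 : H)

variable (H) in
/-- The coproduct of the double: `Δ(f ⋈ h) = (f₂ ⋈ h₁) ⊗ (f₁ ⋈ h₂)`. -/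
noncomputable def comul [Module.Finite ℂ H] : Double H →ₗ[ℂ] Double H ⊗[ℂ] Double H :=
  (TensorProduct.tensorTensorTensorComm ℂ (Dual ℂ H) (Dual ℂ H) H H).toLinearMap ∘ₗ
    TensorProduct.map ((TensorProduct.comm ℂ (Dual ℂ H) (Dual ℂ H)).toLinearMap ∘ₗ dualComul H)
      (Coalgebra.comul (R := ℂ) (A := H))

variable (H) in
/-- The counit of the double: `ε(f ⋈ h) = f(1) ε(h)`. -/
noncomputable def counit : Double H →ₗ[ℂ] ℂ :=
  LinearMap.mul' ℂ ℂ ∘ₗ TensorProduct.map (LinearMap.applyₗ (1 : H))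
    (Coalgebra.counit (R := ℂ) (A := H))

/-- The antipode of the double: `S(f ⋈ h) = (ε ⋈ S(h)) (f ∘ S⁻¹ ⋈ 1)`. -/
noncomputable def antipode : Double H →ₗ[ℂ] Double H :=
  TensorProduct.lift (twist hS ∘ₗ HopfAlgebra.antipode ℂ).flip ∘ₗ
    (antipodeInv hS).dualMap.rTensor H

theorem antipode_tmul (f : Dual ℂ H) (h : H) :
    antipode hS (f ⊗ₜ h) = twist hS (HopfAlgebra.antipode ℂ h) (f ∘ₗ antipodeInv hS) := rfl

/-- A linear isomorphism from the Drinfeld double of `H` onto a Hopf algebra `K` that is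
compatible with all structure maps, i.e. an isomorphism of Hopf algebras `D(H) ≅ K`. -/
structure IsHopfIso {H K : Type*} [Ring H] [HopfAlgebra ℂ H] [Module.Finite ℂ H]
    [Ring K] [HopfAlgebra ℂ K] (hS : Function.Bijective (HopfAlgebra.antipode ℂ (A := H)))
    (e : Double H ≃ₗ[ℂ] K) : Prop where
  map_mul : ∀ x y, e (Double.mul hS x y) = e x * e y
  map_one : e (Double.one H) = 1
  map_comul : ∀ x, Coalgebra.comul (R := ℂ) (e x) =
    TensorProduct.map e.toLinearMap e.toLinearMap (Double.comul H x)
  map_counit : ∀ x, Coalgebra.counit (R := ℂ) (e x) = Double.counit H x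
  map_antipode : ∀ x, HopfAlgebra.antipode ℂ (e x) = e (Double.antipode hS x)

end Double

end Double

/-! ### The trace invariant -/

section Trace

open HopfAlgebra

variable {H V : Type*} [Ring H] [HopfAlgebra ℂ H] [AddCommGroup V] [Module ℂ V]

/-- A representation `φ : H → End V` is irreducible if the `H`-module `V` is simple. -/
structure IsIrreducible (φ : H →ₐ[ℂ] Module.End ℂ V) : Prop where
  nontrivial : Nontrivial V
  eq_bot_or_eq_top : ∀ W : Submodule ℂ V, (∀ h, ∀ w ∈ W, φ h w ∈ W) → W = ⊥ ∨ W = ⊤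

/-- The action of `H` on the dual module `V*`: `(h f)(v) = f(S(h) v)`. -/
noncomputable def dualRep (φ : H →ₐ[ℂ] Module.End ℂ V) : H →ₐ[ℂ] Module.End ℂ (Dual ℂ V) :=
  AlgHom.ofLinearMap
    { toFun := fun h => (φ (antipode ℂ h)).dualMap
      map_add' := fun _ _ => by ext; simp
      map_smul' := fun _ _ => by ext; simp }
    (by ext; simp) (fun _ _ => by ext; simp [antipode_mul_antidistrib])

@[simp] theorem dualRep_apply (φ : H →ₐ[ℂ] Module.End ℂ V) (h : H) (f : Dual ℂ V) (v : V) :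
    dualRep φ h f v = f (φ (antipode ℂ h) v) := rfl

/-- `V` is self-dual if `V ≅ V*` as `H`-modules. -/
def IsSelfDual (φ : H →ₐ[ℂ] Module.End ℂ V) : Prop :=
  ∃ T : V ≃ₗ[ℂ] Dual ℂ V, ∀ h v, T (φ h v) = dualRep φ h (T v)

theorem IsIrreducible.surjective [FiniteDimensional ℂ V] {φ : H →ₐ[ℂ] Module.End ℂ V}
    (hφ : IsIrreducible φ) : Function.Surjective φ := by
  let _ : Module H V := Module.compHom V φ.toRingHom
  have hsm : ∀ (h : H) (v : V), h • v = φ h v := fun _ _ => rfl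
  have : IsScalarTower ℂ H V := ⟨fun c h v => by simp [hsm]⟩
  have := hφ.nontrivial
  have : IsSimpleModule H V := by
    rw [isSimpleModule_iff]
    have : Nontrivial (Submodule H V) := inferInstance
    refine ⟨fun W => ?_⟩
    rcases hφ.eq_bot_or_eq_top (W.restrictScalars ℂ) (fun h w hw => W.smul_mem h hw) with h | h
    · exact Or.inl ((Submodule.restrictScalars_eq_bot_iff ..).1 h)
    · exact Or.inr ((Submodule.restrictScalars_eq_top_iff ..).1 h)
  intro α
  let f : Module.End (Module.End H V) V :=
    { toFun := α
      map_add' := map_add α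
      map_smul' := fun T v => by
        obtain ⟨c, rfl⟩ := (IsSimpleModule.algebraMap_end_bijective_of_isAlgClosed
          (A := H) (V := V) ℂ).2 T
        simp }
  obtain ⟨s, hs⟩ := Module.Finite.fg_top (R := ℂ) (M := V)
  obtain ⟨r, hr⟩ := jacobson_density f s
  refine ⟨r, LinearMap.ext_on hs fun v hv => ?_⟩
  exact (hr v hv).symm

/-- For a simple self-dual module, the antipode induces a unique linear map on `End V`. -/
theorem existsUnique_antipodeEnd [FiniteDimensional ℂ V] {φ : H →ₐ[ℂ] Module.End ℂ V}
    (hφ : IsIrreducible φ) (hd : IsSelfDual φ) :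
    ∃! T : Module.End ℂ V →ₗ[ℂ] Module.End ℂ V, ∀ h, T (φ h) = φ (antipode ℂ h) := by
  obtain ⟨T, hT⟩ := hd
  have hker : LinearMap.ker φ.toLinearMap ≤
      LinearMap.ker (φ.toLinearMap ∘ₗ antipode ℂ (A := H)) := by
    intro h hh
    have hh' : φ h = 0 := hh
    change φ (antipode ℂ h) = 0
    ext v
    refine (Module.forall_dual_apply_eq_zero_iff ℂ _).1 fun f => ?_
    obtain ⟨w, rfl⟩ := T.surjective f
    rw [← dualRep_apply, ← hT, hh']
    simp
  obtain ⟨R, hR⟩ : ∃ R : Module.End ℂ V →ₗ[ℂ] Module.End ℂ V,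
      ∀ h, R (φ h) = φ (antipode ℂ h) := by
    refine ⟨(LinearMap.ker φ.toLinearMap).liftQ _ hker ∘ₗ
      (φ.toLinearMap.quotKerEquivOfSurjective hφ.surjective).symm.toLinearMap, fun h => ?_⟩
    have e : (φ.toLinearMap.quotKerEquivOfSurjective hφ.surjective).symm (φ h) =
        Submodule.Quotient.mk h := by
      rw [LinearEquiv.symm_apply_eq]; rfl
    rw [LinearMap.comp_apply, LinearEquiv.coe_coe, e]
    rfl
  refine ⟨R, hR, fun R' hR' => ?_⟩
  ext1 α
  obtain ⟨h, rfl⟩ := hφ.surjective α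
  rw [hR', hR]

/-- The map `S_V : End V → End V` induced by the antipode, i.e. the unique map with
`S_V(φ(h)) = φ(S(h))`. -/
noncomputable def antipodeEnd [FiniteDimensional ℂ V] {φ : H →ₐ[ℂ] Module.End ℂ V}
    (hφ : IsIrreducible φ) (hd : IsSelfDual φ) : Module.End ℂ V →ₗ[ℂ] Module.End ℂ V :=
  (existsUnique_antipodeEnd hφ hd).choose

theorem antipodeEnd_apply [FiniteDimensional ℂ V] {φ : H →ₐ[ℂ] Module.End ℂ V}
    (hφ : IsIrreducible φ) (hd : IsSelfDual φ) (h : H) :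
    antipodeEnd hφ hd (φ h) = φ (antipode ℂ h) :=
  (existsUnique_antipodeEnd hφ hd).choose_spec.1 h

open Classical in
/-- The trace invariant `μ(V)` of a simple finite-dimensional module: the trace of `S_V` if `V` is
self-dual, and `0` otherwise. -/
noncomputable def traceInvariant [FiniteDimensional ℂ V] {φ : H →ₐ[ℂ] Module.End ℂ V}
    (hφ : IsIrreducible φ) : ℂ :=
  if hd : IsSelfDual φ then LinearMap.trace ℂ (Module.End ℂ V) (antipodeEnd hφ hd) else 0

end Trace

/-! ### The modules `V(l,r)` -/

section Simple

/-- The `q`-integer `(i)_q = 1 + q + ⋯ + q ^ (i - 1)`. -/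
noncomputable def qInt (q : ℂ) (i : ℕ) : ℂ := ∑ k ∈ Finset.range i, q ^ k

/-- The `q`-factorial `(i)!_q = (1)_q (2)_q ⋯ (i)_q`. -/
noncomputable def qFactorial (q : ℂ) (i : ℕ) : ℂ := ∏ k ∈ Finset.range i, qInt q (k + 1)

/-- `α_i(l) = (i)_q (1 - q ^ (i - l))`. -/
noncomputable def alpha (q : ℂ) (l i : ℕ) : ℂ := qInt q i * (1 - q ^ ((i : ℤ) - l))

theorem alpha_succ {q : ℂ} (h0 : q ≠ 0) (l i : ℕ) :
    alpha q l (i + 1) - q * alpha q l i = 1 - q ^ ((2 * i + 1 : ℤ) - l) := by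
  have h1 : qInt q (i + 1) = 1 + q * qInt q i := by
    rw [qInt, Finset.sum_range_succ', qInt, Finset.mul_sum, add_comm]
    simp [pow_succ']
  have h2 : qInt q i * (q - 1) = q ^ i - 1 := geom_sum_mul q i
  have e1 : q ^ (((i + 1 : ℕ) : ℤ) - l) = q * q ^ ((i : ℤ) - l) := by
    rw [← zpow_one_add₀ h0]; congr 1; push_cast; ring
  have e2 : q ^ ((2 * i + 1 : ℤ) - l) = q * q ^ i * q ^ ((i : ℤ) - l) := by
    rw [mul_assoc, ← zpow_natCast, ← zpow_add₀ h0, ← zpow_one_add₀ h0]; congr 1; ring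
  rw [alpha, alpha, h1, e1, e2]
  linear_combination (- q * q ^ ((i : ℤ) - l)) * h2

variable (q : ℂ) (l : ℕ) (r : ℤ)

/-! The matrices of `a, b, c, d` on `V(l,r)` in the basis `v_1, …, v_l`; the index `i : Fin l`
stands for `v_{i+1}`. Thus `a v_i = v_{i+1}`, `b v_i = q ^ (r+i-1) v_i`,
`c v_i = q ^ (i-(r+l)) v_i` and `d v_i = α_{i-1}(l) v_{i-1}`. -/

noncomputable def matA : Matrix (Fin l) (Fin l) ℂ :=
  .of fun p i => if (p : ℕ) = i + 1 then 1 else 0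

noncomputable def matB : Matrix (Fin l) (Fin l) ℂ := .diagonal fun i => q ^ (r + i)

noncomputable def matC : Matrix (Fin l) (Fin l) ℂ :=
  .diagonal fun i => q ^ ((i : ℤ) + 1 - (r + l))

noncomputable def matD : Matrix (Fin l) (Fin l) ℂ :=
  .of fun p i => if (p : ℕ) + 1 = i then alpha q l i else 0

theorem matA_pow (k : ℕ) (p i : Fin l) (h : (matA l ^ k) p i ≠ 0) : (p : ℕ) = i + k := by
  induction k generalizing p with
  | zero =>
    by_contra hne
    exact h (by rw [pow_zero, Matrix.one_apply_ne (fun e => hne (by simp [e]))])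
  | succ k ih =>
    rw [pow_succ', Matrix.mul_apply] at h
    obtain ⟨j, -, hj⟩ := Finset.exists_ne_zero_of_sum_ne_zero h
    have h1 := ih j (right_ne_zero_of_mul hj)
    have h2 : (p : ℕ) = j + 1 := by
      by_contra hne
      exact left_ne_zero_of_mul hj (by simp [matA, hne])
    omega

theorem matD_pow (k : ℕ) (p i : Fin l) (h : (matD q l ^ k) p i ≠ 0) : (i : ℕ) = p + k := by
  induction k generalizing p with
  | zero =>
    by_contra hne
    exact h (by rw [pow_zero, Matrix.one_apply_ne (fun e => hne (by simp [e]))])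
  | succ k ih =>
    rw [pow_succ', Matrix.mul_apply] at h
    obtain ⟨j, -, hj⟩ := Finset.exists_ne_zero_of_sum_ne_zero h
    have h1 := ih j (right_ne_zero_of_mul hj)
    have h2 : (p : ℕ) + 1 = j := by
      by_contra hne
      exact left_ne_zero_of_mul hj (by simp [matD, hne])
    omega

theorem matD_mul_matA (p i : Fin l) :
    (matD q l * matA l) p i = if p = i then alpha q l (i + 1) else 0 := by
  rw [Matrix.mul_apply]
  by_cases hi : (i : ℕ) + 1 < l
  · rw [Finset.sum_eq_single ⟨i + 1, hi⟩]
    · simp [matD, matA, Fin.ext_iff]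
    · intro k _ hk
      have : (k : ℕ) ≠ i + 1 := fun h => hk (Fin.ext h)
      simp [matA, this]
    · simp
  · have hl : (i : ℕ) + 1 = l := by omega
    rw [Finset.sum_eq_zero]
    · simp [alpha, hl]
    · intro k _
      have : (k : ℕ) ≠ i + 1 := by omega
      simp [matA, this]

theorem matA_mul_matD (p i : Fin l) :
    (matA l * matD q l) p i = if p = i then alpha q l i else 0 := by
  rw [Matrix.mul_apply]
  by_cases hi : (i : ℕ) = 0
  · rw [Finset.sum_eq_zero]
    · simp [alpha, qInt, hi]
    · intro k _
      simp [matD, hi]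
  · rw [Finset.sum_eq_single ⟨i - 1, by omega⟩]
    · have h1 : (i : ℕ) - 1 + 1 = i := by omega
      simp [matD, matA, Fin.ext_iff, h1]
    · intro k _ hk
      have : (k : ℕ) + 1 ≠ i := fun h => hk (Fin.ext (by simp; omega))
      simp [matD, this]
    · simp

variable {q l}

theorem mat_rels {n : ℕ} [NeZero n] (hq : IsPrimitiveRoot q n) (hl : l ≤ n) :
    ChenRels n q (matA l) (matB q l r) (matC q l r) (matD q l) := by
  have h0 : q ≠ 0 := hq.ne_zero (NeZero.ne n)
  have hz : ∀ z : ℤ, (q ^ z) ^ n = 1 := fun z => by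
    rw [← zpow_natCast, zpow_comm, zpow_natCast, hq.pow_eq_one, one_zpow]
  refine ⟨?_, ?_, ?_, ?_, ?_, ?_, ?_, ?_, ?_, ?_⟩
  · ext p i
    by_contra h
    have := matA_pow l n p i h
    omega
  · rw [matB, Matrix.diagonal_pow, ← Matrix.diagonal_one]
    congr 1; ext i; simp [hz]
  · rw [matC, Matrix.diagonal_pow, ← Matrix.diagonal_one]
    congr 1; ext i; simp [hz]
  · ext p i
    by_contra h
    have := matD_pow q l n p i h
    omega
  · ext p i
    rw [matB, Matrix.diagonal_mul, Matrix.smul_apply, Matrix.mul_diagonal]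
    by_cases h : (p : ℕ) = i + 1
    · simp only [matA, Matrix.of_apply, h, if_true, smul_eq_mul, mul_one, one_mul]
      rw [← zpow_one_add₀ h0]; congr 1; push_cast; ring
    · simp [matA, h]
  · ext p i
    rw [matB, Matrix.mul_diagonal, Matrix.smul_apply, Matrix.diagonal_mul]
    by_cases h : (p : ℕ) + 1 = i
    · simp only [matD, Matrix.of_apply, h, if_true, smul_eq_mul]
      rw [← mul_assoc, ← zpow_one_add₀ h0, mul_comm]; congr 2; rw [← h]; push_cast; ring
    · simp [matD, h]
  · ext p i
    rw [matC, Matrix.diagonal_mul, Matrix.smul_apply, Matrix.mul_diagonal]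
    by_cases h : (p : ℕ) = i + 1
    · simp only [matA, Matrix.of_apply, h, if_true, smul_eq_mul, mul_one, one_mul]
      rw [← zpow_one_add₀ h0]; congr 1; push_cast; ring
    · simp [matA, h]
  · ext p i
    rw [matC, Matrix.mul_diagonal, Matrix.smul_apply, Matrix.diagonal_mul]
    by_cases h : (p : ℕ) + 1 = i
    · simp only [matD, Matrix.of_apply, h, if_true, smul_eq_mul]
      rw [← mul_assoc, ← zpow_one_add₀ h0, mul_comm]; congr 2; rw [← h]; push_cast; ring
    · simp [matD, h]
  · rw [matB, matC, Matrix.diagonal_mul_diagonal, Matrix.diagonal_mul_diagonal]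
    congr 1; ext i; exact mul_comm _ _
  · ext p i
    rw [Matrix.sub_apply, Matrix.smul_apply, Matrix.sub_apply, matD_mul_matA, matA_mul_matD,
      matB, matC, Matrix.diagonal_mul_diagonal]
    by_cases h : p = i
    · subst h
      rw [if_pos rfl, if_pos rfl, Matrix.one_apply_eq, Matrix.diagonal_apply_eq, smul_eq_mul,
        alpha_succ h0, ← zpow_add₀ h0]
      congr 2; ring
    · simp [h]

/-- The representation of `H_n(1,q)` on the `l`-dimensional module `V(l,r)`. -/
noncomputable def simpleRep {n : ℕ} [NeZero n] (hq : IsPrimitiveRoot q n) (hl : l ≤ n) (r : ℤ) :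
    ChenAlgebra hq →ₐ[ℂ] Module.End ℂ (Fin l → ℂ) :=
  (Matrix.toLinAlgEquiv' (R := ℂ) (n := Fin l)).toAlgHom.comp
    (ChenAlgebra.lift hq (mat_rels r hq hl))

end Simple

/-- The square of a primitive root of unity of odd order is again primitive. -/
theorem sq_isPrimitiveRoot {n : ℕ} (hn : Odd n) {q : ℂ} (hq : IsPrimitiveRoot q n) :
    IsPrimitiveRoot (q ^ 2) n :=
  hq.pow_of_coprime 2 (Nat.coprime_two_left.2 hn)

end TaftDouble

/-! Up to `traceInvariant_simpleRep`, where the square root appears, the letter `q` stands for the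
parameter p of the statement.

Isomorphism. The element c has order n, so H_n(1,q) contains its spectral idempotents E_t (`idem`),
and the elements X_{s,t} = E_t d^s / (s)! (`dualMonomial`) turn out to multiply and comultiply like
the basis dual to x^s g^t. Hence `theta`, f ↦ ∑ f(x^s g^t) X_{s,t}, carries convolution to the
product, the opposite of the dual coproduct to the coproduct, and f ∘ S⁻¹ to the antipode. Together
with `iota` (x ↦ a, g ↦ b) it gives `toChen`, f ⋈ h ↦ θ(f) ι(h). This map is multiplicative as soon
as ι(h) θ(f) obeys the straightening rule of the double. The elements h obeying that rule form a
subalgebra (`mulMap_twist_mul`), so only h = g and h = x have to be examined. For g the rule is a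
commutation of b with X_{s,t}; for x it is the formula for a X_{s,t} in `a_mul_dualMonomial_succ`,
which rests on the commutation of a with powers of d.

Bijectivity. The image is a subalgebra containing a, b, c, d, so `toChen` is onto. For injectivity
no basis of H_n(1,q) is available in advance, so modules are used: for each character b ↦ q^u, c ↦
q^w there is an induced module with basis d^s a^i v, built by hand in `ind_rels`. Applying the image
of ∑ f_{ij} ⋈ x^i g^j to v gives ∑ q^{uj} f_{ij}(x^s g^{i-s+w}) / (s)! · d^s a^i v. Coordinates
separate s and i, Fourier inversion in u separates j, and varying w reaches every power of g; so all
f_{ij} vanish.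

Simple modules. Since α_i(l) ≠ 0 for 0 < i < l, the operator d lowers any nonzero vector to a
multiple of v_1, and a then recovers the whole basis. If V ≅ V*, the image of v_1 is a functional
killing every v_i except v_l, and comparing weights of b gives 2r ≡ 1 - l. Conversely, under this
congruence the antipode acts on matrices as A ↦ K⁻¹ Aᵀ K with K antidiagonal
(`twistTranspose_matRep`). The same K yields the isomorphism V ≅ V*, and the trace of A ↦ K⁻¹ Aᵀ K
is the sum of ratios of opposite entries of K. The entries satisfy a first-order recursion whose
solution involves p^{k(k+2-l)/2}; this is where the square root q of p enters. -/

namespace TaftDouble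

/-! ### Sums over one period of a function on the integers -/

section PeriodicSums

variable {M : Type*} [AddCommGroup M] {n : ℕ}

/-- Moving the window by one replaces φ(k) by φ(n + k), which are equal. Exponents of g and indices
of idempotents are kept in ℤ and summed over `Finset.range n`, so every change of index below goes
through this lemma instead of through residues. -/
theorem sum_range_add_int {φ : ℤ → M} (h : ∀ t, φ (t + n) = φ t) (k : ℤ) :
    ∑ t ∈ Finset.range n, φ (t + k) = ∑ t ∈ Finset.range n, φ t := by
  have step : ∀ k : ℤ, ∑ t ∈ Finset.range n, φ (t + (k + 1)) =
      ∑ t ∈ Finset.range n, φ (t + k) := by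
    intro k
    have h1 := Finset.sum_range_succ (fun t : ℕ => φ (t + k)) n
    have h2 := Finset.sum_range_succ' (fun t : ℕ => φ (t + k)) n
    have h3 : φ ((n : ℤ) + k) = φ (((0 : ℕ) : ℤ) + k) := by
      rw [add_comm, h]; simp
    rw [h1, h3] at h2
    have h4 := add_right_cancel h2
    rw [h4]
    refine Finset.sum_congr rfl fun t _ => ?_
    congr 1; push_cast; ring
  induction k using Int.induction_on with
  | zero => simp
  | succ k ih => rw [step, ih]
  | pred k ih => rw [← ih, ← step]; simp

theorem sum_range_sub_int {φ : ℤ → M} (h : ∀ t, φ (t + n) = φ t) (k : ℤ) :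
    ∑ t ∈ Finset.range n, φ (k - t) = ∑ t ∈ Finset.range n, φ t := by
  rw [← sum_range_add_int h (k - (n - 1)),
    ← Finset.sum_range_reflect (fun t : ℕ => φ (t + (k - (n - 1)))) n]
  refine Finset.sum_congr rfl fun t ht => ?_
  have := Finset.mem_range.1 ht
  congr 1
  rw [Nat.cast_sub (by omega), Nat.cast_sub (by omega)]
  push_cast; ring

/-- After the window is shifted to start at k, only its first element is congruent to k. -/
theorem sum_range_ite_dvd [NeZero n] {φ : ℤ → M} (h : ∀ t, φ (t + n) = φ t) (k : ℤ) :
    ∑ t ∈ Finset.range n, (if (n : ℤ) ∣ t - k then φ t else 0) = φ k := by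
  have hp : ∀ t : ℤ, (if (n : ℤ) ∣ t + n - k then φ (t + n) else 0) =
      if (n : ℤ) ∣ t - k then φ t else 0 := by
    intro t
    have : (n : ℤ) ∣ t + n - k ↔ (n : ℤ) ∣ t - k := by
      rw [show t + n - k = t - k + n by ring]; simp
    simp only [this, h]
  have h1 := sum_range_add_int (φ := fun t => if (n : ℤ) ∣ t - k then φ t else 0) hp k
  simp only [add_sub_cancel_right] at h1
  rw [← h1, Finset.sum_eq_single 0]
  · simp
  · intro t ht h0
    have := Finset.mem_range.1 ht
    rw [if_neg]
    intro hd
    exact h0 (Nat.eq_zero_of_dvd_of_lt (Int.natCast_dvd_natCast.1 hd) this)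
  · intro h0; exact absurd (Finset.mem_range.2 (NeZero.pos n)) h0

end PeriodicSums

/-! ### Character sums, q-integers and q-factorials -/

section RootsOfUnity

variable {n : ℕ} {q : ℂ}

theorem zpow_add_order [NeZero n] (hq : IsPrimitiveRoot q n) (t : ℤ) : q ^ (t + n) = q ^ t := by
  rw [zpow_add₀ (hq.ne_zero (NeZero.ne n)), zpow_natCast, hq.pow_eq_one, mul_one]

theorem sum_zpow_mul [NeZero n] (hq : IsPrimitiveRoot q n) (k : ℤ) :
    ∑ t ∈ Finset.range n, q ^ ((t : ℤ) * k) = if (n : ℤ) ∣ k then (n : ℂ) else 0 := by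
  have h1 : ∀ t : ℕ, q ^ ((t : ℤ) * k) = (q ^ k) ^ t := fun t => by
    rw [mul_comm, zpow_mul, zpow_natCast]
  simp only [h1]
  by_cases hk : (n : ℤ) ∣ k
  · rw [if_pos hk, (hq.zpow_eq_one_iff_dvd k).2 hk]; simp
  · rw [if_neg hk]
    have h2 : q ^ k - 1 ≠ 0 := sub_ne_zero.2 fun h => hk ((hq.zpow_eq_one_iff_dvd k).1 h)
    refine (mul_eq_zero.1 ?_).resolve_right h2
    rw [geom_sum_mul, ← zpow_natCast, zpow_comm, zpow_natCast, hq.pow_eq_one, one_zpow, sub_self]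

theorem qInt_mul_sub_one (i : ℕ) : qInt q i * (q - 1) = q ^ i - 1 := geom_sum_mul q i

/-- For n > 1 the first factor vanishes. For n = 1 it equals 1, but then q = 1 and the second factor
vanishes; the product form covers both cases at once. -/
theorem qInt_order_mul (hq : IsPrimitiveRoot q n) (z : ℤ) : qInt q n * (1 - q ^ z) = 0 := by
  by_cases h1 : q = 1
  · simp [h1]
  · have h2 : qInt q n * (q - 1) = 0 := by rw [qInt_mul_sub_one, hq.pow_eq_one, sub_self]
    rw [(mul_eq_zero.1 h2).resolve_right (sub_ne_zero.2 h1), zero_mul]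

theorem qInt_ne_zero (hq : IsPrimitiveRoot q n) {k : ℕ} (h0 : 0 < k) (hk : k < n) : qInt q k ≠ 0 := by
  intro h
  have := qInt_mul_sub_one (q := q) k
  rw [h, zero_mul, eq_comm, sub_eq_zero] at this
  exact hq.pow_ne_one_of_pos_of_lt h0.ne' hk this

theorem qFactorial_ne_zero (hq : IsPrimitiveRoot q n) {k : ℕ} (hk : k < n) : qFactorial q k ≠ 0 :=
  Finset.prod_ne_zero_iff.2 fun i hi =>
    qInt_ne_zero hq (Nat.succ_pos i) (by have := Finset.mem_range.1 hi; omega)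

theorem qInt_succ (i : ℕ) : qInt q (i + 1) = 1 + q * qInt q i := by
  rw [qInt, Finset.sum_range_succ', qInt, Finset.mul_sum, add_comm]
  simp [pow_succ']

theorem qInt_add (i j : ℕ) : qInt q (i + j) = qInt q i + q ^ i * qInt q j := by
  simp only [qInt, Finset.sum_range_add, Finset.mul_sum, pow_add]

theorem qFactorial_zero : qFactorial q 0 = 1 := by simp [qFactorial]

theorem qFactorial_succ (i : ℕ) : qFactorial q (i + 1) = qFactorial q i * qInt q (i + 1) :=
  Finset.prod_range_succ _ _

/-- Double induction with the q-Pascal rule and (i+j+2)_q = (j+1)_q + q^{j+1} (i+1)_q. Without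
division the identity holds for every q, including roots of unity of small order. -/
theorem gauss_add_mul_qFactorial (i j : ℕ) :
    gauss q (i + j) j * (qFactorial q i * qFactorial q j) = qFactorial q (i + j) := by
  induction i generalizing j with
  | zero => simp [gauss_self, qFactorial_zero]
  | succ i ihi =>
    induction j with
    | zero => simp [gauss_zero_right, qFactorial_zero]
    | succ j ihj =>
      have h1 := ihi (j + 1)
      have h3 : qInt q (i + 1 + (j + 1)) = qInt q (j + 1) + q ^ (j + 1) * qInt q (i + 1) := by
        rw [add_comm (i + 1), qInt_add]
      have e : i + 1 + (j + 1) = (i + (j + 1)) + 1 := by omega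
      have e' : i + 1 + j = i + (j + 1) := by omega
      rw [e'] at ihj
      rw [e] at h3
      rw [e, qFactorial_succ (i + (j + 1)), h3, gauss]
      simp only [qFactorial_succ i, qFactorial_succ j] at *
      linear_combination q ^ (j + 1) * qInt q (i + 1) * h1 + qInt q (j + 1) * ihj

end RootsOfUnity

/-! ### Spectral idempotents of an element of order n -/

section Idempotents

variable {B : Type*} [Ring B] [Algebra ℂ B] {n : ℕ} {q : ℂ}

/-- The element `n⁻¹ ∑ q ^ (-t m) c ^ m`; if `c ^ n = 1`, the idempotent on whose range `c` acts
by `q ^ t`. -/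
noncomputable def idem (n : ℕ) (q : ℂ) (c : B) (t : ℤ) : B :=
  ∑ m ∈ Finset.range n, ((n : ℂ)⁻¹ * q ^ (-(t * m))) • c ^ m

theorem idem_add_order [NeZero n] (hq : IsPrimitiveRoot q n) (c : B) (t : ℤ) :
    idem n q c (t + n) = idem n q c t := by
  refine Finset.sum_congr rfl fun m _ => ?_
  have : q ^ (-((t + n) * m)) = q ^ (-(t * m)) := by
    rw [show -((t + n) * (m : ℤ)) = -(t * m) + n * (-m) by ring,
      zpow_add₀ (hq.ne_zero (NeZero.ne n)), zpow_mul, zpow_natCast, hq.pow_eq_one, one_zpow,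
      mul_one]
  rw [this]

theorem sum_idem [NeZero n] (hq : IsPrimitiveRoot q n) (c : B) :
    ∑ t ∈ Finset.range n, idem n q c t = 1 := by
  simp only [idem]
  rw [Finset.sum_comm, Finset.sum_eq_single 0]
  · have : (n : ℂ)⁻¹ * n = 1 := inv_mul_cancel₀ (Nat.cast_ne_zero.2 (NeZero.ne n))
    simp only [Nat.cast_zero, mul_zero, neg_zero, zpow_zero, mul_one, pow_zero, Finset.sum_const,
      Finset.card_range, ← Nat.cast_smul_eq_nsmul ℂ, smul_smul]
    rw [mul_comm, this, one_smul]
  · intro m hm h0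
    have hd : ¬ (n : ℤ) ∣ -(m : ℤ) := by
      rw [dvd_neg]
      intro h
      exact h0 (Nat.eq_zero_of_dvd_of_lt (Int.natCast_dvd_natCast.1 h) (Finset.mem_range.1 hm))
    rw [← Finset.sum_smul, ← Finset.mul_sum]
    have := sum_zpow_mul hq (-(m : ℤ))
    rw [if_neg hd] at this
    simp only [mul_neg] at this
    rw [this, mul_zero, zero_smul]
  · intro h; exact absurd (Finset.mem_range.2 (NeZero.pos n)) h

theorem mul_idem [NeZero n] (hq : IsPrimitiveRoot q n) {c : B} (hc : c ^ n = 1) (t : ℤ) :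
    c * idem n q c t = q ^ t • idem n q c t := by
  have h0 := hq.ne_zero (NeZero.ne n)
  let φ : ℕ → B := fun m => ((n : ℂ)⁻¹ * q ^ (-(t * m))) • c ^ m
  have h1 : ∀ m : ℕ, c * φ m = q ^ t • φ (m + 1) := by
    intro m
    simp only [φ]
    rw [mul_smul_comm, ← pow_succ', smul_smul, mul_left_comm, ← zpow_add₀ h0]
    congr 3; push_cast; ring
  have h2 : φ n = φ 0 := by
    simp only [φ]
    rw [hc, pow_zero, show -(t * (n : ℤ)) = n * (-t) by ring, zpow_mul, zpow_natCast,
      hq.pow_eq_one, one_zpow]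
    simp
  change c * ∑ m ∈ Finset.range n, φ m = q ^ t • ∑ m ∈ Finset.range n, φ m
  rw [Finset.mul_sum, Finset.sum_congr rfl fun m _ => h1 m, ← Finset.smul_sum]
  congr 1
  have h3 := Finset.sum_range_succ φ n
  rw [Finset.sum_range_succ', h2] at h3
  exact add_right_cancel h3

theorem pow_mul_idem [NeZero n] (hq : IsPrimitiveRoot q n) {c : B} (hc : c ^ n = 1) (k : ℕ)
    (t : ℤ) : c ^ k * idem n q c t = q ^ (t * k) • idem n q c t := by
  induction k with
  | zero => simp
  | succ k ih =>
    rw [pow_succ, mul_assoc, mul_idem hq hc, mul_smul_comm, ih, smul_smul,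
      ← zpow_add₀ (hq.ne_zero (NeZero.ne n))]
    congr 2; push_cast; ring

theorem Commute.idem_right {b c : B} (h : Commute b c) (t : ℤ) : Commute b (idem n q c t) :=
  Commute.sum_right _ _ _ fun m _ => (h.pow_right m).smul_right _

theorem idem_mul_idem [NeZero n] (hq : IsPrimitiveRoot q n) {c : B} (hc : c ^ n = 1) (s t : ℤ) :
    idem n q c s * idem n q c t = if (n : ℤ) ∣ t - s then idem n q c t else 0 := by
  conv_lhs => rw [idem]
  simp only [Finset.sum_mul, smul_mul_assoc, pow_mul_idem hq hc, smul_smul, ← Finset.sum_smul]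
  have h := sum_zpow_mul hq (t - s)
  have h0 := hq.ne_zero (NeZero.ne n)
  have : ∑ m ∈ Finset.range n, (n : ℂ)⁻¹ * q ^ (-(s * m)) * q ^ (t * m) =
      (n : ℂ)⁻¹ * ∑ m ∈ Finset.range n, q ^ ((m : ℤ) * (t - s)) := by
    rw [Finset.mul_sum]
    refine Finset.sum_congr rfl fun m _ => ?_
    rw [mul_assoc, ← zpow_add₀ h0]
    congr 2; ring
  rw [this, h]
  split_ifs
  · rw [inv_mul_cancel₀ (Nat.cast_ne_zero.2 (NeZero.ne n)), one_smul]
  · simp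

/-- An element that q^k-commutes with c shifts the eigenvalues of c. Powers of d use k = s, and a
uses k = -1. -/
theorem mul_idem_of_smul_comm [NeZero n] (hq : IsPrimitiveRoot q n) {c x : B} (k : ℤ)
    (h : x * c = q ^ k • (c * x)) (t : ℤ) : x * idem n q c t = idem n q c (t - k) * x := by
  have h0 := hq.ne_zero (NeZero.ne n)
  rw [idem, idem, Finset.mul_sum, Finset.sum_mul]
  refine Finset.sum_congr rfl fun m _ => ?_
  rw [mul_smul_comm, qcomm_pow h, smul_mul_assoc, smul_smul, mul_assoc, ← zpow_natCast,
    ← zpow_mul, ← zpow_add₀ h0]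
  congr 3; ring

end Idempotents

/-! ### Commutation rules in an algebra satisfying the relations of H_n(1,q) -/

section Rels

namespace ChenRels

variable {B : Type*} [Ring B] [Algebra ℂ B] {n : ℕ} {q : ℂ} {a b c d : B}

theorem d_pow_mul_c (h : ChenRels n q a b c d) (s : ℕ) :
    d ^ s * c = q ^ s • (c * d ^ s) := by
  induction s with
  | zero => simp
  | succ s ih =>
    rw [pow_succ, mul_assoc, h.dc, mul_smul_comm, ← mul_assoc, ih, smul_mul_assoc, smul_smul,
      mul_assoc, pow_succ, mul_comm]

theorem d_pow_mul_b (h : ChenRels n q a b c d) (s : ℕ) :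
    d ^ s * b = q ^ s • (b * d ^ s) := by
  induction s with
  | zero => simp
  | succ s ih =>
    rw [pow_succ, mul_assoc, h.db, mul_smul_comm, ← mul_assoc, ih, smul_mul_assoc, smul_smul,
      mul_assoc, pow_succ, mul_comm]

theorem d_pow_mul_idem [NeZero n] (hq : IsPrimitiveRoot q n) (h : ChenRels n q a b c d) (s : ℕ)
    (t : ℤ) : d ^ s * idem n q c t = idem n q c (t - s) * d ^ s :=
  mul_idem_of_smul_comm hq s (by rw [h.d_pow_mul_c, zpow_natCast]) t

theorem a_mul_idem [NeZero n] (hq : IsPrimitiveRoot q n) (h : ChenRels n q a b c d) (t : ℤ) :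
    a * idem n q c t = idem n q c (t + 1) * a := by
  have := mul_idem_of_smul_comm hq (c := c) (x := a) (-1) (by
    rw [h.ca, smul_smul, zpow_neg_one, inv_mul_cancel₀ (hq.ne_zero (NeZero.ne n)), one_smul]) t
  rwa [sub_neg_eq_add] at this

/-- Induction on s, using that d passes bc at the cost of q² and that q (s+1)_q = q^{s+1} - 1 +
(s+1)_q. The correction term is the source of the lower-degree terms in the straightening of x and
in the action of a on induced modules. -/
theorem d_pow_succ_mul_a (h : ChenRels n q a b c d) (s : ℕ) :
    d ^ (s + 1) * a = q ^ (s + 1) • (a * d ^ (s + 1)) +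
      qInt q (s + 1) • ((1 - q ^ s • (b * c)) * d ^ s) := by
  have hda : d * a = q • (a * d) + (1 - b * c) := by rw [← h.da]; abel
  induction s with
  | zero => simp [hda, qInt]
  | succ s ih =>
    have hdbc : d * (b * c) = q ^ 2 • (b * c * d) := by
      rw [← mul_assoc, h.db, smul_mul_assoc, mul_assoc, h.dc, mul_smul_comm, smul_smul, mul_assoc,
        sq]
    rw [pow_succ' d (s + 1), mul_assoc, ih, mul_add, mul_smul_comm, mul_smul_comm, ← mul_assoc d a,
      hda, ← mul_assoc d _ (d ^ s), mul_sub, mul_one, mul_smul_comm, hdbc]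
    simp only [add_mul, sub_mul, smul_mul_assoc, one_mul, smul_add, smul_sub, smul_smul]
    simp only [mul_assoc, ← pow_succ']
    rw [qInt_succ (s + 1)]
    have e : qInt q (s + 1) * q = q ^ (s + 1) - 1 + qInt q (s + 1) := by
      have := qInt_mul_sub_one (q := q) (s + 1)
      linear_combination this
    have e1 : (1 + q * qInt q (s + 1)) * q ^ (s + 1) =
        q ^ (s + 1) + qInt q (s + 1) * (q ^ s * q ^ 2) := by ring
    have e2 : (1 + q * qInt q (s + 1)) = q ^ (s + 1) + qInt q (s + 1) := by
      linear_combination e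
    rw [e1, e2, ← pow_succ q (s + 1)]
    module

theorem b_mul_idem (h : ChenRels n q a b c d) (t : ℤ) :
    b * idem n q c t = idem n q c t * b :=
  Commute.idem_right (show Commute b c from h.bc) t

theorem d_pow_eq_zero (h : ChenRels n q a b c d) {s : ℕ} (hs : n ≤ s) : d ^ s = 0 := by
  obtain ⟨k, rfl⟩ := Nat.exists_eq_add_of_le hs
  rw [pow_add, h.d_pow, zero_mul]

end ChenRels

/-- The image in `H_n(1,q)` of the element of `H_n(q)*` dual to `x ^ s g ^ t`. -/
noncomputable def dualMonomial {B : Type*} [Ring B] [Algebra ℂ B] (n : ℕ) (q : ℂ) (c d : B)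
    (s : ℕ) (t : ℤ) : B :=
  (qFactorial q s)⁻¹ • (idem n q c t * d ^ s)

section DualMonomial

variable {B : Type*} [Ring B] [Algebra ℂ B] {n : ℕ} [NeZero n] {q : ℂ} {a b c d : B}

theorem dualMonomial_add_order (hq : IsPrimitiveRoot q n) (c d : B) (s : ℕ) (t : ℤ) :
    dualMonomial n q c d s (t + n) = dualMonomial n q c d s t := by
  rw [dualMonomial, idem_add_order hq, dualMonomial]

/-- Moving d^s past E_{t'} gives E_{t'-s}, and orthogonality of idempotents leaves only t' ≡ s + t.
The Gaussian binomial is the ratio (s+s')! / ((s)! (s')!). When s + s' ≥ n that quotient is not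
available, but both sides vanish because d^n = 0. -/
theorem dualMonomial_mul (hq : IsPrimitiveRoot q n) (h : ChenRels n q a b c d) {s s' : ℕ}
    (hs : s < n) (hs' : s' < n) (t t' : ℤ) :
    dualMonomial n q c d s t * dualMonomial n q c d s' t' =
      if (n : ℤ) ∣ t' - (s + t) then
        gauss q (s + s') s' • dualMonomial n q c d (s + s') t else 0 := by
  have h1 : idem n q c t * d ^ s * (idem n q c t' * d ^ s') =
      idem n q c t * idem n q c (t' - s) * d ^ (s + s') := by
    rw [pow_add, mul_assoc, ← mul_assoc (d ^ s), h.d_pow_mul_idem hq]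
    simp only [mul_assoc]
  simp only [dualMonomial]
  rw [smul_mul_smul_comm, h1, (Commute.idem_right (Commute.idem_right (Commute.refl c) t).symm (t' - s)).eq,
    idem_mul_idem hq h.c_pow]
  have hd : (n : ℤ) ∣ t - (t' - s) ↔ (n : ℤ) ∣ t' - (s + t) := by
    rw [← dvd_neg]; ring_nf
  simp only [hd]
  split_ifs
  · by_cases hn : s + s' < n
    · rw [smul_smul]
      congr 1
      have := gauss_add_mul_qFactorial (q := q) s s'
      have h1 := qFactorial_ne_zero hq hs
      have h2 := qFactorial_ne_zero hq hs'
      have h3 := qFactorial_ne_zero hq hn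
      field_simp
      linear_combination -this
    · rw [h.d_pow_eq_zero (not_lt.1 hn)]; simp
  · simp

theorem b_mul_dualMonomial (hq : IsPrimitiveRoot q n) (h : ChenRels n q a b c d) (s : ℕ) (t : ℤ) :
    b * dualMonomial n q c d s t = q ^ (-(s : ℤ)) • (dualMonomial n q c d s t * b) := by
  have h0 := hq.ne_zero (NeZero.ne n)
  rw [dualMonomial, smul_mul_assoc, mul_assoc, h.d_pow_mul_b, mul_smul_comm, mul_smul_comm,
    ← mul_assoc, h.b_mul_idem, mul_assoc, smul_comm, smul_smul _ (q ^ s), zpow_neg,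
    zpow_natCast, inv_mul_cancel₀ (pow_ne_zero _ h0), one_smul]

theorem a_mul_dualMonomial_zero (hq : IsPrimitiveRoot q n) (h : ChenRels n q a b c d) (t : ℤ) :
    a * dualMonomial n q c d 0 t = dualMonomial n q c d 0 (t + 1) * a := by
  simp [dualMonomial, qFactorial_zero, h.a_mul_idem hq]

/-- `d_pow_succ_mul_a` is solved for a d^{s+1}, and the factor (s+1)_q of its correction term
cancels against the factorial, lowering the degree by one. The three terms correspond to the three
terms of the iterated coproduct of x. -/
theorem a_mul_dualMonomial_succ (hq : IsPrimitiveRoot q n) (h : ChenRels n q a b c d) {s : ℕ}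
    (hs : s + 1 < n) (t : ℤ) :
    a * dualMonomial n q c d (s + 1) t =
      q ^ (-(s + 1 : ℤ)) • (dualMonomial n q c d (s + 1) (t + 1) * a) +
      q ^ (t - s) • (dualMonomial n q c d s (t + 1) * b) -
      q ^ (-(s + 1 : ℤ)) • dualMonomial n q c d s (t + 1) := by
  have h0 := hq.ne_zero (NeZero.ne n)
  have h1 := h.d_pow_succ_mul_a s
  have hi := qInt_ne_zero hq (Nat.succ_pos s) hs
  have hf := qFactorial_ne_zero hq (k := s) (by omega)
  have h2 : a * d ^ (s + 1) = q ^ (-(s + 1 : ℤ)) • (d ^ (s + 1) * a) -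
      (q ^ (-(s + 1 : ℤ)) * qInt q (s + 1)) • ((1 - q ^ s • (b * c)) * d ^ s) := by
    have e : q ^ (-(s + 1 : ℤ)) * q ^ (s + 1) = 1 := by
      rw [← zpow_natCast, ← zpow_add₀ h0]; push_cast; simp
    rw [h1, smul_add, smul_smul, smul_smul, e, one_smul, add_sub_cancel_right]
  -- Next to the idempotent E_{t+1} the factor c is the scalar q^{t+1}, so bc contributes only b.
  have h3 : idem n q c (t + 1) * (b * c * d ^ s) =
      (q ^ (t + 1) * q ^ (-(s : ℤ))) • (idem n q c (t + 1) * d ^ s * b) := by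
    have e : b * d ^ s = q ^ (-(s : ℤ)) • (d ^ s * b) := by
      rw [h.d_pow_mul_b, smul_smul, zpow_neg, zpow_natCast, inv_mul_cancel₀ (pow_ne_zero _ h0),
        one_smul]
    have e2 : idem n q c (t + 1) * c = q ^ (t + 1) • idem n q c (t + 1) := by
      rw [← (Commute.idem_right (Commute.refl c) (t + 1)).eq, mul_idem hq h.c_pow]
    rw [h.bc, mul_assoc, e, mul_smul_comm, mul_smul_comm, ← mul_assoc, e2, smul_mul_assoc,
      smul_smul, ← mul_assoc, mul_comm (q ^ (-(s : ℤ)))]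
  have key : a * (idem n q c t * d ^ (s + 1)) =
      q ^ (-(s + 1 : ℤ)) • (idem n q c (t + 1) * d ^ (s + 1) * a) -
      (q ^ (-(s + 1 : ℤ)) * qInt q (s + 1)) • (idem n q c (t + 1) * d ^ s) +
      (q ^ (t - s) * qInt q (s + 1)) • (idem n q c (t + 1) * d ^ s * b) := by
    rw [← mul_assoc, h.a_mul_idem hq, mul_assoc, h2, mul_sub, mul_smul_comm, mul_smul_comm,
      sub_mul, one_mul, mul_sub, smul_mul_assoc, mul_smul_comm, h3, smul_sub, smul_smul,
      smul_smul, ← mul_assoc]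
    have e3 : q ^ (-(s + 1 : ℤ)) * qInt q (s + 1) * q ^ s * (q ^ (t + 1) * q ^ (-(s : ℤ))) =
        q ^ (t - s) * qInt q (s + 1) := by
      have : q ^ (-(s + 1 : ℤ)) * q ^ (s : ℤ) * q ^ (t + 1) * q ^ (-(s : ℤ)) = q ^ (t - s) := by
        rw [← zpow_add₀ h0, ← zpow_add₀ h0, ← zpow_add₀ h0]; congr 1; ring
      rw [← this, zpow_natCast]; ring
    rw [e3]
    abel
  simp only [dualMonomial]
  rw [mul_smul_comm, key, qFactorial_succ]
  simp only [smul_add, smul_sub, smul_smul, smul_mul_assoc]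
  have e4 : (qFactorial q s * qInt q (s + 1))⁻¹ * (q ^ (-(s + 1 : ℤ)) * qInt q (s + 1)) =
      q ^ (-(s + 1 : ℤ)) * (qFactorial q s)⁻¹ := by field_simp
  have e5 : (qFactorial q s * qInt q (s + 1))⁻¹ * (q ^ (t - s : ℤ) * qInt q (s + 1)) =
      q ^ (t - s : ℤ) * (qFactorial q s)⁻¹ := by field_simp
  rw [e4, e5, mul_comm (q ^ (-(s + 1 : ℤ))) (qFactorial q s * _)⁻¹]
  abel

end DualMonomial

end Rels

/-- Products and coproducts of monomials of total degree s are indexed by i + j = s < n. As x^n = 0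
and d^n = 0 kill the terms with i + j ≥ n, the triangle may be enlarged to the full square. -/
theorem sum_range_triangle {M : Type*} [AddCommMonoid M] (n : ℕ) (φ : ℕ → ℕ → M)
    (h : ∀ i j, n ≤ i + j → φ i j = 0) :
    ∑ s ∈ Finset.range n, ∑ k ∈ Finset.range (s + 1), φ k (s - k) =
      ∑ i ∈ Finset.range n, ∑ j ∈ Finset.range n, φ i j := by
  rw [Finset.sum_range_diag_flip]
  refine Finset.sum_congr rfl fun i _ => ?_
  refine Finset.sum_subset (Finset.range_subset_range.2 (Nat.sub_le n i)) fun j _ hj => h i j ?_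
  rw [Finset.mem_range] at hj
  omega

theorem sum_range_triangle' {M : Type*} [AddCommMonoid M] (n : ℕ) (φ : ℕ → ℕ → M)
    (h : ∀ i j, n ≤ i + j → φ i j = 0) :
    ∑ s ∈ Finset.range n, ∑ k ∈ Finset.range (s + 1), φ (s - k) k =
      ∑ i ∈ Finset.range n, ∑ j ∈ Finset.range n, φ i j := by
  rw [← sum_range_triangle n φ h]
  refine Finset.sum_congr rfl fun s _ => ?_
  rw [← Finset.sum_range_reflect]
  refine Finset.sum_congr rfl fun k hk => ?_
  have := Finset.mem_range.1 hk
  rw [Nat.add_sub_cancel, Nat.sub_sub_self (by omega)]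

/-- Powers of a product of `r`-commuting elements. -/
theorem mul_pow_of_smul_comm {A : Type*} [Ring A] [Algebra ℂ A] {r : ℂ} {X Y : A}
    (h : Y * X = r • (X * Y)) (s : ℕ) : (X * Y) ^ s = r ^ s.choose 2 • (X ^ s * Y ^ s) := by
  induction s with
  | zero => simp
  | succ s ih =>
    have h1 : Y ^ s * X = r ^ s • (X * Y ^ s) := by
      clear ih
      induction s with
      | zero => simp
      | succ s ih =>
        rw [pow_succ, mul_assoc, h, mul_smul_comm, ← mul_assoc, ih, smul_mul_assoc, smul_smul,
          mul_assoc, pow_succ, mul_comm]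
    rw [pow_succ, ih, smul_mul_assoc, mul_assoc, ← mul_assoc (Y ^ s), h1, smul_mul_assoc,
      mul_smul_comm, smul_smul, Nat.choose_succ_succ' s 1, Nat.choose_one_right, ← pow_add,
      mul_assoc X, ← pow_succ, ← mul_assoc, ← pow_succ, add_comm s (s.choose _)]

/-! ### Structure maps of the Taft algebra on monomials -/

namespace TaftAlgebra

variable {n : ℕ} [NeZero n] {q : ℂ} (hq : IsPrimitiveRoot q n)

/-- The group-like generator as a unit. -/
noncomputable def gUnit : (TaftAlgebra hq)ˣ :=
  ⟨g hq, g hq ^ (n - 1), g_mul_inv hq, inv_mul_g hq⟩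

theorem gUnit_pow_order : gUnit hq ^ n = 1 :=
  Units.ext (by rw [Units.val_pow_eq_pow_val]; exact (rels hq).g_pow)

theorem gUnit_zpow_mul_x (t : ℤ) : ((gUnit hq ^ t : (TaftAlgebra hq)ˣ) : TaftAlgebra hq) * x hq =
    q ^ t • (x hq * ((gUnit hq ^ t : (TaftAlgebra hq)ˣ) : TaftAlgebra hq)) := by
  have h0 := hq.ne_zero (NeZero.ne n)
  have hx : (gUnit hq : TaftAlgebra hq) * x hq = q • (x hq * gUnit hq) := (rels hq).gx
  have hx' : ((gUnit hq)⁻¹ : (TaftAlgebra hq)ˣ) * x hq =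
      q⁻¹ • (x hq * ((gUnit hq)⁻¹ : (TaftAlgebra hq)ˣ)) := by
    rw [Units.inv_mul_eq_iff_eq_mul, mul_smul_comm, ← mul_assoc, hx, smul_mul_assoc,
      Units.mul_inv_cancel_right, smul_smul, inv_mul_cancel₀ h0, one_smul]
  induction t using Int.induction_on with
  | zero => simp
  | succ t ih =>
    rw [zpow_add_one, Units.val_mul, mul_assoc, hx, mul_smul_comm, ← mul_assoc, ih,
      smul_mul_assoc, smul_smul, mul_assoc, zpow_add_one₀ h0, mul_comm q]
  | pred t ih =>
    rw [zpow_sub_one, Units.val_mul, mul_assoc, hx', mul_smul_comm, ← mul_assoc, ih,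
      smul_mul_assoc, smul_smul, mul_assoc, zpow_sub_one₀ h0, mul_comm q⁻¹]

/-- The monomial `x ^ s g ^ t`. -/
noncomputable def monomial (s : ℕ) (t : ℤ) : TaftAlgebra hq :=
  x hq ^ s * ((gUnit hq ^ t : (TaftAlgebra hq)ˣ) : TaftAlgebra hq)

theorem monomial_natCast (s t : ℕ) : monomial hq s t = x hq ^ s * g hq ^ t := by
  simp [monomial, gUnit]

theorem monomial_add_order (s : ℕ) (t : ℤ) : monomial hq s (t + n) = monomial hq s t := by
  rw [monomial, zpow_add, zpow_natCast, gUnit_pow_order, mul_one, monomial]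

theorem monomial_eq_zero {s : ℕ} (hs : n ≤ s) (t : ℤ) : monomial hq s t = 0 := by
  obtain ⟨k, rfl⟩ := Nat.exists_eq_add_of_le hs
  rw [monomial, pow_add, (rels hq).x_pow, zero_mul, zero_mul]

theorem monomial_mul (s s' : ℕ) (t t' : ℤ) : monomial hq s t * monomial hq s' t' =
    q ^ (t * s') • monomial hq (s + s') (t + t') := by
  simp only [monomial]
  rw [mul_assoc, ← mul_assoc (Units.val _), qcomm_pow (gUnit_zpow_mul_x hq t), smul_mul_assoc,
    mul_smul_comm, zpow_add, Units.val_mul, pow_add, ← zpow_natCast, ← zpow_mul]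
  simp only [mul_assoc]

/-- The elements 1 ⊗ x and x ⊗ g q-commute, so the q-binomial theorem applies. Its coefficients and
the exponent s - k + t in the second factor are those of `dualMonomial_mul`. -/
theorem comul_monomial (s t : ℕ) : Coalgebra.comul (R := ℂ) (monomial hq s t) =
    ∑ k ∈ Finset.range (s + 1),
      gauss q s k • (monomial hq (s - k) t ⊗ₜ[ℂ] monomial hq k ((s - k : ℕ) + t)) := by
  have h1 : (x hq ⊗ₜ[ℂ] g hq) * (1 ⊗ₜ[ℂ] x hq) = q • ((1 ⊗ₜ[ℂ] x hq) * (x hq ⊗ₜ[ℂ] g hq)) := by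
    simp [(rels hq).gx]
  have h2 : Coalgebra.comul (R := ℂ) (g hq ^ t) = (g hq ^ t) ⊗ₜ[ℂ] (g hq ^ t) := by
    rw [Bialgebra.comul_pow, comul_g, Algebra.TensorProduct.tmul_pow]
  rw [monomial_natCast, Bialgebra.comul_mul, Bialgebra.comul_pow, comul_x, h2, add_comm,
    qcomm_add_pow h1, Finset.sum_mul]
  refine Finset.sum_congr rfl fun k _ => ?_
  rw [← Nat.cast_add, monomial_natCast, monomial_natCast]
  simp [Algebra.TensorProduct.tmul_pow, pow_add, mul_assoc]

theorem counit_monomial (s : ℕ) (t : ℤ) :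
    Coalgebra.counit (R := ℂ) (monomial hq s t) = if s = 0 then 1 else 0 := by
  have h1 : Coalgebra.counit (R := ℂ) ((gUnit hq ^ t : (TaftAlgebra hq)ˣ) : TaftAlgebra hq) =
      1 := by
    have : Units.map (Bialgebra.counitAlgHom ℂ (TaftAlgebra hq)).toMonoidHom (gUnit hq) = 1 :=
      Units.ext (counit_g hq)
    have h2 : Units.map (Bialgebra.counitAlgHom ℂ (TaftAlgebra hq)).toMonoidHom (gUnit hq ^ t) =
      1 := by rw [map_zpow, this, one_zpow]
    exact congrArg Units.val h2
  rw [monomial, Bialgebra.counit_mul, Bialgebra.counit_pow, counit_x, h1, mul_one, zero_pow_eq]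

theorem antipode_pow (y : TaftAlgebra hq) (k : ℕ) :
    HopfAlgebra.antipode ℂ (y ^ k) = HopfAlgebra.antipode ℂ y ^ k := by
  induction k with
  | zero => simp
  | succ k ih => rw [pow_succ, HopfAlgebra.antipode_mul_antidistrib, ih, ← pow_succ']

theorem antipode_monomial (s t : ℕ) : HopfAlgebra.antipode ℂ (monomial hq s t) =
    ((-1) ^ s * (q⁻¹ ^ s.choose 2 * q ^ (-(t * s : ℤ)))) • monomial hq s (-t - s) := by
  have hg : g hq ^ (n - 1) = ((gUnit hq)⁻¹ : (TaftAlgebra hq)ˣ) := rfl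
  have h1 : g hq ^ (n - 1) * x hq = q⁻¹ • (x hq * g hq ^ (n - 1)) := by
    have := gUnit_zpow_mul_x hq (-1)
    rwa [zpow_neg_one, zpow_neg_one, ← hg] at this
  have h2 : ∀ k : ℕ, (g hq ^ (n - 1)) ^ k = monomial hq 0 (-k) := by
    intro k
    rw [hg, ← Units.val_pow_eq_pow_val, monomial, pow_zero, one_mul, zpow_neg, inv_pow,
      zpow_natCast]
  have h3 : x hq ^ s = monomial hq s 0 := by simp [monomial]
  rw [monomial_natCast, HopfAlgebra.antipode_mul_antidistrib, antipode_pow, antipode_pow,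
    antipode_g, antipode_x, neg_pow, mul_pow_of_smul_comm h1, h2, h2, h3, monomial_mul,
    mul_smul_comm, ← neg_one_smul ℂ (1 : TaftAlgebra hq), smul_pow, one_pow]
  simp only [smul_mul_assoc, one_mul, mul_smul_comm]
  rw [monomial_mul]
  simp only [smul_smul]
  simp only [Nat.cast_zero, mul_zero, zpow_zero, one_mul, add_zero, zero_add]
  rw [neg_mul, sub_eq_add_neg]
  congr 1
  ring

theorem monomial_ind {P : TaftAlgebra hq → Prop} (h0 : P 0)
    (hadd : ∀ y z, P y → P z → P (y + z)) (hsmul : ∀ (r : ℂ) y, P y → P (r • y))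
    (hmono : ∀ s < n, ∀ t < n, P (x hq ^ s * g hq ^ t)) (y : TaftAlgebra hq) : P y := by
  have hy : y ∈ Submodule.span ℂ (Set.range fun p : Fin n × Fin n =>
    x hq ^ (p.1 : ℕ) * g hq ^ (p.2 : ℕ)) := span_eq_top hq ▸ Submodule.mem_top
  induction hy using Submodule.span_induction with
  | mem y hy => obtain ⟨p, rfl⟩ := hy; exact hmono _ p.1.2 _ p.2.2
  | zero => exact h0
  | add y z _ _ hy hz => exact hadd _ _ hy hz
  | smul r y _ hy => exact hsmul _ _ hy

end TaftAlgebra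

/-- Eigenvalues of commuting elements multiply. Inserting 1 = ∑ E_{t'}(v) turns v into the scalar
q^{t'}, which leaves an idempotent of u of index t - t'. -/
theorem idem_mul_of_commute {B : Type*} [Ring B] [Algebra ℂ B] {n : ℕ} [NeZero n] {q : ℂ}
    (hq : IsPrimitiveRoot q n) {u v : B} (huv : Commute u v) (hv : v ^ n = 1) (t : ℤ) :
    idem n q (u * v) t = ∑ t' ∈ Finset.range n, idem n q u (t - t') * idem n q v t' := by
  have h0 := hq.ne_zero (NeZero.ne n)
  rw [← mul_one (idem n q (u * v) t), ← sum_idem hq v, Finset.mul_sum]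
  refine Finset.sum_congr rfl fun t' _ => ?_
  conv_lhs => arg 1; rw [idem]
  conv_rhs => arg 1; rw [idem]
  rw [Finset.sum_mul, Finset.sum_mul]
  refine Finset.sum_congr rfl fun m _ => ?_
  rw [huv.mul_pow, smul_mul_assoc, mul_assoc, pow_mul_idem hq hv, mul_smul_comm, smul_smul,
    smul_mul_assoc, mul_assoc _ _ (q ^ _), ← zpow_add₀ h0]
  congr 3; ring

theorem idem_inv {B : Type*} [Ring B] [Algebra ℂ B] {n : ℕ} [NeZero n] {q : ℂ}
    (hq : IsPrimitiveRoot q n) {c : B} (hc : c ^ n = 1) (t : ℤ) :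
    idem n q (c ^ (n - 1)) t = idem n q c (-t) := by
  have h0 := hq.ne_zero (NeZero.ne n)
  rw [← mul_one (idem n q (c ^ (n - 1)) t), ← sum_idem hq c, Finset.mul_sum]
  rw [← sum_range_ite_dvd (φ := idem n q c) (idem_add_order hq c) (-t)]
  refine Finset.sum_congr rfl fun u _ => ?_
  rw [idem]
  simp only [Finset.sum_mul, smul_mul_assoc, ← pow_mul, pow_mul_idem hq hc, smul_smul,
    ← Finset.sum_smul]
  have h := sum_zpow_mul hq (-((u : ℤ) - -t))
  have : ∑ m ∈ Finset.range n, (n : ℂ)⁻¹ * q ^ (-(t * m)) * q ^ ((u : ℤ) * ((n - 1) * m : ℕ)) =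
      (n : ℂ)⁻¹ * ∑ m ∈ Finset.range n, q ^ ((m : ℤ) * -((u : ℤ) - -t)) := by
    rw [Finset.mul_sum]
    refine Finset.sum_congr rfl fun m _ => ?_
    rw [mul_assoc, ← zpow_add₀ h0]
    congr 1
    -- On the eigenspace of index u the power c^{(n-1)m} acts by q^{u(n-1)m} = q^{-um}.
    have e : -(t * (m : ℤ)) + (u : ℤ) * ((n - 1) * m : ℕ) = m * -((u : ℤ) - -t) + n * (u * m) := by
      rw [Nat.cast_mul, Nat.cast_sub NeZero.one_le]; push_cast; ring
    rw [e, zpow_add₀ h0, zpow_mul q n, zpow_natCast, hq.pow_eq_one, one_zpow, mul_one]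
  rw [this, h]
  simp only [dvd_neg]
  split_ifs
  · rw [inv_mul_cancel₀ (Nat.cast_ne_zero.2 (NeZero.ne n)), one_smul]
  · simp

theorem map_idem {B C : Type*} [Ring B] [Algebra ℂ B] [Ring C] [Algebra ℂ C] (n : ℕ) (q : ℂ)
    (φ : B →ₐ[ℂ] C) (c : B) (t : ℤ) : φ (idem n q c t) = idem n q (φ c) t := by
  simp [idem]

/-! ### Structure maps of H_n(1,q) on the dual monomials -/

namespace ChenAlgebra

variable {n : ℕ} [NeZero n] {q : ℂ} (hq : IsPrimitiveRoot q n)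

/-- The image of the dual basis element of `x ^ s g ^ t`. -/
noncomputable abbrev dualMono (s : ℕ) (t : ℤ) : ChenAlgebra hq :=
  dualMonomial n q (c hq) (d hq) s t

theorem dualMono_add_order (s : ℕ) (t : ℤ) : dualMono hq s (t + n) = dualMono hq s t :=
  dualMonomial_add_order hq _ _ s t

theorem dualMono_mul {s s' : ℕ} (hs : s < n) (hs' : s' < n) (t t' : ℤ) :
    dualMono hq s t * dualMono hq s' t' =
      if (n : ℤ) ∣ t' - (s + t) then gauss q (s + s') s' • dualMono hq (s + s') t else 0 :=
  dualMonomial_mul hq (rels hq) hs hs' t t'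

theorem comul_idem (t : ℤ) : Coalgebra.comul (R := ℂ) (idem n q (c hq) t) =
    ∑ t' ∈ Finset.range n, idem n q (c hq) (t - t') ⊗ₜ[ℂ] idem n q (c hq) t' := by
  have h1 := map_idem n q (Bialgebra.comulAlgHom ℂ (ChenAlgebra hq)) (c hq) t
  rw [Bialgebra.comulAlgHom_apply, Bialgebra.comulAlgHom_apply, comul_c] at h1
  -- Writing c ⊗ c as a product of commuting factors splits its idempotents by
  -- `idem_mul_of_commute`.
  have h2 : c hq ⊗ₜ[ℂ] c hq = (c hq ⊗ₜ[ℂ] 1) * (1 ⊗ₜ[ℂ] c hq) := by simp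
  rw [h1, h2, idem_mul_of_commute hq (by simp [Commute, SemiconjBy])
    (by simp [Algebra.TensorProduct.tmul_pow, (rels hq).c_pow, Algebra.TensorProduct.one_def])]
  refine Finset.sum_congr rfl fun t' _ => ?_
  have h3 := map_idem n q (Algebra.TensorProduct.includeLeft (R := ℂ) (S := ℂ)
    (A := ChenAlgebra hq) (B := ChenAlgebra hq)) (c hq) (t - t')
  have h4 := map_idem n q (Algebra.TensorProduct.includeRight (R := ℂ)
    (A := ChenAlgebra hq) (B := ChenAlgebra hq)) (c hq) t'
  rw [Algebra.TensorProduct.includeLeft_apply, Algebra.TensorProduct.includeLeft_apply] at h3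
  rw [Algebra.TensorProduct.includeRight_apply, Algebra.TensorProduct.includeRight_apply] at h4
  rw [← h3, ← h4]
  simp

theorem comul_d_pow (s : ℕ) : Coalgebra.comul (R := ℂ) (d hq ^ s) =
    ∑ k ∈ Finset.range (s + 1),
      gauss q s k • ((d hq ^ k) ⊗ₜ[ℂ] (c hq ^ k * d hq ^ (s - k))) := by
  have h1 : (1 ⊗ₜ[ℂ] d hq) * (d hq ⊗ₜ[ℂ] c hq) = q • ((d hq ⊗ₜ[ℂ] c hq) * (1 ⊗ₜ[ℂ] d hq)) := by
    simp [(rels hq).dc]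
  rw [Bialgebra.comul_pow, comul_d, qcomm_add_pow h1]
  refine Finset.sum_congr rfl fun k _ => ?_
  simp [Algebra.TensorProduct.tmul_pow]

/-- The factor c^k produced by the coproduct of d^s is absorbed by E_{t'} and becomes q^{t'k}, while
the Gaussian binomial is absorbed by the factorials. The phase q^{t'k} is the one of `monomial_mul`,
as duality requires. -/
theorem comul_dualMono {s : ℕ} (hs : s < n) (t : ℤ) :
    Coalgebra.comul (R := ℂ) (dualMono hq s t) =
    ∑ k ∈ Finset.range (s + 1), ∑ t' ∈ Finset.range n,
      q ^ ((t' : ℤ) * k) • (dualMono hq k (t - t') ⊗ₜ[ℂ] dualMono hq (s - k) t') := by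
  rw [dualMono, dualMonomial, map_smul, Bialgebra.comul_mul, comul_idem, comul_d_pow,
    Finset.mul_sum, Finset.smul_sum]
  refine Finset.sum_congr rfl fun k hk => ?_
  rw [Finset.sum_mul, Finset.smul_sum]
  refine Finset.sum_congr rfl fun t' _ => ?_
  have hk' : k ≤ s := Nat.lt_succ_iff.1 (Finset.mem_range.1 hk)
  have h1 : idem n q (c hq) t' * (c hq ^ k * d hq ^ (s - k)) =
      q ^ ((t' : ℤ) * k) • (idem n q (c hq) t' * d hq ^ (s - k)) := by
    rw [← mul_assoc, ← (Commute.idem_right ((Commute.refl (c hq)).pow_left k) _).eq,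
      pow_mul_idem hq (rels hq).c_pow, smul_mul_assoc]
  rw [mul_smul_comm, Algebra.TensorProduct.tmul_mul_tmul, h1, TensorProduct.tmul_smul, dualMono,
    dualMono, dualMonomial, dualMonomial, TensorProduct.smul_tmul_smul, smul_smul, smul_smul,
    smul_smul]
  congr 1
  have h2 := gauss_add_mul_qFactorial (q := q) (s - k) k
  rw [Nat.sub_add_cancel hk'] at h2
  have h3 := qFactorial_ne_zero hq hs
  have h4 := qFactorial_ne_zero hq (k := k) (by omega)
  have h5 := qFactorial_ne_zero hq (k := s - k) (by omega)
  field_simp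
  linear_combination q ^ ((t' : ℤ) * k) * h2

theorem counit_dualMono (s : ℕ) (t : ℤ) : Coalgebra.counit (R := ℂ) (dualMono hq s t) =
    if s = 0 ∧ (n : ℤ) ∣ t then 1 else 0 := by
  have h1 := map_idem n q (Bialgebra.counitAlgHom ℂ (ChenAlgebra hq)) (c hq) t
  rw [Bialgebra.counitAlgHom_apply, Bialgebra.counitAlgHom_apply, counit_c] at h1
  have h2 : idem n q (1 : ℂ) t = if (n : ℤ) ∣ t then 1 else 0 := by
    have := sum_zpow_mul hq (-t)
    have h3 : idem n q (1 : ℂ) t = (n : ℂ)⁻¹ * ∑ m ∈ Finset.range n, q ^ ((m : ℤ) * -t) := by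
      rw [idem, Finset.mul_sum]
      refine Finset.sum_congr rfl fun m _ => ?_
      simp [mul_comm]
    rw [h3, this]
    simp only [dvd_neg]
    split_ifs
    · rw [inv_mul_cancel₀ (Nat.cast_ne_zero.2 (NeZero.ne n))]
    · simp
  rw [dualMono, dualMonomial, map_smul, Bialgebra.counit_mul, Bialgebra.counit_pow, counit_d, h1,
    h2, zero_pow_eq]
  by_cases hs : s = 0
  · simp [hs, qFactorial_zero]
  · simp [hs]

theorem antipode_pow (y : ChenAlgebra hq) (k : ℕ) :
    HopfAlgebra.antipode ℂ (y ^ k) = HopfAlgebra.antipode ℂ y ^ k := by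
  induction k with
  | zero => simp
  | succ k ih => rw [pow_succ, HopfAlgebra.antipode_mul_antidistrib, ih, ← pow_succ']

/-- The index changes by the involution t ↦ -t - s, as in `antipode_monomial`, and the two
coefficients are inverse to each other; `antipode_theta` rests on this. -/
theorem antipode_dualMono (s : ℕ) (t : ℤ) : HopfAlgebra.antipode ℂ (dualMono hq s t) =
    ((-1) ^ s * (q ^ s.choose 2 * q ^ (t * s))) • dualMono hq s (-t - s) := by
  have h0 := hq.ne_zero (NeZero.ne n)
  have hcd : c hq ^ (n - 1) * d hq = q • (d hq * c hq ^ (n - 1)) := by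
    rw [qcomm_pow (rels hq).dc, smul_smul, ← pow_succ', Nat.sub_add_cancel NeZero.one_le,
      hq.pow_eq_one, one_smul]
  have h1 : HopfAlgebra.antipode ℂ (idem n q (c hq) t) = idem n q (c hq) (-t) := by
    rw [← idem_inv hq (rels hq).c_pow, idem, idem, map_sum]
    simp only [map_smul, antipode_pow, antipode_c]
  have h2 : (c hq ^ (n - 1)) ^ s * idem n q (c hq) (-t) =
      q ^ (t * s) • idem n q (c hq) (-t) := by
    rw [← pow_mul, pow_mul_idem hq (rels hq).c_pow]
    congr 1
    have e : -t * ((n - 1) * s : ℕ) = t * s + n * (-t * s) := by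
      rw [Nat.cast_mul, Nat.cast_sub NeZero.one_le]; push_cast; ring
    rw [e, zpow_add₀ h0, zpow_mul q n, zpow_natCast, hq.pow_eq_one, one_zpow, mul_one]
  rw [dualMono, dualMonomial, map_smul, HopfAlgebra.antipode_mul_antidistrib, antipode_pow,
    antipode_d, h1, neg_pow, mul_pow_of_smul_comm hcd, mul_smul_comm, smul_mul_assoc, mul_assoc,
    mul_assoc, h2, mul_smul_comm, mul_smul_comm, (rels hq).d_pow_mul_idem hq,
    ← neg_one_smul ℂ (1 : ChenAlgebra hq), smul_pow, one_pow, smul_mul_assoc, one_mul, dualMono,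
    dualMonomial]
  simp only [smul_smul]
  congr 1
  ring

end ChenAlgebra

/-! ### The map θ from the dual of the Taft algebra to H_n(1,q) -/

section Theta

open TaftAlgebra ChenAlgebra

variable {n : ℕ} {q : ℂ} (hq : IsPrimitiveRoot q n)

/-- The embedding `x ↦ a`, `g ↦ b` of `H_n(q)` into `H_n(1,q)`. -/
noncomputable def iota : TaftAlgebra hq →ₐ[ℂ] ChenAlgebra hq :=
  TaftAlgebra.lift hq ⟨(ChenAlgebra.rels hq).b_pow, (ChenAlgebra.rels hq).a_pow,
    (ChenAlgebra.rels hq).ba⟩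

@[simp] theorem iota_g : iota hq (g hq) = b hq := lift_g hq _

@[simp] theorem iota_x : iota hq (x hq) = a hq := lift_x hq _

variable [NeZero n]

/-- The embedding `f ↦ ∑ f(x ^ s g ^ t) (s)!⁻¹ E_t d ^ s` of `H_n(q)*` into `H_n(1,q)`. -/
noncomputable def theta : Dual ℂ (TaftAlgebra hq) →ₗ[ℂ] ChenAlgebra hq :=
  ∑ s ∈ Finset.range n, ∑ t ∈ Finset.range n,
    (LinearMap.applyₗ (monomial hq s t)).smulRight (dualMono hq s t)

theorem theta_apply (f : Dual ℂ (TaftAlgebra hq)) : theta hq f =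
    ∑ s ∈ Finset.range n, ∑ t ∈ Finset.range n,
      f (monomial hq s t) • dualMono hq s t := by
  simp [theta]

/-- Both sides become the same sum over degrees i, j and one exponent t: on the left by
`comul_monomial`, on the right by `dualMono_mul`, whose divisibility condition removes the second
exponent. -/
theorem theta_dualMul (f f' : Dual ℂ (TaftAlgebra hq)) :
    theta hq (Double.dualMul _ (f ⊗ₜ f')) = theta hq f * theta hq f' := by
  have h1 : ∀ s t : ℕ, Double.dualMul _ (f ⊗ₜ f') (monomial hq s t) =
      ∑ k ∈ Finset.range (s + 1), gauss q s k *
        (f (monomial hq (s - k) t) * f' (monomial hq k ((s - k : ℕ) + t))) := by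
    intro s t
    change TensorProduct.dualDistrib ℂ _ _ (f ⊗ₜ f') (Coalgebra.comul (monomial hq s t)) = _
    rw [comul_monomial, map_sum]
    simp [TensorProduct.dualDistrib_apply]
  let φ : ℕ → ℕ → ChenAlgebra hq := fun i j => ∑ t ∈ Finset.range n,
    (gauss q (i + j) j * (f (monomial hq i t) * f' (monomial hq j (i + t)))) •
      dualMono hq (i + j) t
  have hφ : ∀ i j, n ≤ i + j → φ i j = 0 := by
    intro i j hij
    simp only [φ, dualMono, dualMonomial]
    rw [(ChenAlgebra.rels hq).d_pow_eq_zero hij]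
    simp
  have h2 : theta hq (Double.dualMul _ (f ⊗ₜ f')) =
      ∑ s ∈ Finset.range n, ∑ k ∈ Finset.range (s + 1), φ (s - k) k := by
    rw [theta_apply]
    refine Finset.sum_congr rfl fun s _ => ?_
    simp only [h1, Finset.sum_smul]
    rw [Finset.sum_comm]
    refine Finset.sum_congr rfl fun k hk => Finset.sum_congr rfl fun t _ => ?_
    have hk' : k ≤ s := Nat.lt_succ_iff.1 (Finset.mem_range.1 hk)
    rw [Nat.sub_add_cancel hk']
  rw [h2, sum_range_triangle' n φ hφ, theta_apply, theta_apply, Finset.sum_mul]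
  refine Finset.sum_congr rfl fun i hi => ?_
  rw [Finset.sum_mul]
  simp only [Finset.mul_sum]
  conv_rhs => rw [Finset.sum_comm]
  refine Finset.sum_congr rfl fun j hj => ?_
  refine Finset.sum_congr rfl fun t _ => ?_
  simp only [smul_mul_smul_comm,
    dualMono_mul hq (Finset.mem_range.1 hi) (Finset.mem_range.1 hj)]
  have h3 := sum_range_ite_dvd (n := n) (φ := fun t' : ℤ =>
    (f (monomial hq i t) * f' (monomial hq j t')) • gauss q (i + j) j • dualMono hq (i + j) t)
    (fun t' => by rw [monomial_add_order]) (i + t)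
  simp only [smul_ite, smul_zero]
  rw [h3, smul_smul, mul_comm]

theorem theta_counit : theta hq (Coalgebra.counit (R := ℂ) (A := TaftAlgebra hq)) = 1 := by
  rw [theta_apply, Finset.sum_eq_single 0]
  · simp only [counit_monomial, if_true, one_smul, dualMono, dualMonomial, qFactorial_zero, inv_one,
      pow_zero, mul_one]
    exact sum_idem hq (c hq)
  · intro s _ hs
    simp [counit_monomial, hs]
  · intro h; exact absurd (Finset.mem_range.2 (NeZero.pos n)) h

theorem counit_theta (f : Dual ℂ (TaftAlgebra hq)) :
    Coalgebra.counit (R := ℂ) (theta hq f) = f 1 := by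
  rw [theta_apply, map_sum, Finset.sum_eq_single 0, map_sum, Finset.sum_eq_single 0]
  · simp [counit_dualMono, monomial]
  · intro t ht h0
    have hd : ¬ (n : ℤ) ∣ t := fun h =>
      h0 (Nat.eq_zero_of_dvd_of_lt (Int.natCast_dvd_natCast.1 h) (Finset.mem_range.1 ht))
    simp [counit_dualMono, hd]
  · intro h; exact absurd (Finset.mem_range.2 (NeZero.pos n)) h
  · intro s _ hs
    simp [counit_dualMono, hs]
  · intro h; exact absurd (Finset.mem_range.2 (NeZero.pos n)) h

/-- Coordinates are expressed through `TensorProduct.dualDistrib` because `Double.dualComul` is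
known only through it: applied to the dual coproduct of f it is f composed with the product. -/
theorem map_theta_comm (w : Dual ℂ (TaftAlgebra hq) ⊗[ℂ] Dual ℂ (TaftAlgebra hq)) :
    TensorProduct.map (theta hq) (theta hq) (TensorProduct.comm ℂ _ _ w) =
      ∑ s ∈ Finset.range n, ∑ t ∈ Finset.range n, ∑ s' ∈ Finset.range n, ∑ t' ∈ Finset.range n,
        TensorProduct.dualDistrib ℂ _ _ w (monomial hq s' t' ⊗ₜ monomial hq s t) •
          (dualMono hq s t ⊗ₜ[ℂ] dualMono hq s' t') := by
  induction w with
  | zero => simp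
  | add v w hv hw => simp only [map_add, hv, hw, LinearMap.add_apply, add_smul,
      Finset.sum_add_distrib]
  | tmul f f' =>
    rw [TensorProduct.comm_tmul, TensorProduct.map_tmul, theta_apply, theta_apply]
    simp only [TensorProduct.sum_tmul]
    simp only [TensorProduct.tmul_sum, TensorProduct.smul_tmul_smul,
      TensorProduct.dualDistrib_apply]
    refine Finset.sum_congr rfl fun s _ => Finset.sum_congr rfl fun t _ =>
      Finset.sum_congr rfl fun s' _ => Finset.sum_congr rfl fun t' _ => ?_
    rw [mul_comm]

/-- This is the transpose of `monomial_mul` compared with `comul_dualMono`. The flip appears because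
the double contains H* with the opposite coproduct. -/
theorem comul_theta (f : Dual ℂ (TaftAlgebra hq)) :
    Coalgebra.comul (R := ℂ) (theta hq f) = TensorProduct.map (theta hq) (theta hq)
      (TensorProduct.comm ℂ _ _ (Double.dualComul _ f)) := by
  have hw : TensorProduct.dualDistrib ℂ _ _ (Double.dualComul _ f) =
      f ∘ₗ LinearMap.mul' ℂ (TaftAlgebra hq) :=
    (TensorProduct.dualDistribEquiv ℂ (TaftAlgebra hq) (TaftAlgebra hq)).apply_symm_apply _
  rw [map_theta_comm, hw]
  simp only [LinearMap.comp_apply, LinearMap.mul'_apply, monomial_mul, map_smul]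
  let φ : ℕ → ℕ → ChenAlgebra hq ⊗[ℂ] ChenAlgebra hq := fun i j =>
    ∑ t ∈ Finset.range n, ∑ t' ∈ Finset.range n,
      (q ^ ((t' : ℤ) * i) • f (monomial hq (j + i) (t' + t))) •
        (dualMono hq i t ⊗ₜ[ℂ] dualMono hq j t')
  have hφ : ∀ i j, n ≤ i + j → φ i j = 0 := by
    intro i j hij
    simp [φ, monomial_eq_zero hq (show n ≤ j + i by omega)]
  trans ∑ i ∈ Finset.range n, ∑ j ∈ Finset.range n, φ i j
  · rw [← sum_range_triangle n φ hφ, theta_apply, map_sum]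
    refine Finset.sum_congr rfl fun s hs => ?_
    simp only [map_sum, map_smul, comul_dualMono hq (Finset.mem_range.1 hs), Finset.smul_sum]
    rw [Finset.sum_comm]
    refine Finset.sum_congr rfl fun k hk => ?_
    have hk' : k ≤ s := Nat.lt_succ_iff.1 (Finset.mem_range.1 hk)
    simp only [φ]
    rw [Finset.sum_comm, Finset.sum_comm (s := Finset.range n)
      (f := fun t t' : ℕ => (q ^ ((t' : ℤ) * k) • f (monomial hq (s - k + k) (t' + t))) •
        (dualMono hq k t ⊗ₜ[ℂ] dualMono hq (s - k) t'))]
    refine Finset.sum_congr rfl fun t' _ => ?_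
    -- Shifting t by t' turns the index t - t' of the coproduct formula into t.
    rw [Nat.sub_add_cancel hk', ← sum_range_add_int (n := n) (φ := fun t : ℤ =>
      f (monomial hq s t) • q ^ ((t' : ℤ) * k) •
        (dualMono hq k (t - t') ⊗ₜ[ℂ] dualMono hq (s - k) t')) _ (t' : ℤ)]
    · refine Finset.sum_congr rfl fun t _ => ?_
      rw [add_sub_cancel_right, smul_smul, smul_eq_mul, mul_comm, add_comm]
    · intro t
      rw [monomial_add_order, show t + n - (t' : ℤ) = t - t' + n by ring,
        dualMono_add_order hq]
  · refine Finset.sum_congr rfl fun s _ => ?_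
    rw [Finset.sum_comm]

/-- The sum over t is reindexed by the involution t ↦ -t - s, after which the coefficients cancel.
Stating this with f ∘ S avoids a formula for S⁻¹ on monomials; the statement for f ∘ S⁻¹ follows by
substitution. -/
theorem antipode_theta (f : Dual ℂ (TaftAlgebra hq)) :
    HopfAlgebra.antipode ℂ (theta hq (f ∘ₗ HopfAlgebra.antipode ℂ)) = theta hq f := by
  have h0 := hq.ne_zero (NeZero.ne n)
  rw [theta_apply, theta_apply, map_sum]
  refine Finset.sum_congr rfl fun s _ => ?_
  rw [map_sum, ← sum_range_sub_int (φ := fun t : ℤ => f (monomial hq s t) • dualMono hq s t)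
    (fun t => by rw [monomial_add_order, dualMono_add_order hq]) (-s)]
  refine Finset.sum_congr rfl fun t _ => ?_
  rw [map_smul, antipode_dualMono, LinearMap.comp_apply, antipode_monomial, map_smul, smul_eq_mul,
    smul_smul, show -(t : ℤ) - s = -s - t by ring]
  congr 1
  have h1 : ((-1 : ℂ) ^ s) * (-1) ^ s = 1 := by rw [← mul_pow]; simp
  have h2 : q⁻¹ ^ s.choose 2 * q ^ s.choose 2 = 1 := by
    rw [← mul_pow, inv_mul_cancel₀ h0, one_pow]
  have h3 : q ^ (-((t : ℤ) * s)) * q ^ ((t : ℤ) * s) = 1 := by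
    rw [← zpow_add₀ h0]; simp
  linear_combination (f (monomial hq s (-s - t)) * (q⁻¹ ^ s.choose 2 * q ^ s.choose 2) *
    (q ^ (-((t : ℤ) * s)) * q ^ ((t : ℤ) * s))) * h1 +
    f (monomial hq s (-s - t)) * (q ^ (-((t : ℤ) * s)) * q ^ ((t : ℤ) * s)) * h2 +
    f (monomial hq s (-s - t)) * h3

end Theta

/-! ### When f ⋈ h ↦ θ(f) ι(h) respects the structure of a double -/

namespace Double

variable {H : Type*} [Ring H] [HopfAlgebra ℂ H]
  (hS : Function.Bijective (HopfAlgebra.antipode ℂ (A := H)))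

theorem antipode_antipodeInv (y : H) : HopfAlgebra.antipode ℂ (antipodeInv hS y) = y :=
  (LinearEquiv.ofBijective _ hS).apply_symm_apply y

theorem antipodeInv_antipode (y : H) : antipodeInv hS (HopfAlgebra.antipode ℂ y) = y :=
  (LinearEquiv.ofBijective _ hS).symm_apply_apply y

theorem antipodeInv_eq {y z : H} (h : HopfAlgebra.antipode ℂ z = y) : antipodeInv hS y = z := by
  rw [← h, antipodeInv_antipode]

theorem antipodeInv_mul (y z : H) :
    antipodeInv hS (y * z) = antipodeInv hS z * antipodeInv hS y :=
  antipodeInv_eq hS (by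
    rw [HopfAlgebra.antipode_mul_antidistrib, antipode_antipodeInv, antipode_antipodeInv])

theorem antipodeInv_one : antipodeInv hS (1 : H) = 1 :=
  antipodeInv_eq hS (by simp)

theorem twist_eq (h : H) (f : Dual ℂ H) : twist hS h f =
    straighten hS ((Coalgebra.comul (R := ℂ) (A := H)).lTensor H (Coalgebra.comul h)) f := rfl

variable {K : Type*} [Ring K] [Algebra ℂ K] (θ : Dual ℂ H →ₗ[ℂ] K) (ι : H →ₐ[ℂ] K)

/-- The linear map `f ⋈ h ↦ θ(f) ι(h)` on the double. -/
noncomputable def mulMap : Double H →ₗ[ℂ] K :=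
  LinearMap.mul' ℂ K ∘ₗ TensorProduct.map θ ι.toLinearMap

@[simp] theorem mulMap_tmul (f : Dual ℂ H) (h : H) : mulMap θ ι (f ⊗ₜ h) = θ f * ι h := rfl

/-- The operators f ↦ f(S⁻¹(z) ? x) compose as an action, because S⁻¹ reverses products; so the
outer legs of the right factor can be applied to f first, and its middle leg splits off. -/
theorem mulMap_straighten_mul (u : H ⊗[ℂ] (H ⊗[ℂ] H)) (x y z : H) (f : Dual ℂ H) :
    mulMap θ ι (straighten hS (u * (x ⊗ₜ (y ⊗ₜ z))) f) =
      mulMap θ ι (straighten hS u (coadj hS x z f)) * ι y := by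
  induction u with
  | zero => simp
  | add u v hu hv => simp only [add_mul, map_add, LinearMap.add_apply, hu, hv]
  | tmul x₀ w =>
    induction w with
    | zero => simp
    | add u v hu hv => simp only [TensorProduct.tmul_add, add_mul, map_add, LinearMap.add_apply,
        hu, hv]
    | tmul y₀ z₀ =>
      have hc : coadj hS (x₀ * x) (z₀ * z) f = coadj hS x₀ z₀ (coadj hS x z f) := by
        ext y
        simp only [coadj_apply, antipodeInv_mul, mul_assoc]
      rw [Algebra.TensorProduct.tmul_mul_tmul, Algebra.TensorProduct.tmul_mul_tmul,
        straighten_tmul, straighten_tmul, mulMap_tmul, mulMap_tmul, map_mul ι, mul_assoc, hc]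

/-- The rule for h is applied to the functional already twisted by the outer legs of h', then the
rule for h'. This makes the elements satisfying the rule closed under products. -/
theorem mulMap_twist_mul {h h' : H}
    (hh : ∀ f, mulMap θ ι (twist hS h f) = ι h * θ f)
    (hh' : ∀ f, mulMap θ ι (twist hS h' f) = ι h' * θ f) (f : Dual ℂ H) :
    mulMap θ ι (twist hS (h * h') f) = ι (h * h') * θ f := by
  have hmul : ∀ u v : H ⊗[ℂ] H, (Coalgebra.comul (R := ℂ) (A := H)).lTensor H (u * v) =
      (Coalgebra.comul (R := ℂ) (A := H)).lTensor H u *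
        (Coalgebra.comul (R := ℂ) (A := H)).lTensor H v := fun u v =>
    map_mul (Algebra.TensorProduct.map (AlgHom.id ℂ H) (Bialgebra.comulAlgHom ℂ H)) u v
  have key : ∀ v : H ⊗[ℂ] (H ⊗[ℂ] H),
      mulMap θ ι (straighten hS ((Coalgebra.comul (R := ℂ) (A := H)).lTensor H
        (Coalgebra.comul h) * v) f) = ι h * mulMap θ ι (straighten hS v f) := by
    intro v
    induction v with
    | zero => simp
    | add u v hu hv => simp only [mul_add, map_add, LinearMap.add_apply, hu, hv]
    | tmul x w =>
      induction w with
      | zero => simp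
      | add u v hu hv => simp only [TensorProduct.tmul_add, mul_add, map_add,
          LinearMap.add_apply, hu, hv]
      | tmul y z =>
        rw [mulMap_straighten_mul, ← twist_eq, hh, straighten_tmul, mulMap_tmul, mul_assoc]
  rw [twist_eq, Bialgebra.comul_mul, hmul, key, ← twist_eq, hh', map_mul, mul_assoc]

/-- The straightening rule needs only be checked on generators. -/
theorem mulMap_twist {s : Set H} (hs : Algebra.adjoin ℂ s = ⊤)
    (h : ∀ y ∈ s, ∀ f, mulMap θ ι (twist hS y f) = ι y * θ f) (y : H) :
    ∀ f, mulMap θ ι (twist hS y f) = ι y * θ f := by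
  have hy : y ∈ Algebra.adjoin ℂ s := hs ▸ Algebra.mem_top
  induction hy using Algebra.adjoin_induction with
  | mem y hy => exact h y hy
  | algebraMap r =>
    intro f
    have hc : coadj hS 1 1 f = f := by ext y; simp [coadj_apply, antipodeInv_one]
    have h1 : twist hS (1 : H) f = f ⊗ₜ 1 := by
      rw [twist_eq, Bialgebra.comul_one, Algebra.TensorProduct.one_def, LinearMap.lTensor_tmul,
        Bialgebra.comul_one, Algebra.TensorProduct.one_def, straighten_tmul, hc]
    rw [Algebra.algebraMap_eq_smul_one, map_smul, LinearMap.smul_apply, h1, map_smul]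
    simp
  | add y z _ _ hy hz =>
    intro f
    rw [map_add, LinearMap.add_apply, map_add, hy, hz, map_add, add_mul]
  | mul y z _ _ hy hz => exact mulMap_twist_mul hS θ ι hy hz

theorem mulMap_mul (hθ : ∀ f f', θ (dualMul H (f ⊗ₜ f')) = θ f * θ f')
    (h : ∀ y f, mulMap θ ι (twist hS y f) = ι y * θ f) (u v : Double H) :
    mulMap θ ι (mul hS u v) = mulMap θ ι u * mulMap θ ι v := by
  induction u using TensorProduct.induction_on with
  | zero => simp
  | add u u' hu hu' => simp only [map_add, LinearMap.add_apply, add_mul, hu, hu']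
  | tmul f y =>
    induction v using TensorProduct.induction_on with
    | zero => simp
    | add v v' hv hv' => simp only [map_add, mul_add, hv, hv']
    | tmul f' y' =>
      have key : ∀ w : Double H, mulMap θ ι (TensorProduct.map
          (dualMul H ∘ₗ TensorProduct.mk ℂ (Dual ℂ H) (Dual ℂ H) f)
          (LinearMap.mulRight ℂ y') w) = θ f * mulMap θ ι w * ι y' := by
        intro w
        induction w using TensorProduct.induction_on with
        | zero => simp
        | add v v' hv hv' => simp only [map_add, mul_add, add_mul, hv, hv']
        | tmul f'' y'' =>
          rw [TensorProduct.map_tmul, mulMap_tmul, mulMap_tmul, LinearMap.comp_apply,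
            TensorProduct.mk_apply, hθ, LinearMap.mulRight_apply, map_mul]
          simp only [mul_assoc]
      rw [mul_tmul, key, h, mulMap_tmul, mulMap_tmul]
      simp only [mul_assoc]

/-- The middle exchange of the coproduct of the double matches the componentwise product in K ⊗ K.
-/
theorem map_mulMap_comm (W : Dual ℂ H ⊗[ℂ] Dual ℂ H) (Z : H ⊗[ℂ] H) :
    TensorProduct.map (mulMap θ ι) (mulMap θ ι)
      (TensorProduct.tensorTensorTensorComm ℂ (Dual ℂ H) (Dual ℂ H) H H (W ⊗ₜ Z)) =
      TensorProduct.map θ θ W * TensorProduct.map ι.toLinearMap ι.toLinearMap Z := by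
  induction W with
  | zero => simp
  | add v v' hv hv' => simp only [TensorProduct.add_tmul, map_add, add_mul, hv, hv']
  | tmul f f' =>
    induction Z with
    | zero => simp
    | add v v' hv hv' => simp only [TensorProduct.tmul_add, map_add, mul_add, hv, hv']
    | tmul y y' => simp

end Double

/-! ### The map from the double to H_n(1,q) as a morphism of Hopf algebras -/

section Iso

variable {n : ℕ} [NeZero n] {q : ℂ} (hq : IsPrimitiveRoot q n)

open TaftAlgebra ChenAlgebra

theorem comul_iota (y : TaftAlgebra hq) : Coalgebra.comul (R := ℂ) (iota hq y) =
    TensorProduct.map (iota hq).toLinearMap (iota hq).toLinearMap (Coalgebra.comul y) := by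
  have : (Bialgebra.comulAlgHom ℂ (ChenAlgebra hq)).comp (iota hq) =
      (Algebra.TensorProduct.map (iota hq) (iota hq)).comp
        (Bialgebra.comulAlgHom ℂ (TaftAlgebra hq)) :=
    TaftAlgebra.hom_ext (by simp) (by simp)
  exact DFunLike.congr_fun this y

theorem counit_iota (y : TaftAlgebra hq) : Coalgebra.counit (R := ℂ) (iota hq y) =
    Coalgebra.counit (R := ℂ) y := by
  have : (Bialgebra.counitAlgHom ℂ (ChenAlgebra hq)).comp (iota hq) =
      Bialgebra.counitAlgHom ℂ (TaftAlgebra hq) :=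
    TaftAlgebra.hom_ext (by simp) (by simp)
  exact DFunLike.congr_fun this y

theorem antipode_iota (y : TaftAlgebra hq) : HopfAlgebra.antipode ℂ (iota hq y) =
    iota hq (HopfAlgebra.antipode ℂ y) := by
  have hy : y ∈ Algebra.adjoin ℂ {g hq, x hq} := TaftAlgebra.adjoin_eq_top hq ▸ Algebra.mem_top
  induction hy using Algebra.adjoin_induction with
  | mem y hy =>
    rcases hy with rfl | rfl
    · simp [TaftAlgebra.antipode_g, ChenAlgebra.antipode_b]
    · simp [TaftAlgebra.antipode_x, ChenAlgebra.antipode_a]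
  | algebraMap r => simp [Algebra.algebraMap_eq_smul_one]
  | add y z _ _ hy hz => simp only [map_add, hy, hz]
  | mul y z _ _ hy hz =>
    rw [map_mul, HopfAlgebra.antipode_mul_antidistrib, HopfAlgebra.antipode_mul_antidistrib, hy, hz,
      map_mul]

theorem antipodeInv_g : Double.antipodeInv (antipode_bijective hq) (g hq) = monomial hq 0 (-1) := by
  have h1 : monomial hq 0 (-1) = g hq ^ (n - 1) := by
    simp [monomial, gUnit]
  refine Double.antipodeInv_eq _ ?_
  have := antipode_monomial hq 0 (n - 1)
  rw [h1, ← one_mul (g hq ^ (n - 1)), ← pow_zero (x hq), ← monomial_natCast, this]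
  have h2 := monomial_add_order hq 0 (-((n - 1 : ℕ) : ℤ))
  rw [Nat.cast_sub NeZero.one_le] at *
  simp only [Nat.cast_zero, sub_zero] at *
  rw [← h2]
  have := monomial_natCast hq 0 1
  simp at this ⊢
  exact this

theorem antipodeInv_x : Double.antipodeInv (antipode_bijective hq) (x hq) =
    -(monomial hq 0 (-1) * x hq) := by
  have h1 := Double.antipode_antipodeInv (antipode_bijective hq) (g hq)
  rw [antipodeInv_g] at h1
  refine Double.antipodeInv_eq _ ?_
  rw [map_neg, HopfAlgebra.antipode_mul_antidistrib, h1, TaftAlgebra.antipode_x, neg_mul, neg_neg,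
    mul_assoc, inv_mul_g, mul_one]

end Iso

/-- Multiplying a degree s + 1 term by a gives terms of degrees s + 1 and s. This regroups them by
resulting degree, nothing being lost at the top since X vanishes there. -/
theorem sum_range_eq_add_of_shift {M : Type*} [AddCommMonoid M] {n : ℕ} [NeZero n]
    {A X Y : ℕ → M} (hX : ∀ s, n ≤ s + 1 → X s = 0) (h0 : A 0 = Y 0)
    (h : ∀ s, s + 1 < n → A (s + 1) = X s + Y (s + 1)) :
    ∑ s ∈ Finset.range n, A s = ∑ s ∈ Finset.range n, X s + ∑ s ∈ Finset.range n, Y s := by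
  obtain ⟨N, rfl⟩ := Nat.exists_eq_succ_of_ne_zero (NeZero.ne n)
  rw [Finset.sum_range_succ' A, Finset.sum_range_succ X, Finset.sum_range_succ' Y, hX N le_rfl, h0,
    add_zero, ← add_assoc, ← Finset.sum_add_distrib]
  congr 1
  exact Finset.sum_congr rfl fun s hs => h s (Nat.succ_lt_succ (Finset.mem_range.1 hs))

section Iso

variable {n : ℕ} [NeZero n] {q : ℂ} (hq : IsPrimitiveRoot q n)

open TaftAlgebra ChenAlgebra

theorem monomial_zero_one : monomial hq 0 1 = g hq := by
  simpa using monomial_natCast hq 0 1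

theorem monomial_one_zero : monomial hq 1 0 = x hq := by
  simpa using monomial_natCast hq 1 0

/-- The image of the double of the Taft algebra. -/
noncomputable abbrev toChen : Double (TaftAlgebra hq) →ₗ[ℂ] ChenAlgebra hq :=
  Double.mulMap (theta hq) (iota hq)

theorem toChen_twist_g (f : Dual ℂ (TaftAlgebra hq)) :
    toChen hq (Double.twist (antipode_bijective hq) (g hq) f) = iota hq (g hq) * theta hq f := by
  have h0 := hq.ne_zero (NeZero.ne n)
  have hc : ∀ s t : ℕ, Double.coadj (antipode_bijective hq) (g hq) (g hq) f (monomial hq s t) =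
      q ^ (-(s : ℤ)) * f (monomial hq s t) := by
    intro s t
    rw [Double.coadj_apply, antipodeInv_g, ← monomial_zero_one, monomial_mul, mul_smul_comm,
      monomial_mul, map_smul, map_smul, smul_eq_mul, smul_eq_mul]
    simp
  rw [Double.twist_eq, comul_g, LinearMap.lTensor_tmul, comul_g, Double.straighten_tmul,
    Double.mulMap_tmul, iota_g, theta_apply, theta_apply, Finset.sum_mul, Finset.mul_sum]
  refine Finset.sum_congr rfl fun s _ => ?_
  rw [Finset.sum_mul, Finset.mul_sum]
  refine Finset.sum_congr rfl fun t _ => ?_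
  rw [hc, mul_smul_comm, b_mul_dualMonomial hq (ChenAlgebra.rels hq), smul_smul, smul_mul_assoc,
    mul_comm (f _)]

/-- The iterated coproduct of x is x ⊗ g ⊗ g + 1 ⊗ x ⊗ g + 1 ⊗ 1 ⊗ x. The resulting three twisted
functionals are evaluated on monomials in `hc1`, `hc2`, `hc3` and match the three terms of
`a_mul_dualMonomial_succ`. -/
theorem toChen_twist_x (f : Dual ℂ (TaftAlgebra hq)) :
    toChen hq (Double.twist (antipode_bijective hq) (x hq) f) = iota hq (x hq) * theta hq f := by
  have h0 := hq.ne_zero (NeZero.ne n)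
  have hc1 : ∀ s t : ℕ, Double.coadj (antipode_bijective hq) (x hq) (g hq) f (monomial hq s t) =
      q ^ ((t : ℤ) - s - 1) * f (monomial hq (s + 1) (t - 1)) := by
    intro s t
    rw [Double.coadj_apply, antipodeInv_g, ← monomial_one_zero, monomial_mul, mul_smul_comm,
      monomial_mul, map_smul, map_smul, smul_eq_mul, smul_eq_mul, ← mul_assoc, ← zpow_add₀ h0]
    congr 2
    · push_cast; ring
    · congr 1
      ring
  have hc2 : ∀ s t : ℕ, Double.coadj (antipode_bijective hq) 1 (g hq) f (monomial hq s t) =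
      q ^ (-(s : ℤ)) * f (monomial hq s (t - 1)) := by
    intro s t
    rw [Double.coadj_apply, antipodeInv_g, mul_one, monomial_mul, map_smul, smul_eq_mul]
    congr 2
    · ring
    · congr 1
      ring
  have hc3 : ∀ s t : ℕ, Double.coadj (antipode_bijective hq) 1 (x hq) f (monomial hq s t) =
      -(q ^ (-(s + 1 : ℤ)) * f (monomial hq (s + 1) (t - 1))) := by
    intro s t
    rw [Double.coadj_apply, antipodeInv_x, mul_one, ← monomial_one_zero, monomial_mul, neg_mul,
      smul_mul_assoc, monomial_mul, map_neg, map_smul, map_smul, smul_eq_mul, smul_eq_mul,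
      ← mul_assoc, ← zpow_add₀ h0]
    congr 3
    · push_cast; ring
    · congr 1
      ring
  have hx : toChen hq (Double.twist (antipode_bijective hq) (x hq) f) =
      theta hq (Double.coadj (antipode_bijective hq) (x hq) (g hq) f) * b hq +
      (theta hq (Double.coadj (antipode_bijective hq) 1 (g hq) f) * a hq +
        theta hq (Double.coadj (antipode_bijective hq) 1 (x hq) f)) := by
    rw [Double.twist_eq, comul_x, map_add, LinearMap.lTensor_tmul, LinearMap.lTensor_tmul, comul_g,
      comul_x, TensorProduct.tmul_add, map_add, map_add, LinearMap.add_apply, LinearMap.add_apply,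
      Double.straighten_tmul, Double.straighten_tmul, Double.straighten_tmul, map_add, map_add,
      Double.mulMap_tmul, Double.mulMap_tmul, Double.mulMap_tmul, iota_g, iota_x, map_one (iota hq), mul_one]
  rw [hx, iota_x, theta_apply, theta_apply, theta_apply, theta_apply]
  simp only [hc1, hc2, hc3]
  rw [Finset.sum_mul, Finset.sum_mul, Finset.mul_sum]
  -- `X` collects the two terms of lowered degree, which read f in degree s + 1, and `Y` the term
  -- that keeps the degree.
  rw [sum_range_eq_add_of_shift (n := n)
    (A := fun s => a hq * ∑ t ∈ Finset.range n, f (monomial hq s t) • dualMono hq s t)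
    (X := fun s => (∑ t ∈ Finset.range n, (q ^ ((t : ℤ) - s - 1) * f (monomial hq (s + 1) (t - 1))) •
      dualMono hq s t) * b hq + ∑ t ∈ Finset.range n,
        (-(q ^ (-(s + 1 : ℤ)) * f (monomial hq (s + 1) (t - 1)))) • dualMono hq s t)
    (Y := fun s => (∑ t ∈ Finset.range n, (q ^ (-(s : ℤ)) * f (monomial hq s (t - 1))) •
      dualMono hq s t) * a hq), Finset.sum_add_distrib]
  · abel
  · intro s hs
    simp [monomial_eq_zero hq hs]
  · simp only [Finset.sum_mul, Finset.mul_sum, mul_smul_comm, smul_mul_assoc,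
      a_mul_dualMonomial_zero hq (ChenAlgebra.rels hq)]
    rw [← sum_range_add_int (φ := fun t : ℤ => f (monomial hq 0 t) •
      (dualMonomial n q (c hq) (d hq) 0 (t + 1) * a hq)) _ (-1)]
    · simp [sub_eq_add_neg]
    · intro t
      rw [monomial_add_order, add_right_comm, dualMonomial_add_order hq]
  · intro s hs
    simp only [Finset.sum_mul, Finset.mul_sum, mul_smul_comm, smul_mul_assoc,
      a_mul_dualMonomial_succ hq (ChenAlgebra.rels hq) hs]
    -- Passing a through E_t raises t by one; replacing t by t - 1 restores the index t and puts f
    -- at g^{t-1}.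
    rw [← sum_range_add_int (φ := fun t : ℤ => f (monomial hq (s + 1) t) •
      (q ^ (-(s + 1 : ℤ)) • (dualMonomial n q (c hq) (d hq) (s + 1) (t + 1) * a hq) +
      q ^ (t - s) • (dualMonomial n q (c hq) (d hq) s (t + 1) * b hq) -
      q ^ (-(s + 1 : ℤ)) • dualMonomial n q (c hq) (d hq) s (t + 1))) _ (-1),
      ← Finset.sum_add_distrib, ← Finset.sum_add_distrib]
    · refine Finset.sum_congr rfl fun t _ => ?_
      rw [neg_add_cancel_right, ← sub_eq_add_neg, sub_right_comm]
      push_cast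
      module
    · intro t
      rw [monomial_add_order, add_right_comm, dualMonomial_add_order hq,
        dualMonomial_add_order hq, add_sub_right_comm t, zpow_add_order hq]

theorem toChen_twist (y : TaftAlgebra hq) (f : Dual ℂ (TaftAlgebra hq)) :
    toChen hq (Double.twist (antipode_bijective hq) y f) = iota hq y * theta hq f := by
  refine Double.mulMap_twist _ _ _ (TaftAlgebra.adjoin_eq_top hq) ?_ y f
  rintro y (rfl | rfl) f
  · exact toChen_twist_g hq f
  · exact toChen_twist_x hq f

theorem toChen_mul (u v : Double (TaftAlgebra hq)) :
    toChen hq (Double.mul (antipode_bijective hq) u v) = toChen hq u * toChen hq v :=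
  Double.mulMap_mul _ _ _ (theta_dualMul hq) (toChen_twist hq) u v

theorem toChen_one : toChen hq (Double.one _) = 1 := by
  rw [Double.one, Double.mulMap_tmul, theta_counit, map_one, mul_one]

theorem comul_toChen (u : Double (TaftAlgebra hq)) : Coalgebra.comul (R := ℂ) (toChen hq u) =
    TensorProduct.map (toChen hq) (toChen hq) (Double.comul _ u) := by
  induction u using TensorProduct.induction_on with
  | zero => simp
  | add u v hu hv => simp only [map_add, hu, hv]
  | tmul f y =>
    rw [Double.mulMap_tmul, Bialgebra.comul_mul, comul_theta, comul_iota]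
    exact (Double.map_mulMap_comm _ _ _ _).symm

theorem counit_toChen (u : Double (TaftAlgebra hq)) : Coalgebra.counit (R := ℂ) (toChen hq u) =
    Double.counit _ u := by
  induction u using TensorProduct.induction_on with
  | zero => simp
  | add u v hu hv => simp only [map_add, hu, hv]
  | tmul f y =>
    rw [Double.mulMap_tmul, Bialgebra.counit_mul, counit_theta, counit_iota]
    rfl

theorem antipode_toChen (u : Double (TaftAlgebra hq)) : HopfAlgebra.antipode ℂ (toChen hq u) =
    toChen hq (Double.antipode (antipode_bijective hq) u) := by
  induction u using TensorProduct.induction_on with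
  | zero => simp
  | add u v hu hv => simp only [map_add, hu, hv]
  | tmul f y =>
    -- With this, `antipode_theta` for f ∘ S⁻¹ computes the antipode of θ(f), and the remaining
    -- product is a case of the straightening rule.
    have h1 : (f ∘ₗ Double.antipodeInv (antipode_bijective hq)) ∘ₗ HopfAlgebra.antipode ℂ = f := by
      ext z
      simp [Double.antipodeInv_antipode]
    change _ = toChen hq (Double.twist (antipode_bijective hq) (HopfAlgebra.antipode ℂ y)
      (f ∘ₗ Double.antipodeInv (antipode_bijective hq)))
    rw [toChen_twist, Double.mulMap_tmul,
      HopfAlgebra.antipode_mul_antidistrib, antipode_iota,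
      ← antipode_theta hq (f ∘ₗ _), h1]

end Iso

/-! ### Modules induced from characters of the group generated by b and c -/

section Induced

variable {n : ℕ} {q : ℂ}

/-- The basis vector `d ^ s a ^ i v` of the module induced from a character of `⟨b, c⟩`. -/
noncomputable def indVec (n s i : ℕ) : Fin n × Fin n →₀ ℂ :=
  if h : s < n ∧ i < n then Finsupp.single (⟨s, h.1⟩, ⟨i, h.2⟩) 1 else 0

theorem indVec_eq_zero_left {s : ℕ} (h : n ≤ s) (i : ℕ) : indVec n s i = 0 :=
  dif_neg fun h' => absurd h'.1 (not_lt.2 h)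

theorem indVec_eq_zero_right {i : ℕ} (h : n ≤ i) (s : ℕ) : indVec n s i = 0 :=
  dif_neg fun h' => absurd h'.2 (not_lt.2 h)

theorem indVec_fin (p : Fin n × Fin n) : indVec n p.1 p.2 = Finsupp.single p 1 :=
  dif_pos ⟨p.1.2, p.2.2⟩

theorem ind_ext {M : Type*} [AddCommMonoid M] [Module ℂ M] {φ ψ : (Fin n × Fin n →₀ ℂ) →ₗ[ℂ] M}
    (h : ∀ s i, φ (indVec n s i) = ψ (indVec n s i)) : φ = ψ := by
  refine Finsupp.lhom_ext' fun p => LinearMap.ext_ring ?_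
  have := h p.1 p.2
  rwa [indVec_fin] at this

/-- Since `indVec` is zero outside the range, a formula that also vanishes there holds for all
natural s and i, which removes boundary cases from the relations. -/
theorem linearCombination_indVec {M : Type*} [AddCommMonoid M] [Module ℂ M] {φ : ℕ → ℕ → M}
    (h : ∀ s i, n ≤ s ∨ n ≤ i → φ s i = 0) (s i : ℕ) :
    Finsupp.linearCombination ℂ (fun p : Fin n × Fin n => φ p.1 p.2) (indVec n s i) = φ s i := by
  by_cases hs : s < n ∧ i < n
  · rw [indVec, dif_pos hs]; simp
  · rw [indVec, dif_neg hs, map_zero, h]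
    omega

/-- Value of `a` on `indVec n s i`; `z` is the exponent by which `b c` acts on the generator. -/
noncomputable def indAVal (n : ℕ) (q : ℂ) (z : ℤ) : ℕ → ℕ → (Fin n × Fin n →₀ ℂ)
  | 0, i => indVec n 0 (i + 1)
  | s + 1, i => q ^ (-(s + 1 : ℤ)) • (indVec n (s + 1) (i + 1) -
      (qInt q (s + 1) * (1 - q ^ (2 * i - s + z : ℤ))) • indVec n s i)

noncomputable def indA (n : ℕ) (q : ℂ) (z : ℤ) : Module.End ℂ (Fin n × Fin n →₀ ℂ) :=
  Finsupp.linearCombination ℂ fun p => indAVal n q z p.1 p.2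

noncomputable def indD (n : ℕ) : Module.End ℂ (Fin n × Fin n →₀ ℂ) :=
  Finsupp.linearCombination ℂ fun p => indVec n (p.1 + 1) p.2

noncomputable def indG (n : ℕ) (q : ℂ) (z : ℤ) : Module.End ℂ (Fin n × Fin n →₀ ℂ) :=
  Finsupp.linearCombination ℂ fun p => q ^ ((p.2 : ℤ) - (p.1 : ℕ) + z) • indVec n p.1 p.2

theorem indAVal_eq_zero (hq : IsPrimitiveRoot q n) (z : ℤ) (s i : ℕ) (h : n ≤ s ∨ n ≤ i) :
    indAVal n q z s i = 0 := by
  rcases h with h | h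
  · cases s with
    | zero => exact indVec_eq_zero_left h _
    | succ s =>
      rw [indAVal, indVec_eq_zero_left h, zero_sub, smul_neg]
      rcases h.lt_or_eq with h' | h'
      · rw [indVec_eq_zero_left (by omega), smul_zero, smul_zero, neg_zero]
      -- At s + 1 = n the vector of degree s = n - 1 is nonzero; it is its coefficient (n)_q (1 -
      -- q^…) that vanishes.
      · rw [← h', qInt_order_mul hq, zero_smul, smul_zero, neg_zero]
  · cases s with
    | zero => exact indVec_eq_zero_right (by omega) _
    | succ s =>
      rw [indAVal, indVec_eq_zero_right (by omega), indVec_eq_zero_right h, smul_zero, sub_zero,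
        smul_zero]

theorem indA_zero (hq : IsPrimitiveRoot q n) (z : ℤ) (i : ℕ) :
    indA n q z (indVec n 0 i) = indVec n 0 (i + 1) :=
  linearCombination_indVec (indAVal_eq_zero hq z) 0 i

theorem indA_succ (hq : IsPrimitiveRoot q n) (z : ℤ) (s i : ℕ) :
    indA n q z (indVec n (s + 1) i) = q ^ (-(s + 1 : ℤ)) • (indVec n (s + 1) (i + 1) -
      (qInt q (s + 1) * (1 - q ^ (2 * i - s + z : ℤ))) • indVec n s i) :=
  linearCombination_indVec (indAVal_eq_zero hq z) (s + 1) i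

theorem indD_apply (s i : ℕ) : indD n (indVec n s i) = indVec n (s + 1) i := by
  refine linearCombination_indVec (φ := fun s i => indVec n (s + 1) i) ?_ s i
  rintro s i (h | h)
  · exact indVec_eq_zero_left (by omega) _
  · exact indVec_eq_zero_right h _

theorem indG_apply (z : ℤ) (s i : ℕ) :
    indG n q z (indVec n s i) = q ^ ((i : ℤ) - s + z) • indVec n s i := by
  refine linearCombination_indVec (φ := fun s i : ℕ => q ^ ((i : ℤ) - s + z) • indVec n s i) ?_ s i
  rintro s i (h | h)
  · rw [indVec_eq_zero_left h, smul_zero]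
  · rw [indVec_eq_zero_right h, smul_zero]

theorem indD_pow_apply (k s i : ℕ) : (indD n ^ k) (indVec n s i) = indVec n (s + k) i := by
  induction k with
  | zero => simp
  | succ k ih => rw [pow_succ', Module.End.mul_apply, ih, indD_apply]; rfl

theorem indA_pow_apply (hq : IsPrimitiveRoot q n) (z : ℤ) (k i : ℕ) :
    (indA n q z ^ k) (indVec n 0 i) = indVec n 0 (i + k) := by
  induction k with
  | zero => simp
  | succ k ih => rw [pow_succ', Module.End.mul_apply, ih, indA_zero hq]; rfl

theorem indG_pow_apply (h0 : q ≠ 0) (z : ℤ) (k s i : ℕ) :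
    (indG n q z ^ k) (indVec n s i) = q ^ (((i : ℤ) - s + z) * k) • indVec n s i := by
  induction k with
  | zero => simp
  | succ k ih =>
    rw [pow_succ, Module.End.mul_apply, indG_apply, map_smul, ih, smul_smul, ← zpow_add₀ h0]
    congr 2; push_cast; ring

/-- The counterpart of `d_pow_succ_mul_a` for powers of a. It is stated without the nilpotency
relations because it serves to prove a^n = 0 on the induced module. -/
theorem d_mul_a_pow_succ {B : Type*} [Ring B] [Algebra ℂ B] {a b c d : B}
    (hba : b * a = q • (a * b)) (hca : c * a = q • (a * c))
    (hda : d * a - q • (a * d) = 1 - b * c) (k : ℕ) :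
    d * a ^ (k + 1) = q ^ (k + 1) • (a ^ (k + 1) * d) +
      qInt q (k + 1) • (a ^ k * (1 - q ^ k • (b * c))) := by
  have hda' : d * a = q • (a * d) + (1 - b * c) := by rw [← hda]; abel
  have hbca : b * c * a = q ^ 2 • (a * (b * c)) := by
    rw [mul_assoc, hca, mul_smul_comm, ← mul_assoc, hba, smul_mul_assoc, smul_smul, mul_assoc, sq]
  induction k with
  | zero => simp [hda', qInt]
  | succ k ih =>
    rw [pow_succ a (k + 1), ← mul_assoc, ih, add_mul, smul_mul_assoc, smul_mul_assoc,
      mul_assoc _ d a, hda', mul_assoc (a ^ k), sub_mul, one_mul, smul_mul_assoc, hbca]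
    simp only [mul_add, mul_sub, mul_smul_comm, smul_add, smul_sub, smul_smul, mul_one]
    simp only [← mul_assoc, ← pow_succ]
    rw [qInt_succ (k + 1)]
    have e : qInt q (k + 1) * q = q ^ (k + 1) - 1 + qInt q (k + 1) := by
      have := qInt_mul_sub_one (q := q) (k + 1)
      linear_combination this
    have e1 : (1 + q * qInt q (k + 1)) * q ^ (k + 1) =
        q ^ (k + 1) + qInt q (k + 1) * (q ^ k * q ^ 2) := by ring
    have e2 : (1 + q * qInt q (k + 1)) = q ^ (k + 1) + qInt q (k + 1) := by
      linear_combination e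
    rw [e1, e2]
    module

/-- The action of a is forced by `d_pow_succ_mul_a`: d^s a^i v has bc-weight q^{2(i-s)+u+w}, which
gives the factor 1 - q^{2i-s+u+w} in `indA_succ`. The relations other than a^n = 0 are verified on
basis vectors. -/
theorem ind_rels [NeZero n] (hq : IsPrimitiveRoot q n) (u w : ℤ) :
    ChenRels n q (indA n q (u + w)) (indG n q u) (indG n q w) (indD n) := by
  have h0 := hq.ne_zero (NeZero.ne n)
  have hpow : ∀ z, indG n q z ^ n = 1 := by
    intro z
    refine ind_ext fun s i => ?_
    rw [indG_pow_apply h0, mul_comm, zpow_mul, zpow_natCast, hq.pow_eq_one, one_zpow, one_smul]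
    rfl
  have hGA : ∀ z, indG n q z * indA n q (u + w) = q • (indA n q (u + w) * indG n q z) := by
    intro z
    refine ind_ext fun s i => ?_
    rw [LinearMap.smul_apply, Module.End.mul_apply, Module.End.mul_apply, indG_apply, map_smul]
    cases s with
    | zero =>
      rw [indA_zero hq, indG_apply, smul_smul, ← zpow_one_add₀ h0]
      congr 2; push_cast; ring
    | succ s =>
      rw [indA_succ hq, map_smul, map_sub, map_smul, indG_apply, indG_apply]
      have e1 : q ^ (((i + 1 : ℕ) : ℤ) - (s + 1 : ℕ) + z) = q * q ^ ((i : ℤ) - (s + 1 : ℕ) + z) := by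
        rw [← zpow_one_add₀ h0]; congr 1; push_cast; ring
      have e2 : q ^ ((i : ℤ) - s + z) = q * q ^ ((i : ℤ) - (s + 1 : ℕ) + z) := by
        rw [← zpow_one_add₀ h0]; congr 1; push_cast; ring
      rw [e1, e2]
      module
  have hDG : ∀ z, indD n * indG n q z = q • (indG n q z * indD n) := by
    intro z
    refine ind_ext fun s i => ?_
    rw [LinearMap.smul_apply, Module.End.mul_apply, Module.End.mul_apply, indG_apply, map_smul,
      indD_apply, indG_apply, smul_smul, ← zpow_one_add₀ h0]
    congr 2; push_cast; ring
  have hDA : indD n * indA n q (u + w) - q • (indA n q (u + w) * indD n) =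
      1 - indG n q u * indG n q w := by
    refine ind_ext fun s i => ?_
    simp only [LinearMap.sub_apply, LinearMap.smul_apply, Module.End.mul_apply, indG_apply,
      indD_apply, map_smul, Module.End.one_apply, indA_succ hq]
    have e1 : ∀ k : ℕ, q * q ^ (-(k + 1 : ℤ)) = q ^ (-(k : ℤ)) := by
      intro k; rw [← zpow_one_add₀ h0]; congr 1; ring
    cases s with
    | zero =>
      simp only [indA_zero hq, indD_apply]
      have e2 : q ^ ((i : ℤ) - (0 : ℕ) + w) * q ^ ((i : ℤ) - (0 : ℕ) + u) =
          q ^ (2 * i - (0 : ℕ) + (u + w) : ℤ) := by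
        rw [← zpow_add₀ h0]; congr 1; push_cast; ring
      rw [smul_smul, smul_smul, e1, e2]
      simp [qInt, sub_smul]
    | succ s =>
      simp only [indA_succ hq, map_smul, map_sub, indD_apply]
      have e3 := qInt_succ (q := q) (s + 1)
      have e4 := qInt_mul_sub_one (q := q) (s + 1)
      have e5 : q * q ^ (-(((s + 1 : ℕ) : ℤ) + 1)) = q ^ (-(s + 1 : ℤ)) := by
        rw [e1]; push_cast; rfl
      have e6 : q ^ (2 * i - s + (u + w) : ℤ) = q * q ^ (2 * i - (s + 1 : ℕ) + (u + w) : ℤ) := by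
        rw [← zpow_one_add₀ h0]; congr 1; push_cast; ring
      have e7 : q ^ ((i : ℤ) - (s + 1 : ℕ) + w) * q ^ ((i : ℤ) - (s + 1 : ℕ) + u) =
          q ^ (-(s + 1 : ℤ)) * q ^ (2 * i - (s + 1 : ℕ) + (u + w) : ℤ) := by
        rw [← zpow_add₀ h0, ← zpow_add₀ h0]; congr 1; push_cast; ring
      have e8 : q ^ (-(s + 1 : ℤ)) * q ^ (s + 1) = 1 := by
        rw [← zpow_natCast, ← zpow_add₀ h0]; push_cast; simp
      rw [smul_smul, smul_smul, e5, e7, e6, e3]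
      generalize q ^ (2 * i - (s + 1 : ℕ) + (u + w) : ℤ) = y at *
      match_scalars
      · ring
      · linear_combination (q ^ (-(s + 1 : ℤ))) * e4 + e8
  refine ⟨?_, hpow u, hpow w, ?_, hGA u, hDG u, hGA w, hDG w, ?_, hDA⟩
  -- For exponent n the correction term of `d_mul_a_pow_succ` vanishes, so d commutes with a^n. As
  -- a^n kills each a^i v, it kills each d^s a^i v.
  · obtain ⟨N, hN⟩ := Nat.exists_eq_succ_of_ne_zero (NeZero.ne n)
    have h1 := d_mul_a_pow_succ (B := Module.End ℂ (Fin n × Fin n →₀ ℂ)) (hGA u) (hGA w) hDA N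
    have h2 : qInt q n • (indA n q (u + w) ^ N * (1 - q ^ N • (indG n q u * indG n q w))) = 0 := by
      rw [← mul_smul_comm]
      convert mul_zero _
      refine ind_ext fun s i => ?_
      simp only [LinearMap.sub_apply, LinearMap.smul_apply, Module.End.mul_apply, indG_apply,
        map_smul, Module.End.one_apply, LinearMap.zero_apply]
      rw [smul_smul, smul_smul, ← zpow_natCast, ← zpow_add₀ h0, ← zpow_add₀ h0]
      nth_rw 1 [← one_smul ℂ (indVec n s i)]
      rw [← sub_smul, smul_smul, qInt_order_mul hq, zero_smul]
    have hN' : N + 1 = n := hN.symm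
    rw [hN', h2, add_zero, hq.pow_eq_one, one_smul] at h1
    refine ind_ext fun s i => ?_
    rw [LinearMap.zero_apply]
    induction s with
    | zero => rw [indA_pow_apply hq, indVec_eq_zero_right (by omega)]
    | succ s ih =>
      rw [← indD_apply, ← Module.End.mul_apply, ← h1, Module.End.mul_apply, ih, map_zero]
  · refine ind_ext fun s i => ?_
    rw [indD_pow_apply, indVec_eq_zero_left (by omega)]; rfl
  · refine ind_ext fun s i => ?_
    simp only [Module.End.mul_apply, indG_apply, map_smul]
    rw [smul_comm]

end Induced

/-- Fourier inversion on ℤ/n. -/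
theorem eq_zero_of_sum_zpow {n : ℕ} [NeZero n] {q : ℂ} (hq : IsPrimitiveRoot q n) {v : ℕ → ℂ}
    (h : ∀ u : ℤ, ∑ j ∈ Finset.range n, q ^ (u * j) * v j = 0) {j : ℕ} (hj : j < n) : v j = 0 := by
  have h0 := hq.ne_zero (NeZero.ne n)
  have h1 : ∑ u ∈ Finset.range n, q ^ (-((u : ℤ) * j)) *
      ∑ k ∈ Finset.range n, q ^ ((u : ℤ) * k) * v k = 0 := by simp [h]
  simp only [Finset.mul_sum, ← mul_assoc, ← zpow_add₀ h0] at h1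
  rw [Finset.sum_comm, Finset.sum_eq_single j] at h1
  · simp only [neg_add_cancel, zpow_zero, one_mul, Finset.sum_const, Finset.card_range,
      nsmul_eq_mul, mul_eq_zero, Nat.cast_eq_zero, NeZero.ne n, false_or] at h1
    exact h1
  · intro k hk hkj
    have h2 := sum_zpow_mul hq ((k : ℤ) - j)
    rw [if_neg] at h2
    · rw [← Finset.sum_mul]
      have h3 : ∀ u : ℕ, q ^ (-((u : ℤ) * j) + u * k) = q ^ ((u : ℤ) * ((k : ℤ) - j)) :=
        fun u => by congr 1; ring
      simp only [h3, h2, zero_mul]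
    · intro hd
      have := Finset.mem_range.1 hk
      have h3 := Int.eq_zero_of_abs_lt_dvd hd (by rw [abs_lt]; omega)
      omega
  · intro h; exact absurd (Finset.mem_range.2 hj) h

/-! ### Bijectivity of the map from the double -/

section Bijective

variable {n : ℕ} [NeZero n] {q : ℂ} (hq : IsPrimitiveRoot q n)

open TaftAlgebra ChenAlgebra

/-- The representation of `H_n(1,q)` induced from a character of `⟨b, c⟩`. -/
noncomputable def indRep (u w : ℤ) : ChenAlgebra hq →ₐ[ℂ] Module.End ℂ (Fin n × Fin n →₀ ℂ) :=
  ChenAlgebra.lift hq (ind_rels hq u w)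

theorem indRep_idem (u w t : ℤ) (s i : ℕ) : indRep hq u w (idem n q (c hq) t) (indVec n s i) =
    if (n : ℤ) ∣ t - ((i : ℤ) - s + w) then indVec n s i else 0 := by
  have h0 := hq.ne_zero (NeZero.ne n)
  have hc : indRep hq u w (c hq) = indG n q w := ChenAlgebra.lift_c hq _
  have hi : indRep hq u w (idem n q (c hq) t) = idem n q (indG n q w) t := by
    simp only [idem, map_sum, map_smul, map_pow, hc]
  rw [hi, idem, LinearMap.sum_apply]
  simp only [LinearMap.smul_apply, indG_pow_apply h0, smul_smul, ← Finset.sum_smul]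
  have h := sum_zpow_mul hq (-(t - ((i : ℤ) - s + w)))
  have : ∑ m ∈ Finset.range n, (n : ℂ)⁻¹ * q ^ (-(t * m)) * q ^ (((i : ℤ) - s + w) * m) =
      (n : ℂ)⁻¹ * ∑ m ∈ Finset.range n, q ^ ((m : ℤ) * (-(t - ((i : ℤ) - s + w)))) := by
    rw [Finset.mul_sum]
    refine Finset.sum_congr rfl fun m _ => ?_
    rw [mul_assoc, ← zpow_add₀ h0]
    congr 2; ring
  rw [this, h]
  simp only [dvd_neg]
  split_ifs
  · rw [inv_mul_cancel₀ (Nat.cast_ne_zero.2 (NeZero.ne n)), one_smul]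
  · simp

/-- The vector d^s a^i v has c-weight q^{i-s+w}, so among the idempotents E_t only t ≡ i - s + w
survives, and one value of f remains in each degree s. -/
theorem indRep_theta (f : Dual ℂ (TaftAlgebra hq)) (u w : ℤ) (i : ℕ) :
    indRep hq u w (theta hq f) (indVec n 0 i) = ∑ s ∈ Finset.range n,
      ((qFactorial q s)⁻¹ * f (monomial hq s ((i : ℤ) - s + w))) • indVec n s i := by
  rw [theta_apply, map_sum, LinearMap.sum_apply]
  refine Finset.sum_congr rfl fun s _ => ?_
  rw [map_sum, LinearMap.sum_apply]
  have h1 : ∀ t : ℤ, indRep hq u w (dualMono hq s t) (indVec n 0 i) =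
      (qFactorial q s)⁻¹ • if (n : ℤ) ∣ t - ((i : ℤ) - s + w) then indVec n s i else 0 := by
    intro t
    have hd : indRep hq u w (d hq) = indD n := ChenAlgebra.lift_d hq _
    rw [dualMono, dualMonomial, map_smul, map_mul, map_pow, LinearMap.smul_apply,
      Module.End.mul_apply, hd, indD_pow_apply, zero_add, indRep_idem]
  simp only [map_smul, LinearMap.smul_apply, h1, smul_ite, smul_zero]
  rw [sum_range_ite_dvd (φ := fun t : ℤ => f (monomial hq s t) • (qFactorial q s)⁻¹ • indVec n s i)
    (fun t => by rw [monomial_add_order]), smul_smul, mul_comm]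

theorem exists_double_eq_sum (Z : Double (TaftAlgebra hq)) :
    ∃ f : ℕ → ℕ → Dual ℂ (TaftAlgebra hq), Z = ∑ i ∈ Finset.range n, ∑ j ∈ Finset.range n,
      f i j ⊗ₜ[ℂ] (x hq ^ i * g hq ^ j) := by
  induction Z using TensorProduct.induction_on with
  | zero => exact ⟨0, by simp⟩
  | add Y Z hY hZ =>
    obtain ⟨f, rfl⟩ := hY
    obtain ⟨f', rfl⟩ := hZ
    exact ⟨f + f', by simp [TensorProduct.add_tmul, Finset.sum_add_distrib]⟩
  | tmul h y =>
    induction y using monomial_ind with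
    | h0 => exact ⟨0, by simp⟩
    | hadd y z hy hz =>
      obtain ⟨f, hf⟩ := hy
      obtain ⟨f', hf'⟩ := hz
      exact ⟨f + f', by
        rw [TensorProduct.tmul_add, hf, hf']
        simp [TensorProduct.add_tmul, Finset.sum_add_distrib]⟩
    | hsmul r y hy =>
      obtain ⟨f, hf⟩ := hy
      exact ⟨r • f, by
        rw [TensorProduct.tmul_smul, hf]
        simp [TensorProduct.smul_tmul', Finset.smul_sum]⟩
    | hmono s hs t ht =>
      refine ⟨fun i j => if i = s ∧ j = t then h else 0, ?_⟩
      rw [Finset.sum_eq_single s, Finset.sum_eq_single t]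
      · simp
      · intro j _ hj; simp [hj]
      · intro h; exact absurd (Finset.mem_range.2 ht) h
      · intro i _ hi; simp [hi]
      · intro h; exact absurd (Finset.mem_range.2 hs) h

theorem toChen_injective : Function.Injective (toChen hq) := by
  rw [← LinearMap.ker_eq_bot, LinearMap.ker_eq_bot']
  intro Z hZ
  obtain ⟨f, rfl⟩ := exists_double_eq_sum hq Z
  have h0 := hq.ne_zero (NeZero.ne n)
  suffices hf : ∀ i < n, ∀ j < n, f i j = 0 by
    refine Finset.sum_eq_zero fun i hi => Finset.sum_eq_zero fun j hj => ?_
    rw [hf i (Finset.mem_range.1 hi) j (Finset.mem_range.1 hj), TensorProduct.zero_tmul]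
  have key : ∀ u w : ℤ, ∑ i ∈ Finset.range n, ∑ j ∈ Finset.range n, ∑ s ∈ Finset.range n,
      (q ^ (u * j) * ((qFactorial q s)⁻¹ * f i j (monomial hq s ((i : ℤ) - s + w)))) •
        indVec n s i = 0 := by
    intro u w
    -- The image of Z is evaluated at the generator v of the induced module: b^j gives q^{uj}, then
    -- a^i gives a^i v.
    have h1 := congrArg (fun y => indRep hq u w y (indVec n 0 0)) hZ
    simp only [map_zero, LinearMap.zero_apply] at h1
    rw [← h1]
    simp only [map_sum, LinearMap.sum_apply]
    refine Finset.sum_congr rfl fun i _ => Finset.sum_congr rfl fun j _ => ?_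
    have ha : indRep hq u w (a hq) = indA n q (u + w) := ChenAlgebra.lift_a hq _
    have hb : indRep hq u w (b hq) = indG n q u := ChenAlgebra.lift_b hq _
    rw [Double.mulMap_tmul, map_mul (iota hq), map_pow, map_pow, iota_x, iota_g, map_mul, map_mul,
      map_pow, map_pow, ha, hb, Module.End.mul_apply, Module.End.mul_apply, indG_pow_apply h0,
      map_smul, map_smul, indA_pow_apply hq, zero_add, indRep_theta, Finset.smul_sum]
    simp [smul_smul]
  intro i hi j hj
  have hm : ∀ s < n, ∀ w : ℤ, f i j (monomial hq s ((i : ℤ) - s + w)) = 0 := by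
    intro s hs w
    refine eq_zero_of_sum_zpow hq (v := fun j => f i j (monomial hq s ((i : ℤ) - s + w)))
      (fun u => ?_) hj
    have h1 := DFunLike.congr_fun (key u w) (⟨s, hs⟩, ⟨i, hi⟩)
    simp only [Finsupp.finsetSum_apply, Finsupp.smul_apply, Finsupp.zero_apply] at h1
    have h2 : ∀ s' i' : ℕ, (indVec n s' i' : Fin n × Fin n →₀ ℂ) (⟨s, hs⟩, ⟨i, hi⟩) =
        if s' = s ∧ i' = i then 1 else 0 := by
      intro s' i'
      by_cases h : s' < n ∧ i' < n
      · rw [indVec, dif_pos h, Finsupp.single_apply]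
        simp
      · rw [indVec, dif_neg h, if_neg (by rintro ⟨rfl, rfl⟩; exact h ⟨hs, hi⟩)]
        rfl
    simp only [h2] at h1
    rw [Finset.sum_eq_single i (fun i' _ hi' => by simp [hi'])
      (fun h => absurd (Finset.mem_range.2 hi) h)] at h1
    have h3 : ∀ j' ∈ Finset.range n, ∑ s' ∈ Finset.range n,
        (q ^ (u * (j' : ℤ)) * ((qFactorial q s')⁻¹ *
          f i j' (monomial hq s' ((i : ℤ) - s' + w)))) • (if s' = s ∧ i = i then (1 : ℂ) else 0) =
        (qFactorial q s)⁻¹ * (q ^ (u * (j' : ℤ)) * f i j' (monomial hq s ((i : ℤ) - s + w))) := by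
      intro j' _
      rw [Finset.sum_eq_single s (fun i' _ hi' => by simp [hi'])
        (fun h => absurd (Finset.mem_range.2 hs) h)]
      simp only [and_self, if_true, smul_eq_mul, mul_one]
      ring
    rw [Finset.sum_congr rfl h3, ← Finset.mul_sum, mul_eq_zero] at h1
    exact h1.resolve_left (inv_ne_zero (qFactorial_ne_zero hq hs))
  ext y
  induction y using monomial_ind with
  | h0 => simp
  | hadd y z hy hz => rw [map_add, map_add, hy, hz]
  | hsmul r y hy => rw [map_smul, map_smul, hy]
  | hmono s hs t ht =>
    -- This w makes the exponent i - s + w equal to t.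
    have := hm s hs (t - (i - s))
    rw [add_sub_cancel, monomial_natCast] at this
    exact this

/-- The spectral decomposition c = ∑ q^t E_t is θ of the character g ↦ q, x ↦ 0. -/
theorem exists_theta_eq_c : ∃ f, theta hq f = c hq := by
  have hr : TaftRels n q q (0 : ℂ) :=
    ⟨hq.pow_eq_one, zero_pow (NeZero.ne n), by simp⟩
  refine ⟨(TaftAlgebra.lift hq hr).toLinearMap, ?_⟩
  have hf : ∀ s t : ℕ, (TaftAlgebra.lift hq hr).toLinearMap (monomial hq s t) =
      if s = 0 then q ^ t else 0 := by
    intro s t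
    rw [monomial_natCast, AlgHom.toLinearMap_apply, map_mul, map_pow, map_pow, TaftAlgebra.lift_x,
      TaftAlgebra.lift_g, zero_pow_eq]
    split_ifs <;> simp
  rw [theta_apply, Finset.sum_eq_single 0]
  · simp only [hf, if_true, dualMono, dualMonomial, qFactorial_zero, inv_one, pow_zero, mul_one,
      one_smul]
    conv_rhs => rw [← mul_one (c hq), ← sum_idem hq (c hq), Finset.mul_sum]
    exact Finset.sum_congr rfl fun t _ => by
      rw [mul_idem hq (ChenAlgebra.rels hq).c_pow, zpow_natCast]
  · intro s _ hs
    simp [hf, hs]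
  · intro h; exact absurd (Finset.mem_range.2 (NeZero.pos n)) h

/-- As d = ∑ E_t d, the required functional is 1 on x g^t and 0 on x^s g^t for s ≠ 1. It is realised
as a matrix entry of a two-dimensional representation, which makes it well defined without linear
independence of the monomials. For n = 1 that representation does not exist, but then d = 0. -/
theorem exists_theta_eq_d : ∃ f, theta hq f = d hq := by
  by_cases hn : n < 2
  · refine ⟨0, ?_⟩
    have h1 : n = 1 := by have := NeZero.pos n; omega
    have h2 := (ChenAlgebra.rels hq).d_pow_eq_zero (s := 1) h1.le
    rw [map_zero, ← h2, pow_one]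
  have hN : (!![0, 1; 0, 0] : Matrix (Fin 2) (Fin 2) ℂ) ^ 2 = 0 := by
    rw [sq, Matrix.mul_fin_two]
    ext i j; fin_cases i <;> fin_cases j <;> simp
  have hN' : ∀ s, (!![0, 1; 0, 0] : Matrix (Fin 2) (Fin 2) ℂ) ^ (s + 2) = 0 := by
    intro s; rw [pow_add, hN, mul_zero]
  have hr : TaftRels n q (.diagonal ![q, 1] : Matrix (Fin 2) (Fin 2) ℂ) !![0, 1; 0, 0] := by
    refine ⟨?_, ?_, ?_⟩
    · rw [Matrix.diagonal_pow, ← Matrix.diagonal_one]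
      congr 1; ext i; fin_cases i <;> simp [hq.pow_eq_one]
    · obtain ⟨s, rfl⟩ := Nat.exists_eq_add_of_le' (not_lt.1 hn)
      exact hN' s
    · ext i j
      rw [Matrix.diagonal_mul, Matrix.smul_apply, Matrix.mul_diagonal]
      fin_cases i <;> fin_cases j <;> simp
  let ξ : Dual ℂ (TaftAlgebra hq) :=
    Matrix.entryLinearMap ℂ ℂ (0 : Fin 2) (1 : Fin 2) ∘ₗ (TaftAlgebra.lift hq hr).toLinearMap
  have hf : ∀ s t : ℕ, ξ (monomial hq s t) = if s = 1 then 1 else 0 := by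
    intro s t
    change TaftAlgebra.lift hq hr (monomial hq s t) 0 1 = _
    rw [monomial_natCast, map_mul, map_pow, map_pow, TaftAlgebra.lift_x, TaftAlgebra.lift_g,
      Matrix.diagonal_pow, Matrix.mul_diagonal]
    rcases s with - | - | s
    · simp
    · simp
    · simp [hN']
  refine ⟨ξ, ?_⟩
  rw [theta_apply, Finset.sum_eq_single 1]
  · simp only [hf, if_true, dualMono, dualMonomial, pow_one, one_smul, qFactorial_succ,
      qFactorial_zero, one_mul]
    rw [← Finset.smul_sum, ← Finset.sum_mul, sum_idem hq, one_mul]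
    simp [qInt]
  · intro s _ hs
    simp [hf, hs]
  · intro h; exact absurd (Finset.mem_range.2 (by omega)) h

theorem toChen_surjective : Function.Surjective (toChen hq) := by
  intro y
  have hy : y ∈ Algebra.adjoin ℂ {a hq, b hq, c hq, d hq} :=
    ChenAlgebra.adjoin_eq_top hq ▸ Algebra.mem_top
  induction hy using Algebra.adjoin_induction with
  | mem y hy =>
    rcases hy with rfl | rfl | rfl | rfl
    · exact ⟨Coalgebra.counit ⊗ₜ x hq, by
        rw [Double.mulMap_tmul, theta_counit, iota_x, one_mul]⟩
    · exact ⟨Coalgebra.counit ⊗ₜ g hq, by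
        rw [Double.mulMap_tmul, theta_counit, iota_g, one_mul]⟩
    · obtain ⟨f, hf⟩ := exists_theta_eq_c hq
      exact ⟨f ⊗ₜ 1, by rw [Double.mulMap_tmul, hf, map_one, mul_one]⟩
    · obtain ⟨f, hf⟩ := exists_theta_eq_d hq
      exact ⟨f ⊗ₜ 1, by rw [Double.mulMap_tmul, hf, map_one, mul_one]⟩
  | algebraMap r => exact ⟨r • Double.one _, by
      rw [map_smul, toChen_one, Algebra.algebraMap_eq_smul_one]⟩
  | add y z _ _ hy hz =>
    obtain ⟨Y, rfl⟩ := hy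
    obtain ⟨Z, rfl⟩ := hz
    exact ⟨Y + Z, map_add _ _ _⟩
  | mul y z _ _ hy hz =>
    obtain ⟨Y, rfl⟩ := hy
    obtain ⟨Z, rfl⟩ := hz
    exact ⟨_, toChen_mul hq Y Z⟩

/-- The isomorphism of Hopf algebras `D(H_n(q)) ≅ H_n(1,q)`. -/
noncomputable def doubleEquiv : Double (TaftAlgebra hq) ≃ₗ[ℂ] ChenAlgebra hq :=
  LinearEquiv.ofBijective (toChen hq) ⟨toChen_injective hq, toChen_surjective hq⟩

theorem doubleEquiv_isHopfIso : Double.IsHopfIso (antipode_bijective hq) (doubleEquiv hq) where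
  map_mul := toChen_mul hq
  map_one := toChen_one hq
  map_comul := comul_toChen hq
  map_counit := counit_toChen hq
  map_antipode := antipode_toChen hq

/-- For f dual to one monomial x^s g^t the two outer sums reduce to a single term, and the inner sum
is the expansion of E_t. -/
theorem doubleEquiv_tmul (f : Dual ℂ (TaftAlgebra hq)) (i j : ℕ) :
    doubleEquiv hq (f ⊗ₜ[ℂ] (x hq ^ i * g hq ^ j)) =
      ∑ s ∈ Finset.range n, ∑ t ∈ Finset.range n, f (x hq ^ s * g hq ^ t) •
        ∑ m ∈ Finset.range n, (1 / ((n : ℂ) * qFactorial q s) * q ^ (-((t : ℤ) * m))) •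
          (c hq ^ m * d hq ^ s * a hq ^ i * b hq ^ j) := by
  change toChen hq _ = _
  rw [Double.mulMap_tmul, map_mul (iota hq), map_pow, map_pow, iota_x, iota_g, theta_apply,
    Finset.sum_mul]
  refine Finset.sum_congr rfl fun s _ => ?_
  rw [Finset.sum_mul]
  refine Finset.sum_congr rfl fun t _ => ?_
  rw [monomial_natCast, smul_mul_assoc, dualMono, dualMonomial, idem, Finset.sum_mul,
    Finset.smul_sum, Finset.sum_mul]
  congr 1
  refine Finset.sum_congr rfl fun m _ => ?_
  rw [smul_mul_assoc, smul_mul_assoc, smul_mul_assoc, smul_smul]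
  congr 1
  · rw [one_div, mul_inv]; ring
  · simp only [mul_assoc]

end Bijective

theorem alpha_ne_zero {n : ℕ} {q : ℂ} {l : ℕ} (hq : IsPrimitiveRoot q n) (hl : l ≤ n) {i : ℕ} (h0 : 0 < i) (hi : i < l) :
    alpha q l i ≠ 0 := by
  refine mul_ne_zero (qInt_ne_zero hq h0 (by omega)) (sub_ne_zero.2 fun h => ?_)
  have hd := (hq.zpow_eq_one_iff_dvd _).1 h.symm
  have := Int.eq_zero_of_abs_lt_dvd hd (by rw [abs_lt]; omega)
  omega

/-! ### Simplicity of V(l,r) and a necessary condition for self-duality -/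

section Simple

variable {n : ℕ} [NeZero n] {q : ℂ} {l : ℕ}

open ChenAlgebra

theorem matA_mulVec_single {i : ℕ} (hi : i + 1 < l) :
    (matA l).mulVec (Pi.single ⟨i, by omega⟩ 1) = Pi.single ⟨i + 1, hi⟩ 1 := by
  rw [Matrix.mulVec_single_one]
  ext p
  simp [matA, Pi.single_apply, Fin.ext_iff]

theorem matB_mulVec_single (r : ℤ) (i : Fin l) :
    (matB q l r).mulVec (Pi.single i 1) = q ^ (r + i) • Pi.single i 1 := by
  rw [Matrix.mulVec_single_one]
  ext p
  rcases eq_or_ne p i with rfl | h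
  · simp [matB]
  · simp [matB, h]

theorem matD_mulVec_single_zero (h : 0 < l) :
    (matD q l).mulVec (Pi.single ⟨0, h⟩ 1) = 0 := by
  rw [Matrix.mulVec_single_one]
  ext p
  simp [matD]

theorem matD_mulVec_single_succ {i : ℕ} (hi : i + 1 < l) :
    (matD q l).mulVec (Pi.single ⟨i + 1, hi⟩ 1) =
      alpha q l (i + 1) • Pi.single ⟨i, by omega⟩ 1 := by
  rw [Matrix.mulVec_single_one]
  ext p
  simp [matD, Pi.single_apply, Fin.ext_iff]

theorem matD_mulVec (w : Fin l → ℂ) {i : ℕ} (hi : i + 1 < l) :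
    (matD q l).mulVec w ⟨i, by omega⟩ = alpha q l (i + 1) * w ⟨i + 1, hi⟩ := by
  rw [Matrix.mulVec, dotProduct, Finset.sum_eq_single ⟨i + 1, hi⟩]
  · simp [matD]
  · intro j _ hj
    have : i + 1 ≠ j := fun h => hj (Fin.ext h.symm)
    simp [matD, this]
  · simp

theorem matD_mulVec_last (w : Fin l → ℂ) {i : ℕ} (hi : i + 1 = l) :
    (matD q l).mulVec w ⟨i, by omega⟩ = 0 := by
  rw [Matrix.mulVec, dotProduct]
  refine Finset.sum_eq_zero fun j _ => ?_
  have : i + 1 ≠ j := by omega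
  simp [matD, this]

variable (hq : IsPrimitiveRoot q n) (hl : l ≤ n) (r : ℤ)

theorem simpleRep_a (v : Fin l → ℂ) : simpleRep hq hl r (a hq) v = (matA l).mulVec v := by
  simp [simpleRep]

theorem simpleRep_b (v : Fin l → ℂ) : simpleRep hq hl r (b hq) v = (matB q l r).mulVec v := by
  simp [simpleRep]

theorem simpleRep_d (v : Fin l → ℂ) : simpleRep hq hl r (d hq) v = (matD q l).mulVec v := by
  simp [simpleRep]

theorem simpleRep_isIrreducible (h1 : 1 ≤ l) : IsIrreducible (simpleRep hq hl r) := by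
  have hne : Nonempty (Fin l) := ⟨⟨0, h1⟩⟩
  refine ⟨inferInstance, fun W hW => ?_⟩
  by_cases hb : W = ⊥
  · exact Or.inl hb
  right
  obtain ⟨w, hw, hw0⟩ := W.ne_bot_iff.1 hb
  -- Induction on the highest nonzero coordinate k: d moves it from k + 1 to k with the nonzero
  -- factor α_{k+1}(l), until a multiple of v_1 is left.
  have hdown : ∀ k, ∀ hk : k < l, ∀ w ∈ W, w ⟨k, hk⟩ ≠ 0 → (∀ j : Fin l, k < j → w j = 0) →
      Pi.single ⟨0, h1⟩ (1 : ℂ) ∈ W := by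
    intro k
    induction k with
    | zero =>
      intro hk w hw h0 hj
      have : Pi.single ⟨0, h1⟩ (1 : ℂ) = (w ⟨0, hk⟩)⁻¹ • w := by
        ext j
        by_cases h : (j : ℕ) = 0
        · obtain rfl : j = ⟨0, h1⟩ := Fin.ext h
          simp [h0]
        · have hne : j ≠ ⟨0, h1⟩ := fun e => h (congrArg Fin.val e)
          simp [hj j (Nat.pos_of_ne_zero h), hne]
      rw [this]
      exact W.smul_mem _ hw
    | succ k ih =>
      intro hk w hw h0 hj
      refine ih (by omega) (simpleRep hq hl r (d hq) w) (hW _ _ hw) ?_ ?_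
      · rw [simpleRep_d, matD_mulVec w hk]
        exact mul_ne_zero (alpha_ne_zero hq hl (Nat.succ_pos k) hk) h0
      · rintro ⟨j, hjl⟩ hkj
        have hkj' : k < j := hkj
        rw [simpleRep_d]
        by_cases hj1 : j + 1 < l
        · rw [matD_mulVec w hj1, hj ⟨j + 1, hj1⟩ (by simp; omega), mul_zero]
        · exact matD_mulVec_last w (by omega)
  have h0 : Pi.single ⟨0, h1⟩ (1 : ℂ) ∈ W := by
    obtain ⟨i, hi⟩ := Function.ne_iff.1 hw0
    let s : Finset (Fin l) := Finset.univ.filter fun j => w j ≠ 0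
    have hs : s.Nonempty := ⟨i, by simpa [s] using hi⟩
    have hmax := s.max'_mem hs
    refine hdown _ (s.max' hs).2 w hw (by simpa [s] using hmax) fun j hj => ?_
    by_contra hwj
    exact absurd (s.le_max' j (by simpa [s] using hwj)) (not_le.2 hj)
  have hall : ∀ k, ∀ hk : k < l, Pi.single ⟨k, hk⟩ (1 : ℂ) ∈ W := by
    intro k
    induction k with
    | zero => intro _; exact h0
    | succ k ih =>
      intro hk
      rw [← matA_mulVec_single hk, ← simpleRep_a hq hl r]
      exact hW _ _ (ih (by omega))
  refine top_unique fun v _ => ?_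
  rw [pi_eq_sum_univ' v]
  refine W.sum_mem fun i _ => W.smul_mem _ ?_
  convert hall i i.2 using 1

/-- The functional φ corresponding to v_1 is annihilated by d, hence vanishes on the image of d,
which contains every basis vector but the last. Thus φ is a nonzero multiple of the coordinate of
v_l, and its b-weight q^{-(r+l-1)} must equal the weight q^r of v_1. -/
theorem modEq_of_isSelfDual (h1 : 1 ≤ l) (hd : IsSelfDual (simpleRep hq hl r)) :
    2 * r ≡ 1 - (l : ℤ) [ZMOD (n : ℤ)] := by
  have h0 := hq.ne_zero (NeZero.ne n)
  obtain ⟨T, hT⟩ := hd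
  set φ := T (Pi.single ⟨0, h1⟩ 1) with hφ
  have hD : ∀ v, φ ((matD q l).mulVec v) = 0 := by
    intro v
    -- Evaluating at c v cancels the c⁻¹ in S(d) = -d c⁻¹.
    have := DFunLike.congr_fun (hT (d hq) (Pi.single ⟨0, h1⟩ 1)) (simpleRep hq hl r (c hq) v)
    rw [simpleRep_d, matD_mulVec_single_zero, map_zero, LinearMap.zero_apply, dualRep_apply,
      antipode_d, ← Module.End.mul_apply, ← map_mul, neg_mul, mul_assoc, inv_mul_c, mul_one,
      map_neg, LinearMap.neg_apply, map_neg, simpleRep_d, eq_comm, neg_eq_zero] at this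
    exact this
  have hz : ∀ i : ℕ, ∀ hi : i + 1 < l, φ (Pi.single ⟨i, by omega⟩ 1) = 0 := by
    intro i hi
    have := hD (Pi.single ⟨i + 1, hi⟩ 1)
    rw [matD_mulVec_single_succ, map_smul, smul_eq_mul, mul_eq_zero] at this
    exact this.resolve_left (alpha_ne_zero hq hl (Nat.succ_pos i) hi)
  have hlast : φ (Pi.single ⟨l - 1, by omega⟩ 1) ≠ 0 := by
    intro h
    have hφ0 : φ = 0 := by
      refine LinearMap.pi_ext' fun i => LinearMap.ext_ring ?_
      by_cases hi : (i : ℕ) + 1 < l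
      · exact hz i hi
      · have hi' : i = ⟨l - 1, by omega⟩ := Fin.ext (by simp; omega)
        rw [hi']
        exact h
    have h2 := T.map_eq_zero_iff.1 (hφ.symm.trans hφ0)
    have h3 := congrFun h2 ⟨0, h1⟩
    simp at h3
  -- Evaluating at b v_l cancels the b⁻¹ coming from the antipode.
  have hb := DFunLike.congr_fun (hT (b hq) (Pi.single ⟨0, h1⟩ 1))
    (simpleRep hq hl r (b hq) (Pi.single ⟨l - 1, by omega⟩ 1))
  rw [dualRep_apply, antipode_b, ← Module.End.mul_apply, ← map_mul, inv_mul_b, map_one,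
    Module.End.one_apply, simpleRep_b, simpleRep_b, matB_mulVec_single, matB_mulVec_single,
    map_smul, map_smul, LinearMap.smul_apply, smul_smul, ← zpow_add₀ h0, ← hφ, smul_eq_mul] at hb
  have h2 := mul_right_cancel₀ hlast (hb.trans (one_mul _).symm)
  have h3 := (hq.zpow_eq_one_iff_dvd _).1 h2
  have h4 : ((l - 1 : ℕ) : ℤ) = l - 1 := by omega
  have h5 : 1 - (l : ℤ) - 2 * r = -(r + ((l - 1 : ℕ) : ℤ) + (r + ((0 : ℕ) : ℤ))) := by
    rw [h4]; push_cast; ring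
  rw [Int.modEq_iff_dvd, h5]
  exact Int.dvd_neg.2 h3

end Simple

/-! ### The antipode on matrices and its trace -/

section SelfDual

variable {n : ℕ} [NeZero n] {q : ℂ} {l : ℕ}

open ChenAlgebra

/-- The anti-automorphism `A ↦ K⁻¹ Aᵀ K` of the matrix algebra, where `K` is the anti-diagonal
matrix with entries `κ`. -/
noncomputable def twistTranspose (κ : ℕ → ℂ) :
    Matrix (Fin l) (Fin l) ℂ →ₗ[ℂ] Matrix (Fin l) (Fin l) ℂ where
  toFun A := .of fun i j => (κ i.rev)⁻¹ * κ j.rev * A j.rev i.rev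
  map_add' A B := by ext i j; simp [mul_add]
  map_smul' c A := by ext i j; simp [mul_left_comm]

theorem twistTranspose_apply (κ : ℕ → ℂ) (A : Matrix (Fin l) (Fin l) ℂ) (i j : Fin l) :
    twistTranspose κ A i j = (κ i.rev)⁻¹ * κ j.rev * A j.rev i.rev := rfl

theorem twistTranspose_mul {κ : ℕ → ℂ} (hκ : ∀ i, κ i ≠ 0) (A B : Matrix (Fin l) (Fin l) ℂ) :
    twistTranspose κ (A * B) = twistTranspose κ B * twistTranspose κ A := by
  ext i j
  rw [twistTranspose_apply, Matrix.mul_apply, Matrix.mul_apply, Finset.mul_sum,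
    ← Equiv.sum_comp Fin.revPerm]
  refine Finset.sum_congr rfl fun k _ => ?_
  rw [twistTranspose_apply, twistTranspose_apply, Fin.revPerm_apply]
  have := hκ k.rev
  field_simp

theorem twistTranspose_one {κ : ℕ → ℂ} (hκ : ∀ i, κ i ≠ 0) :
    twistTranspose κ (1 : Matrix (Fin l) (Fin l) ℂ) = 1 := by
  ext i j
  rw [twistTranspose_apply]
  rcases eq_or_ne i j with rfl | h
  · simp [hκ]
  · rw [Matrix.one_apply_ne h, Matrix.one_apply_ne (fun e => h (Fin.rev_injective e).symm), mul_zero]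

/-- The matrix unit E_{ij} goes to a multiple of E_{j.rev, i.rev}, so only the pairs with j = i.rev
contribute to the trace. -/
theorem trace_twistTranspose (κ : ℕ → ℂ) :
    LinearMap.trace ℂ _ (twistTranspose (l := l) κ) =
      ∑ i : Fin l, (κ i.rev)⁻¹ * κ i := by
  rw [LinearMap.trace_eq_matrix_trace ℂ (Matrix.stdBasis ℂ (Fin l) (Fin l)), Matrix.trace,
    Fintype.sum_prod_type]
  refine Finset.sum_congr rfl fun i _ => ?_
  have h1 : ∀ j : Fin l, ((LinearMap.toMatrix (Matrix.stdBasis ℂ (Fin l) (Fin l))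
      (Matrix.stdBasis ℂ (Fin l) (Fin l))) (twistTranspose κ)).diag (i, j) =
      (κ i.rev)⁻¹ * κ j.rev * Matrix.single i j (1 : ℂ) j.rev i.rev := by
    intro j
    rw [Matrix.diag_apply, LinearMap.toMatrix_apply, Matrix.stdBasis_eq_single]
    rfl
  simp only [h1]
  rw [Finset.sum_eq_single i.rev]
  · simp
  · intro j _ hj
    rw [Matrix.single_apply_of_ne, mul_zero]
    rintro ⟨h, -⟩
    exact hj (by rw [h, Fin.rev_rev])
  · simp

/-- The matrix form of `simpleRep`. -/
noncomputable abbrev matRep (hq : IsPrimitiveRoot q n) (hl : l ≤ n) (r : ℤ) :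
    ChenAlgebra hq →ₐ[ℂ] Matrix (Fin l) (Fin l) ℂ :=
  ChenAlgebra.lift hq (mat_rels r hq hl)

theorem simpleRep_apply (hq : IsPrimitiveRoot q n) (hl : l ≤ n) (r : ℤ) (h : ChenAlgebra hq)
    (v : Fin l → ℂ) : simpleRep hq hl r h v = (matRep hq hl r h).mulVec v := by
  simp [simpleRep]

/-- The bilinear form ∑ κ_i v_i w_{i.rev} is nondegenerate, and the hypothesis says that the adjoint
of h for this form is S(h). -/
theorem isSelfDual_of_twistTranspose (hq : IsPrimitiveRoot q n) (hl : l ≤ n) (r : ℤ) {κ : ℕ → ℂ}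
    (hκ : ∀ i, κ i ≠ 0)
    (h : ∀ y, twistTranspose κ (matRep hq hl r y) = matRep hq hl r (HopfAlgebra.antipode ℂ y)) :
    IsSelfDual (simpleRep hq hl r) := by
  let T₀ : (Fin l → ℂ) →ₗ[ℂ] Dual ℂ (Fin l → ℂ) :=
    LinearMap.mk₂ ℂ (fun v w => ∑ i : Fin l, κ i * v i * w i.rev)
      (fun v v' w => by simp [mul_add, add_mul, Finset.sum_add_distrib])
      (fun c v w => by
        simp only [Pi.smul_apply, smul_eq_mul, Finset.mul_sum]
        exact Finset.sum_congr rfl fun i _ => by ring)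
      (fun v w w' => by simp [mul_add, Finset.sum_add_distrib])
      (fun c v w => by
        simp only [Pi.smul_apply, smul_eq_mul, Finset.mul_sum]
        exact Finset.sum_congr rfl fun i _ => by ring)
  have hT₀ : ∀ v w, T₀ v w = ∑ i : Fin l, κ i * v i * w i.rev := fun v w => rfl
  have hinj : Function.Injective T₀ := by
    rw [← LinearMap.ker_eq_bot, LinearMap.ker_eq_bot']
    intro v hv
    ext i
    have := DFunLike.congr_fun hv (Pi.single i.rev 1)
    rw [hT₀, Finset.sum_eq_single i (fun j _ hj => by simp [hj]) (by simp)] at this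
    simpa [hκ] using this
  refine ⟨LinearEquiv.ofInjectiveOfFinrankEq T₀ hinj Subspace.dual_finrank_eq.symm, fun y v => ?_⟩
  have hc : ∀ v, LinearEquiv.ofInjectiveOfFinrankEq T₀ hinj Subspace.dual_finrank_eq.symm v =
      T₀ v := fun v => DFunLike.congr_fun (LinearEquiv.coe_ofInjectiveOfFinrankEq ..) v
  rw [hc, hc]
  refine LinearMap.ext fun w => ?_
  rw [dualRep_apply, hT₀, hT₀, simpleRep_apply, simpleRep_apply, ← h]
  simp only [Matrix.mulVec, dotProduct, Finset.mul_sum, Finset.sum_mul]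
  rw [Finset.sum_comm]
  refine Finset.sum_congr rfl fun j _ => ?_
  rw [← Equiv.sum_comp Fin.revPerm]
  refine Finset.sum_congr rfl fun k _ => ?_
  rw [twistTranspose_apply, Fin.revPerm_apply, Fin.rev_rev, Fin.rev_rev]
  have := hκ j
  field_simp

theorem traceInvariant_of_twistTranspose (hq : IsPrimitiveRoot q n) (hl : l ≤ n) (r : ℤ)
    {κ : ℕ → ℂ} (hκ : ∀ i, κ i ≠ 0)
    (h : ∀ y, twistTranspose κ (matRep hq hl r y) = matRep hq hl r (HopfAlgebra.antipode ℂ y))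
    (hV : IsIrreducible (simpleRep hq hl r)) :
    traceInvariant hV = ∑ i : Fin l, (κ i.rev)⁻¹ * κ i := by
  have hd := isSelfDual_of_twistTranspose hq hl r hκ h
  rw [traceInvariant, dif_pos hd, ← trace_twistTranspose κ,
    -- The trace is invariant under identifying matrices with endomorphisms, and surjectivity of the
    -- representation determines the map from its values on the image.
    ← LinearMap.trace_conj' (twistTranspose κ) (Matrix.toLin' (R := ℂ) (m := Fin l) (n := Fin l))]
  congr 1
  refine LinearMap.ext fun α => ?_
  obtain ⟨y, rfl⟩ := hV.surjective α
  rw [antipodeEnd_apply, LinearEquiv.conj_apply]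
  have h1 : ∀ y, simpleRep hq hl r y = Matrix.toLin' (matRep hq hl r y) := fun y => rfl
  rw [h1, h1, ← h]
  simp

/-- Both sides reverse products, so generators suffice. For a the identity amounts to the recursion
`hs`, for b and c to the congruence `hr`, and for d it follows from the recursion and the symmetry
α_{l-j}(l) = q^{l-2j} α_j(l). -/
theorem twistTranspose_matRep (hq : IsPrimitiveRoot q n) (hl : l ≤ n) (r : ℤ) {κ : ℕ → ℂ}
    (hκ : ∀ i, κ i ≠ 0)
    (hr : (n : ℤ) ∣ 2 * r + l - 1)
    (hs : ∀ k : ℕ, κ (k + 1) = - q ^ (-(r + l - 2 - k)) * κ k) (y : ChenAlgebra hq) :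
    twistTranspose κ (matRep hq hl r y) = matRep hq hl r (HopfAlgebra.antipode ℂ y) := by
  have h0 := hq.ne_zero (NeZero.ne n)
  have hinv : ∀ z : ℤ, (q ^ z) ^ (n - 1) = q ^ (-z) := by
    intro z
    rw [zpow_neg]
    refine eq_inv_of_mul_eq_one_left ?_
    rw [← pow_succ,
      Nat.sub_add_cancel NeZero.one_le, ← zpow_natCast, zpow_comm, zpow_natCast, hq.pow_eq_one,
      one_zpow]
  have hmod : ∀ y z : ℤ, (n : ℤ) ∣ y - z → q ^ y = q ^ z := by
    intro y z h
    have := (hq.zpow_eq_one_iff_dvd _).2 h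
    rw [zpow_sub₀ h0, div_eq_one_iff_eq (zpow_ne_zero _ h0)] at this
    exact this
  have hB : matB q l r ^ (n - 1) = .diagonal fun i : Fin l => q ^ (-(r + i)) := by
    rw [matB, Matrix.diagonal_pow]
    congr 1; ext i; exact hinv _
  have hC : matC q l r ^ (n - 1) = .diagonal fun i : Fin l => q ^ (-((i : ℤ) + 1 - (r + l))) := by
    rw [matC, Matrix.diagonal_pow]
    congr 1; ext i; exact hinv _
  have hrev : ∀ i : Fin l, ((i.rev : ℕ) : ℤ) = l - 1 - i := by
    intro i; rw [Fin.val_rev]; omega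
  have hy : y ∈ Algebra.adjoin ℂ {a hq, b hq, c hq, d hq} :=
    ChenAlgebra.adjoin_eq_top hq ▸ Algebra.mem_top
  induction hy using Algebra.adjoin_induction with
  | mem y hy =>
    rcases hy with rfl | rfl | rfl | rfl
    · rw [antipode_a, map_neg, map_mul, map_pow, lift_a, lift_b, hB]
      ext i j
      rw [twistTranspose_apply, Matrix.neg_apply, Matrix.mul_diagonal]
      by_cases hij : (i : ℕ) = j + 1
      · have h1 : (j.rev : ℕ) = i.rev + 1 := by simp only [Fin.val_rev]; omega
        have h2 : κ j.rev = - q ^ (-(r + (j : ℤ))) * κ i.rev := by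
          rw [h1, hs, hrev]; congr 3; push_cast [hij]; ring
        have := hκ i.rev
        simp only [matA, Matrix.of_apply, if_pos hij, if_pos h1]
        rw [h2]; field_simp
      · have h1 : ¬ (j.rev : ℕ) = i.rev + 1 := by simp only [Fin.val_rev]; omega
        simp only [matA, Matrix.of_apply, if_neg hij, if_neg h1, mul_zero, zero_mul, neg_zero]
    · rw [antipode_b, map_pow, lift_b, hB]
      ext i j
      rw [twistTranspose_apply, matB]
      rcases eq_or_ne i j with rfl | h
      · rw [Matrix.diagonal_apply_eq, Matrix.diagonal_apply_eq, inv_mul_cancel₀ (hκ _), one_mul]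
        refine hmod _ _ ?_
        rw [hrev]; convert hr using 1; ring
      · rw [Matrix.diagonal_apply_ne _ h,
          Matrix.diagonal_apply_ne _ (fun e => h (Fin.rev_injective e).symm), mul_zero]
    · rw [antipode_c, map_pow, lift_c, hC]
      ext i j
      rw [twistTranspose_apply, matC]
      rcases eq_or_ne i j with rfl | h
      · rw [Matrix.diagonal_apply_eq, Matrix.diagonal_apply_eq, inv_mul_cancel₀ (hκ _), one_mul]
        refine hmod _ _ ?_
        rw [hrev, ← Int.dvd_neg]; convert hr using 1; ring
      · rw [Matrix.diagonal_apply_ne _ h,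
          Matrix.diagonal_apply_ne _ (fun e => h (Fin.rev_injective e).symm), mul_zero]
    · rw [antipode_d, map_neg, map_mul, map_pow, lift_d, lift_c, hC]
      ext i j
      rw [twistTranspose_apply, Matrix.neg_apply, Matrix.mul_diagonal]
      by_cases hij : (i : ℕ) + 1 = j
      · have h1 : (j.rev : ℕ) + 1 = i.rev := by simp only [Fin.val_rev]; omega
        have hj := j.2
        have h2 : κ i.rev = - q ^ (-(r + (j : ℤ) - 1)) * κ j.rev := by
          rw [← h1, hs, hrev]; congr 3; ring
        -- An entry above the diagonal exists only for l ≥ 2, hence n ≥ 2 and q ≠ 1; the q-integers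
        -- can then be replaced by (q^k - 1)/(q - 1).
        have hq1 : q - 1 ≠ 0 := sub_ne_zero.2 fun e => by
          have : n = 1 := by rw [e] at hq; exact hq.unique .one
          omega
        have h3 : alpha q l i.rev = q ^ ((l : ℤ) - 2 * j) * alpha q l j := by
          have e1 := qInt_mul_sub_one (q := q) (i.rev : ℕ)
          have e2 := qInt_mul_sub_one (q := q) (j : ℕ)
          have e3 : (((i.rev : ℕ) : ℤ)) = l - j := by rw [hrev]; omega
          rw [← zpow_natCast, e3] at e1
          rw [← zpow_natCast] at e2
          refine mul_right_cancel₀ hq1 ?_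
          rw [alpha, alpha, mul_right_comm, e1, mul_assoc (q ^ _), mul_right_comm (qInt q j), e2, e3]
          have e4 : q ^ ((l : ℤ) - j - l) = (q ^ (j : ℤ))⁻¹ := by
            rw [← zpow_neg]; congr 1; ring
          rw [e4, zpow_sub₀ h0, zpow_sub₀ h0, zpow_sub₀ h0, mul_comm (2 : ℤ), zpow_mul (q) j 2]
          have e5 := zpow_ne_zero (j : ℤ) h0
          have e6 := zpow_ne_zero (l : ℤ) h0
          generalize q ^ (j : ℤ) = x at *
          generalize q ^ (l : ℤ) = z at *
          rw [zpow_ofNat]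
          field_simp
        have h4 : q ^ (-((j : ℤ) + 1 - (r + l))) =
            (q ^ (-(r + (j : ℤ) - 1)))⁻¹ * q ^ ((l : ℤ) - 2 * j) := by
          rw [← zpow_neg, ← zpow_add₀ h0]; congr 1; ring
        have h5 := hκ j.rev
        have h6 := zpow_ne_zero (-(r + (j : ℤ) - 1)) h0
        simp only [matD, Matrix.of_apply, if_pos hij, if_pos h1]
        rw [h2, h3, h4]; field_simp
      · have h1 : ¬ (j.rev : ℕ) + 1 = i.rev := by simp only [Fin.val_rev]; omega
        simp only [matD, Matrix.of_apply, if_neg hij, if_neg h1, mul_zero, zero_mul, neg_zero]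
  | algebraMap s =>
    simp [Algebra.algebraMap_eq_smul_one, twistTranspose_one hκ]
  | add y z _ _ hy hz => simp only [map_add, hy, hz]
  | mul y z _ _ hy hz =>
    rw [map_mul, twistTranspose_mul hκ, hy, hz, HopfAlgebra.antipode_mul_antidistrib, map_mul]

theorem traceInvariant_simpleRep {q : ℂ} (hq : IsPrimitiveRoot q n)
    (hp : IsPrimitiveRoot (q ^ 2) n) (hl : l ≤ n) (r : ℤ) (h1 : 1 ≤ l)
    (hV : IsIrreducible (simpleRep hp hl r)) : traceInvariant hV =
      if 2 * r ≡ 1 - (l : ℤ) [ZMOD (n : ℤ)] then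
        ∑ j ∈ Finset.Icc 1 l, (-q) ^ ((l : ℤ) - 2 * (j : ℤ) + 1) else 0 := by
  have h0 := hq.ne_zero (NeZero.ne n)
  split_ifs with hr
  -- By the congruence, q² to the power -(r+l-2-k) equals q^{2k+3-l}. The exponent k(k+2-l) is the
  -- sum of 2m + 3 - l over m < k, so this κ solves the recursion with κ(0) = 1.
  · let κ : ℕ → ℂ := fun k => (-1) ^ k * q ^ ((k : ℤ) * (k + 2 - l))
    have hκ : ∀ k, κ k ≠ 0 := fun k =>
      mul_ne_zero (pow_ne_zero _ (neg_ne_zero.2 one_ne_zero)) (zpow_ne_zero _ h0)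
    have hr' : (n : ℤ) ∣ 2 * r + l - 1 := by
      rw [Int.modEq_iff_dvd, ← Int.dvd_neg] at hr
      convert hr using 1; ring
    have hs : ∀ k : ℕ, κ (k + 1) = - (q ^ 2) ^ (-(r + l - 2 - k)) * κ k := by
      intro k
      have e1 : (q ^ 2) ^ (-(r + l - 2 - k)) = q ^ (2 * k + 3 - l : ℤ) := by
        rw [← zpow_natCast q 2, ← zpow_mul]
        have := (hq.zpow_eq_one_iff_dvd _).2 hr'
        rw [show ((2 : ℕ) : ℤ) * (-(r + l - 2 - k)) = (2 * k + 3 - l) - (2 * r + l - 1) by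
          push_cast; ring, zpow_sub₀ h0, this, div_one]
      have e2 : q ^ (((k + 1 : ℕ) : ℤ) * ((k + 1 : ℕ) + 2 - l)) =
          q ^ (2 * k + 3 - l : ℤ) * q ^ ((k : ℤ) * (k + 2 - l)) := by
        rw [← zpow_add₀ h0]; congr 1; push_cast; ring
      simp only [κ]
      rw [e1, e2, pow_succ]; ring
    rw [traceInvariant_of_twistTranspose hp hl r hκ
      (twistTranspose_matRep hp hl r hκ hr' hs) hV]
    have h2 : ∀ i : Fin l, (κ i.rev)⁻¹ * κ i = (-q) ^ (2 * (i : ℕ) - l + 1 : ℤ) := by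
      intro i
      have hrev : ((i.rev : ℕ) : ℤ) = l - 1 - i := by rw [Fin.val_rev]; omega
      have hm : (-1 : ℂ) ≠ 0 := neg_ne_zero.2 one_ne_zero
      simp only [κ]
      rw [neg_eq_neg_one_mul q, mul_zpow, mul_inv, ← zpow_natCast, ← zpow_natCast (-1) (i : ℕ), hrev,
        mul_mul_mul_comm, ← zpow_neg, ← zpow_neg, ← zpow_add₀ h0, ← zpow_add₀ hm]
      congr 2 <;> ring
    simp only [h2]
    rw [Fin.sum_univ_eq_sum_range (fun i : ℕ => (-q) ^ (2 * (i : ℤ) - l + 1)) l]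
    -- The index i from 0 to l - 1 corresponds to j = l - i, turning 2i - l + 1 into l - 2j + 1.
    refine Finset.sum_nbij' (fun i => l - i) (fun j => l - j) ?_ ?_ ?_ ?_ ?_
    · intro i hi; simp only [Finset.mem_range, Finset.mem_Icc] at *; omega
    · intro i hi; simp only [Finset.mem_range, Finset.mem_Icc] at *; omega
    · intro i hi; simp only [Finset.mem_range] at *; omega
    · intro i hi; simp only [Finset.mem_Icc] at *; omega
    · intro i hi
      have := Finset.mem_range.1 hi
      congr 1
      omega
  · rw [traceInvariant, dif_neg fun hd => hr ?_]
    have h2 := modEq_of_isSelfDual hp hl r h1 hd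
    exact h2

end SelfDual

end TaftDouble

/-! ### The main theorem, with parameter p = q² -/

open TaftDouble in
theorem mainTheorem1 (n : ℕ) [NeZero n] (hn : Odd n) (q : ℂ) (hq : IsPrimitiveRoot q n) :
    (∃ e : Double (TaftAlgebra (sq_isPrimitiveRoot hn hq)) ≃ₗ[ℂ]
          ChenAlgebra (sq_isPrimitiveRoot hn hq),
      Double.IsHopfIso (TaftAlgebra.antipode_bijective (sq_isPrimitiveRoot hn hq)) e ∧
      ∀ (f : Module.Dual ℂ (TaftAlgebra (sq_isPrimitiveRoot hn hq))) (i j : ℕ), i < n → j < n →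
        e (f ⊗ₜ[ℂ] (TaftAlgebra.x (sq_isPrimitiveRoot hn hq) ^ i *
            TaftAlgebra.g (sq_isPrimitiveRoot hn hq) ^ j)) =
          ∑ s ∈ Finset.range n, ∑ t ∈ Finset.range n,
            f (TaftAlgebra.x (sq_isPrimitiveRoot hn hq) ^ s *
                TaftAlgebra.g (sq_isPrimitiveRoot hn hq) ^ t) •
              ∑ m ∈ Finset.range n,
                (1 / ((n : ℂ) * qFactorial (q ^ 2) s) * (q ^ 2) ^ (-((t : ℤ) * m))) •
                  (ChenAlgebra.c (sq_isPrimitiveRoot hn hq) ^ m *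
                    ChenAlgebra.d (sq_isPrimitiveRoot hn hq) ^ s *
                    ChenAlgebra.a (sq_isPrimitiveRoot hn hq) ^ i *
                    ChenAlgebra.b (sq_isPrimitiveRoot hn hq) ^ j)) ∧
    ∀ (l : ℕ) (r : ℤ), 1 ≤ l → ∀ hl : l ≤ n,
      ∃ hV : IsIrreducible (simpleRep (sq_isPrimitiveRoot hn hq) hl r),
        traceInvariant hV =
          if 2 * r ≡ 1 - (l : ℤ) [ZMOD (n : ℤ)] then
            ∑ j ∈ Finset.Icc 1 l, (-q) ^ ((l : ℤ) - 2 * (j : ℤ) + 1)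
          else 0 := by
  refine ⟨⟨doubleEquiv _, doubleEquiv_isHopfIso _, fun f i j _ _ => doubleEquiv_tmul _ f i j⟩, ?_⟩
  intro l r h1 hl
  exact ⟨simpleRep_isIrreducible _ hl r h1, traceInvariant_simpleRep hq _ hl r h1 _⟩
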